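/- Work in the hyperbolic plane $\mathbb H^2$. An *ortho geodesic* of a collection $\mathcal G$ of geodesics is a geodesic segment of positive length, each of whose two endpoints lies on an element of $\mathcal G$ and at which it is orthogonal to that element. The *ortho spectrum* of $\mathcal G$ is the set of lengths of its ortho geodesics, counted with multiplicity. If $D\subset\mathbb H^2$ is a convex region invariant under a discrete group $\Gamma$ acting freely on it, the ortho spectrum of the surface $D/\Gamma$ is the set of lengths, with multiplicity, of the $\Gamma$-orbits of ortho geodesics of the collection of all complete geodesics contained in $\partial D$. Quotients $D/\Gamma$ carry the quotient hyperbolic metric. Two hyperbolic surfaces are *commensurable* if they have a common connected covering of finite degree (by locally isometric covering maps). **Construction.** Let $\gamma$ be an orientation-preserving isometry of $\mathbb H^2$ and $g$ a geodesic such that for every $i\in\mathbb Z$ either $g\cap\gamma^i g=\emptyset$ or $\gamma^i g=g$, and all $\gamma^i g\neq g$ lie in one component $U$ of $\mathbb H^2\setminus g$. Let $\mathcal G_0$ be a non-empty collection of mutually disjoint geodesics contained in the closed half plane $\mathbb H^2\setminus U$. Let $n\ge 1$, let $X'$ be an $n$-element set of vertices of the cycle graph $C_{2n}$ with vertices $0,\dots,2n-1$,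 let $\overline{X'}$ be its complement, and let $X,\overline X\subset\mathbb Z$ be the sets of integers whose residues modulo $2n$ lie in $X'$, $\overline{X'}$ respectively. Put $\mathcal G_X=\bigcup_{i\in X}\gamma^i(\mathcal G_0)$ and $\mathcal G_{\overline X}=\bigcup_{i\in\overline X}\gamma^i(\mathcal G_0)$, and let $H_X$ (resp. $H_{\overline X}$) be the connected component of the complement of $\bigcup\mathcal G_X$ (resp. $\bigcup\mathcal G_{\overline X}$) whose boundary contains all of $\mathcal G_X$ (resp. $\mathcal G_{\overline X}$), assuming that such components exist. Call $X'$ and $\overline{X'}$ *congruent* if an automorphism of the graph $C_{2n}$ maps one onto the other. Let $m\geq 1$ with $2n\mid m$. **Statement.** 1. If $\gamma$ is parabolic, then $H_X/\langle\gamma^m\rangle$ and $H_{\overline X}/\langle\gamma^m\rangle$ are connected hyperbolic surfaces with a puncture (a cusp). They have the same ortho spectrum, as do the boundary collections of their universal coverings $H_X$ and $H_{\overline X}$, and they are not isometric whenever $X'$ and $\overline{X'}$ are incongruent. 2. If $\gamma$ is hyperbolic with axis $h$ disjoint from $g$, and $H'$ is the half plane with respect to $h$, including $h$, that contains $g$,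 then $(H_X\cap H')/\langle\gamma^m\rangle$ and $(H_{\overline X}\cap H')/\langle\gamma^m\rangle$ are connected hyperbolic surfaces whose boundary is one closed totally geodesic curve (the geodesics of $\mathcal G_X$, $\mathcal G_{\overline X}$ not being part of the surfaces). They have the same ortho spectrum (the boundary of the universal covering here includes $h$), as do the boundary collections of their universal coverings, and they are not isometric whenever $X'$ and $\overline{X'}$ are incongruent. 3. If $n=4$ and $X'=\{0,1,2,5\}$, $\overline{X'}=\{3,4,6,7\}$ (the Mallows–Clark pair), then the two surfaces in 1, and the two surfaces in 2, are incommensurable. 4. Such surfaces exist: there are a parabolic $\gamma$ and a $g$, and a hyperbolic $\gamma$ and a $g$ disjoint from its axis, that satisfy the assumptions with $\mathcal G_0=\{g\}$. For every such $\gamma$ and $g$, with $\mathcal G_0=\{g\}$, and every $A\subset\mathbb Z$ there is a connected component of the complement of $\bigcup_{i\in A}\gamma^i g$ whose boundary contains every $\gamma^i g$, $i\in A$; in particular $H_X$ and $H_{\overline X}$ exist. In particular, there are incommensurable hyperbolic surfaces with the same ortho spectrum. -/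

import Mathlib

open Set Topology UpperHalfPlane MatrixGroups Pointwise

noncomputable section

namespace OrthoSurf

/-! ### Geodesics and ortho geodesics of the hyperbolic plane `ℍ` -/

/-- A unit speed parametrisation of a complete geodesic of the hyperbolic plane: an isometric
embedding of the real line. -/
def IsGeodesicCurve (c : ℝ → ℍ) : Prop := Isometry c

/-- A complete (unparametrised) geodesic. -/
def IsGeodesic (s : Set ℍ) : Prop := ∃ c : ℝ → ℍ, IsGeodesicCurve c ∧ s = range c

/-- The geodesic curve `c` meets the geodesic `s` orthogonally at the time `t`. The velocities are
compared in the Euclidean inner product of `ℂ`: the hyperbolic metric is conformal to it. -/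
def OrthogonalAt (c : ℝ → ℍ) (t : ℝ) (s : Set ℍ) : Prop :=
  ∃ e : ℝ → ℍ, IsGeodesicCurve e ∧ s = range e ∧ ∃ u : ℝ, e u = c t ∧
    inner ℝ (deriv (fun v => (c v : ℂ)) t) (deriv (fun v => (e v : ℂ)) u) = 0

/-- The ortho geodesics of length `l` of a collection `𝒢` of geodesics: the (unoriented) geodesic
segments of length `l > 0` that are orthogonal at each of their two ends to an element of `𝒢`. -/
def orthoGeodesics (𝒢 : Set (Set ℍ)) (l : ℝ) : Set (Set ℍ) :=
  {σ | 0 < l ∧ ∃ c : ℝ → ℍ, IsGeodesicCurve c ∧ σ = c '' Icc 0 l ∧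
    ∃ a ∈ 𝒢, ∃ b ∈ 𝒢, OrthogonalAt c 0 a ∧ OrthogonalAt c l b}

/-- The ortho spectrum of a collection of geodesics: the multiset of the lengths of its ortho
geodesics, as the function that maps `l` to the multiplicity of `l`. -/
def orthoSpectrum (𝒢 : Set (Set ℍ)) : ℝ → ℕ∞ := fun l => (orthoGeodesics 𝒢 l).encard

/-- The complete geodesics that make up the boundary of a region of the hyperbolic plane. -/
def boundaryGeodesics (D : Set ℍ) : Set (Set ℍ) := {s | IsGeodesic s ∧ s ⊆ frontier D}

/-- The ortho spectrum of the surface `D / Γ` with universal covering `D`: an ortho geodesic of the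
surface is a `Γ`-orbit of ortho geodesics of the boundary geodesics of `D`. -/
def surfaceOrthoSpectrum (Γ : Subgroup SL(2, ℝ)) (D : Set ℍ) : ℝ → ℕ∞ := fun l =>
  {o : Set (Set ℍ) | ∃ σ ∈ orthoGeodesics (boundaryGeodesics D) l,
    o = MulAction.orbit Γ σ}.encard

/-! ### Quotients of regions of the hyperbolic plane, with their metric -/

/-- Points of `D` that differ by an element of `Γ`. -/
def quotientSetoid (Γ : Subgroup SL(2, ℝ)) (D : Set ℍ) : Setoid D where
  r x y := ∃ γ ∈ Γ, γ • (x : ℍ) = (y : ℍ)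
  iseqv :=
    { refl := fun x => ⟨1, Γ.one_mem, one_smul _ _⟩
      symm := by
        rintro x y ⟨γ, hγ, h⟩
        exact ⟨γ⁻¹, Γ.inv_mem hγ, by rw [← h, inv_smul_smul]⟩
      trans := by
        rintro x y z ⟨γ, hγ, h⟩ ⟨δ, hδ, h'⟩
        exact ⟨δ * γ, Γ.mul_mem hδ hγ, by rw [mul_smul, h, h']⟩ }

/-- The quotient `D / Γ`. -/
def QuotientSurface (Γ : Subgroup SL(2, ℝ)) (D : Set ℍ) : Type := Quotient (quotientSetoid Γ D)

/-- The distance of two `Γ`-orbits. -/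
def orbitDist (Γ : Subgroup SL(2, ℝ)) (z w : ℍ) : ℝ := ⨅ γ : Γ, dist z ((γ : SL(2, ℝ)) • w)

theorem orbitDist_bddBelow (Γ : Subgroup SL(2, ℝ)) (z w : ℍ) :
    BddBelow (range fun γ : Γ => dist z ((γ : SL(2, ℝ)) • w)) :=
  ⟨0, by rintro _ ⟨γ, rfl⟩; exact dist_nonneg⟩

theorem orbitDist_le (Γ : Subgroup SL(2, ℝ)) (z w : ℍ) {γ : SL(2, ℝ)} (hγ : γ ∈ Γ) :
    orbitDist Γ z w ≤ dist z (γ • w) :=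
  ciInf_le (orbitDist_bddBelow Γ z w) ⟨γ, hγ⟩

theorem orbitDist_self (Γ : Subgroup SL(2, ℝ)) (z : ℍ) : orbitDist Γ z z = 0 := by
  refine le_antisymm ?_ (le_ciInf fun _ => dist_nonneg)
  simpa using orbitDist_le Γ z z Γ.one_mem

theorem orbitDist_comm_le (Γ : Subgroup SL(2, ℝ)) (z w : ℍ) :
    orbitDist Γ z w ≤ orbitDist Γ w z := by
  refine le_ciInf fun γ => ?_
  refine (orbitDist_le Γ z w (Γ.inv_mem γ.2)).trans (le_of_eq ?_)
  rw [← dist_smul (γ : SL(2, ℝ)), smul_inv_smul, dist_comm]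

theorem orbitDist_comm (Γ : Subgroup SL(2, ℝ)) (z w : ℍ) : orbitDist Γ z w = orbitDist Γ w z :=
  le_antisymm (orbitDist_comm_le Γ z w) (orbitDist_comm_le Γ w z)

theorem orbitDist_triangle (Γ : Subgroup SL(2, ℝ)) (x y z : ℍ) :
    orbitDist Γ x z ≤ orbitDist Γ x y + orbitDist Γ y z := by
  refine le_ciInf_add_ciInf fun γ δ => ?_
  refine (orbitDist_le Γ x z (Γ.mul_mem γ.2 δ.2)).trans ?_
  refine (dist_triangle _ ((γ : SL(2, ℝ)) • y) _).trans ?_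
  rw [mul_smul, dist_smul]

theorem orbitDist_smul_right (Γ : Subgroup SL(2, ℝ)) (z w : ℍ) {γ : SL(2, ℝ)} (hγ : γ ∈ Γ) :
    orbitDist Γ z (γ • w) = orbitDist Γ z w := by
  refine le_antisymm (le_ciInf fun δ => ?_) (le_ciInf fun δ => ?_)
  · refine (orbitDist_le Γ z _ (Γ.mul_mem δ.2 (Γ.inv_mem hγ))).trans (le_of_eq ?_)
    rw [mul_smul, inv_smul_smul]
  · refine (orbitDist_le Γ z _ (Γ.mul_mem δ.2 hγ)).trans (le_of_eq ?_)
    rw [mul_smul]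

/-- The quotient metric. (For a convex `Γ`-invariant region `D` it is the path metric of the
surface `D / Γ`.) -/
instance quotientPseudoMetricSpace (Γ : Subgroup SL(2, ℝ)) (D : Set ℍ) : PseudoMetricSpace (QuotientSurface Γ D) where
  dist := Quotient.lift₂ (fun x y : D => orbitDist Γ x y) (by
    rintro x y x' y' ⟨γ, hγ, h⟩ ⟨δ, hδ, h'⟩
    rw [← h, ← h', orbitDist_smul_right Γ _ _ hδ, orbitDist_comm Γ (γ • _),
      orbitDist_smul_right Γ _ _ hγ, orbitDist_comm])
  dist_self := by rintro ⟨x⟩; exact orbitDist_self Γ x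
  dist_comm := by rintro ⟨x⟩ ⟨y⟩; exact orbitDist_comm Γ x y
  dist_triangle := by rintro ⟨x⟩ ⟨y⟩ ⟨z⟩; exact orbitDist_triangle Γ x y z

/-! ### Hyperbolic surfaces, cusps, commensurability -/

/-- `S` is a connected hyperbolic surface with (possibly empty) totally geodesic boundary `B`: a
point outside `B` has a ball that is isometric to a ball of `ℍ`, and a point of `B` has a ball that
is isometric to a half ball centred at a point of a geodesic, `B` corresponding to that geodesic. -/
structure IsHyperbolicSurface (S : Type) [PseudoMetricSpace S] (B : Set S) : Prop where
  connected : ConnectedSpace S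
  interior_chart : ∀ p ∉ B, ∃ ε > 0,
    Nonempty (Metric.ball p ε ≃ᵢ Metric.ball (UpperHalfPlane.I : ℍ) ε)
  boundary_chart : ∀ p ∈ B, ∃ ε > 0,
    ∃ e : Metric.ball p ε ≃ᵢ {w : ℍ | w ∈ Metric.ball UpperHalfPlane.I ε ∧ 0 ≤ w.re},
      ∀ q : Metric.ball p ε, (q : S) ∈ B ↔ (e q : ℍ).re = 0

/-- The translation `z ↦ z + 1`. -/
def unitTranslation : SL(2, ℝ) := ⟨!![1, 1; 0, 1], by simp⟩

/-- `S` has a puncture (a cusp): an open subset is isometric to the quotient of a horoball by a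
parabolic translation. -/
def HasCusp (S : Type) [PseudoMetricSpace S] : Prop :=
  ∃ c > 0, ∃ f : QuotientSurface (Subgroup.zpowers unitTranslation) {z : ℍ | c < z.im} → S,
    Isometry f ∧ IsOpen (range f)

/-- A hyperbolic surface without boundary that has a puncture. -/
def IsPuncturedSurface (S : Type) [PseudoMetricSpace S] : Prop :=
  IsHyperbolicSurface S ∅ ∧ HasCusp S

/-- A hyperbolic surface whose boundary is one closed geodesic. -/
def HasOneGeodesicBoundary (S : Type) [PseudoMetricSpace S] : Prop :=
  ∃ B : Set S, IsHyperbolicSurface S B ∧ IsConnected B ∧ IsCompact B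

/-- `S` and `S'` are isometric. -/
def AreIsometric (S S' : Type) [PseudoMetricSpace S] [PseudoMetricSpace S'] : Prop :=
  Nonempty (S ≃ᵢ S')

/-- A covering of finite degree that is locally isometric. -/
structure IsFiniteCover {Z S : Type} [PseudoMetricSpace Z] [PseudoMetricSpace S] (f : Z → S) :
    Prop where
  covering : IsCoveringMap f
  surjective : Function.Surjective f
  finite_degree : ∀ p, (f ⁻¹' {p}).Finite
  locally_isometric : ∀ z, ∃ U ∈ 𝓝 z, ∀ x ∈ U, ∀ y ∈ U, dist (f x) (f y) = dist x y

/-- `S` and `S'` are commensurable: they have a common (connected) covering of finite degree. -/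
def AreCommensurable (S S' : Type) [PseudoMetricSpace S] [PseudoMetricSpace S'] : Prop :=
  ∃ (Z : Type) (_ : MetricSpace Z) (f : Z → S) (f' : Z → S'),
    ConnectedSpace Z ∧ IsFiniteCover f ∧ IsFiniteCover f'

/-! ### The construction -/

/-- `U` is a connected component of the subset `s` of the hyperbolic plane. -/
def IsComponentOf (U s : Set ℍ) : Prop := ∃ x ∈ s, U = connectedComponentIn s x

/-- The standing assumptions on an isometry `γ`, a geodesic `g` and a collection `𝒢₀`: each
`γ ^ i g` is equal to `g` or disjoint from it, those that differ from `g` lie in one component `U`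
of the complement of `g`, and `𝒢₀` is a non-empty collection of mutually disjoint geodesics in the
other half plane (with its boundary line `g`). -/
structure IsSetup (γ : SL(2, ℝ)) (g : Set ℍ) (𝒢₀ : Set (Set ℍ)) : Prop where
  geodesic : IsGeodesic g
  disjoint_or_eq : ∀ i : ℤ, Disjoint g (γ ^ i • g) ∨ g = γ ^ i • g
  nonempty : 𝒢₀.Nonempty
  geodesics : ∀ a ∈ 𝒢₀, IsGeodesic a
  pairwiseDisjoint : 𝒢₀.PairwiseDisjoint id
  half_plane : ∃ U, IsComponentOf U gᶜ ∧ (∀ i : ℤ, γ ^ i • g ≠ g → γ ^ i • g ⊆ U) ∧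
    ∀ a ∈ 𝒢₀, a ⊆ Uᶜ

/-- The preimage in `ℤ`, the vertex set of the universal covering of the cycle graph with `2 * n`
vertices, of a set of vertices of that cycle. -/
def cycleLift {n : ℕ} (X : Finset (Fin (2 * n))) : Set ℤ :=
  {i | ∃ v ∈ X, (v : ℤ) = i % ((2 * n : ℕ) : ℤ)}

/-- The union of the collections `γ ^ i 𝒢₀` over the indices `i ∈ A`. -/
def translates (γ : SL(2, ℝ)) (𝒢₀ : Set (Set ℍ)) (A : Set ℤ) : Set (Set ℍ) :=
  {s | ∃ i ∈ A, ∃ a ∈ 𝒢₀, s = γ ^ i • a}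

/-- `D` is a connected component of the complement of (the union of) `𝒢` whose boundary contains
every element of `𝒢`. -/
def IsFace (𝒢 : Set (Set ℍ)) (D : Set ℍ) : Prop :=
  IsComponentOf D (⋃₀ 𝒢)ᶜ ∧ ∀ s ∈ 𝒢, s ⊆ frontier D

/-- Two sets of vertices of a cycle graph are congruent if an automorphism of the graph maps one
onto the other. -/
def AreCongruent {k : ℕ} (X Y : Finset (Fin k)) : Prop :=
  ∃ φ : SimpleGraph.cycleGraph k ≃g SimpleGraph.cycleGraph k, X.image φ = Y

/-- One set of the Mallows-Clark pair of four-point subsets of the cycle with eight vertices; the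
other one is its complement `{3, 4, 6, 7}`. -/
def mallowsClark : Finset (Fin (2 * 4)) := {0, 1, 2, 5}

/-- The data of the construction: `X` consists of half of the vertices of the cycle with `2 * n`
vertices, `m` is a positive multiple of `2 * n`, and `D` and `D'` are the regions bounded by the
translates of `𝒢₀` with indices in `X` and in its complement. -/
structure IsPair (γ : SL(2, ℝ)) (g : Set ℍ) (𝒢₀ : Set (Set ℍ)) {n : ℕ}
    (X : Finset (Fin (2 * n))) (m : ℕ) (D D' : Set ℍ) : Prop where
  setup : IsSetup γ g 𝒢₀
  n_pos : 0 < n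
  card : X.card = n
  m_pos : 0 < m
  dvd : 2 * n ∣ m
  face : IsFace (translates γ 𝒢₀ (cycleLift X)) D
  face_compl : IsFace (translates γ 𝒢₀ (cycleLift Xᶜ)) D'

/-- `γ` is a parabolic isometry of the hyperbolic plane. -/
def Parabolic (γ : SL(2, ℝ)) : Prop := (γ : Matrix (Fin 2) (Fin 2) ℝ).IsParabolic

/-- `γ` is hyperbolic, its axis is disjoint from `g`, and `H` is the half plane with respect to the
axis (including the axis) that contains `g`. -/
def HyperbolicWithSide (γ : SL(2, ℝ)) (g H : Set ℍ) : Prop :=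
  (γ : Matrix (Fin 2) (Fin 2) ℝ).IsHyperbolic ∧
    ∃ h : Set ℍ, IsGeodesic h ∧ γ • h = h ∧ Disjoint h g ∧
      ∃ W, IsComponentOf W hᶜ ∧ g ⊆ W ∧ H = W ∪ h

/-- The surface `D / ⟨γ ^ m⟩`. -/
abbrev CyclicQuotient (γ : SL(2, ℝ)) (m : ℕ) (D : Set ℍ) : Type :=
  QuotientSurface (Subgroup.zpowers (γ ^ m)) D

/-- The surfaces `D / ⟨γ ^ m⟩` and `D' / ⟨γ ^ m⟩` have the same ortho spectrum, and so have the
collections of geodesics that bound their universal coverings `D` and `D'`. -/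
def SameOrthoSpectrum (γ : SL(2, ℝ)) (m : ℕ) (D D' : Set ℍ) : Prop :=
  surfaceOrthoSpectrum (Subgroup.zpowers (γ ^ m)) D =
      surfaceOrthoSpectrum (Subgroup.zpowers (γ ^ m)) D' ∧
    orthoSpectrum (boundaryGeodesics D) = orthoSpectrum (boundaryGeodesics D')

end OrthoSurf

end

open OrthoSurf

noncomputable section

namespace OrthoSurf

/-! ### Möbius transformations, geodesics and isometries of the hyperbolic plane -/

/-! Equality of the spectra is a counting argument. Take the translates of `𝒢₀` by all powers of
`γ`. The sets `γ ^ i • Uᶜ` are disjoint, so each end of an ortho geodesic of this full collection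
carries one index, or none if it lies on the axis, and the index set is empty or `{i, i + d}` with
`d ≥ 0`. The segment belongs to the collection of `X` exactly if its indices lie in the lift of `X`.
Since `X` is half of the cycle, inclusion-exclusion gives as many `v` with `v, v + d ∈ X` as with
`v, v + d ∉ X` (`card_pairs`). Hence for each `d` some permutation `ψ d` of `ℤ`, commuting with
translation by `2n`, matches the two sets of lifts (`exists_perm_cycleLift`). Moving a segment with
indices `{i, i + d}` by `γ ^ (ψ d i - i)` preserves its length and commutes with `γ ^ m`; this is a
bijection of segments and of orbits (`IsCore.sameOrthoSpectrum`).

Commensurability forces congruence, for every `X`. The regions are convex, so their projections lift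
to a common finite covering, and developing yields an isometry `F` of `ℍ` that maps one region onto
the other. By finiteness of the degree `F` conjugates a nontrivial power of `γ` to a power of `γ`
(`AreCommensurable.exists_isometryEquiv`). For parabolic `γ` this makes `F` a Euclidean similarity
in suitable coordinates; its factor is 1, because the heights of the points of `𝒢₀` are bounded. For
hyperbolic `γ` no factor can occur. So `F` conjugates `γ` to `γ` or its inverse, permutes boundary
geodesics, and acts on their indices by `i ↦ ± i + c`, which is an automorphism of the cycle
(`IsCore.areCongruent`). Isometric surfaces are commensurable, and the Mallows-Clark pair is
incongruent.

The geometric basis is that each region is an intersection of half planes with disjoint complements.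
Such families are locally finite (`not_three_near`), so the intersection is open and its boundary
geodesics are exactly those of the half planes. -/

theorem det_entries (M : SL(2, ℝ)) : M 0 0 * M 1 1 - M 0 1 * M 1 0 = 1 := by
  have := M.det_coe
  rwa [Matrix.det_fin_two] at this

theorem denom_sq_pos (M : SL(2, ℝ)) (z : ℍ) :
    0 < (M 1 0 * z.re + M 1 1) ^ 2 + (M 1 0 * z.im) ^ 2 := by
  have hd := det_entries M
  by_contra hneg
  have h1 : (M 1 0 * z.re + M 1 1) = 0 := by nlinarith [sq_nonneg (M 1 0 * z.im), sq_nonneg (M 1 0 * z.re + M 1 1)]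
  have h2 : M 1 0 * z.im = 0 := by nlinarith [sq_nonneg (M 1 0 * z.im), sq_nonneg (M 1 0 * z.re + M 1 1)]
  have h3 : M 1 0 = 0 := (mul_eq_zero.1 h2).resolve_right z.im_pos.ne'
  rw [h3] at h1 hd
  simp at h1
  rw [h1] at hd
  simp at hd

theorem coe_smul_eq (M : SL(2, ℝ)) (z : ℍ) :
    ((M • z : ℍ) : ℂ) = ((M 0 0 : ℂ) * z + M 0 1) / ((M 1 0 : ℂ) * z + M 1 1) := by
  rw [UpperHalfPlane.specialLinearGroup_apply]
  rfl

theorem smul_re (M : SL(2, ℝ)) (z : ℍ) : (M • z).re =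
    (M 0 0 * M 1 0 * (z.re ^ 2 + z.im ^ 2) + (M 0 0 * M 1 1 + M 0 1 * M 1 0) * z.re
      + M 0 1 * M 1 1) / ((M 1 0 * z.re + M 1 1) ^ 2 + (M 1 0 * z.im) ^ 2) := by
  rw [← UpperHalfPlane.coe_re, coe_smul_eq, Complex.div_re]
  have h := denom_sq_pos M z
  simp only [Complex.normSq_apply, Complex.add_re, Complex.mul_re, Complex.ofReal_re,
    Complex.ofReal_im, Complex.add_im, Complex.mul_im, coe_re, coe_im, zero_mul, sub_zero, add_zero]
  rw [← add_div, ← sq, ← sq]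
  congr 1
  ring

theorem smul_im (M : SL(2, ℝ)) (z : ℍ) :
    (M • z).im = z.im / ((M 1 0 * z.re + M 1 1) ^ 2 + (M 1 0 * z.im) ^ 2) := by
  rw [← UpperHalfPlane.coe_im, coe_smul_eq, Complex.div_im]
  have h := denom_sq_pos M z
  simp only [Complex.normSq_apply, Complex.add_re, Complex.mul_re, Complex.ofReal_re,
    Complex.ofReal_im, Complex.add_im, Complex.mul_im, coe_re, coe_im, zero_mul, sub_zero, add_zero]
  rw [← sub_div, ← sq, ← sq]
  congr 1
  linear_combination z.im * det_entries M

theorem cosh_dist_eq (z w : ℍ) : Real.cosh (dist z w) =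
    ((z.re - w.re) ^ 2 + z.im ^ 2 + w.im ^ 2) / (2 * z.im * w.im) := by
  rw [UpperHalfPlane.cosh_dist']

theorem dist_eq_iff_cosh {a b c d : ℍ} :
    dist a b = dist c d ↔ Real.cosh (dist a b) = Real.cosh (dist c d) :=
  ⟨fun h => by rw [h], fun h => Real.cosh_strictMonoOn.injOn dist_nonneg dist_nonneg h⟩

theorem ext_re_im {z w : ℍ} (h : z.re = w.re) (h' : z.im = w.im) : z = w :=
  UpperHalfPlane.ext (Complex.ext h h')

/-- The matrix with the given entries and determinant one. -/
def mkSL (a b c d : ℝ) (h : a * d - b * c = 1) : SL(2, ℝ) :=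
  ⟨!![a, b; c, d], by rw [Matrix.det_fin_two_of, h]⟩

section
variable (a b c d : ℝ) (h : a * d - b * c = 1)
@[simp] theorem mkSL_zero_zero : mkSL a b c d h 0 0 = a := rfl
@[simp] theorem mkSL_zero_one : mkSL a b c d h 0 1 = b := rfl
@[simp] theorem mkSL_one_zero : mkSL a b c d h 1 0 = c := rfl
@[simp] theorem mkSL_one_one : mkSL a b c d h 1 1 = d := rfl
end

/-- The unit speed parametrisation of the imaginary axis. -/
def expI (t : ℝ) : ℍ := ⟨⟨0, Real.exp t⟩, Real.exp_pos t⟩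

@[simp] theorem expI_re (t : ℝ) : (expI t).re = 0 := rfl
@[simp] theorem expI_im (t : ℝ) : (expI t).im = Real.exp t := rfl

theorem isometry_expI : Isometry expI := isometry_vertical_line 0

theorem expI_zero : expI 0 = UpperHalfPlane.I := by
  exact ext_re_im (by simp) (by simp)

theorem expI_log {z : ℍ} (h : z.re = 0) : expI (Real.log z.im) = z :=
  ext_re_im (by simp [h]) (by simp [Real.exp_log z.im_pos])

theorem range_expI : range expI = {z : ℍ | z.re = 0} := by
  ext z
  exact ⟨by rintro ⟨t, rfl⟩; rfl, fun h => ⟨_, expI_log h⟩⟩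

/-- Clearing denominators and subtracting the two distance equations determines `im`, because the
centres have different heights 1 and `exp r`. Only the sign of `re`, that is the reflection in the
axis, stays open. -/
theorem im_eq_of_dist_expI {w w' : ℍ} {r : ℝ} (hr : r ≠ 0)
    (h0 : dist w (expI 0) = dist w' (expI 0)) (h1 : dist w (expI r) = dist w' (expI r)) :
    w.im = w'.im ∧ w.re ^ 2 = w'.re ^ 2 := by
  rw [dist_eq_iff_cosh, cosh_dist_eq, cosh_dist_eq] at h0 h1
  simp only [expI_re, expI_im, sub_zero, Real.exp_zero] at h0 h1
  have hy := w.im_pos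
  have hy' := w'.im_pos
  have hE := Real.exp_pos r
  have hE1 : Real.exp r ^ 2 - 1 ≠ 0 := by
    intro h
    have : Real.exp r = 1 := by nlinarith
    exact hr (by simpa using this)
  rw [div_eq_div_iff (by positivity) (by positivity)] at h0 h1
  have e0 : (w.re ^ 2 + w.im ^ 2 + 1) * w'.im = (w'.re ^ 2 + w'.im ^ 2 + 1) * w.im := by
    linear_combination h0 / 2
  have e1 : (w.re ^ 2 + w.im ^ 2 + Real.exp r ^ 2) * w'.im
      = (w'.re ^ 2 + w'.im ^ 2 + Real.exp r ^ 2) * w.im := by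
    apply mul_left_cancel₀ hE.ne'
    linear_combination h1 / 2
  have e2 : (Real.exp r ^ 2 - 1) * (w'.im - w.im) = 0 := by linear_combination e1 - e0
  have e3 : w.im = w'.im := by
    have := (mul_eq_zero.1 e2).resolve_left hE1
    linarith
  refine ⟨e3, ?_⟩
  rw [e3] at e0
  have := mul_right_cancel₀ hy'.ne' e0
  linarith

/-- The rotation about `I` through the angle `2 * θ`. -/
def rot (θ : ℝ) : SL(2, ℝ) := mkSL (Real.cos θ) (Real.sin θ) (-Real.sin θ) (Real.cos θ) (by
  nlinarith [Real.sin_sq_add_cos_sq θ])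

theorem rot_smul_I (θ : ℝ) : rot θ • UpperHalfPlane.I = UpperHalfPlane.I := by
  apply ext_re_im
  · rw [smul_re]
    simp [rot, UpperHalfPlane.I_re, UpperHalfPlane.I_im]
    ring
  · rw [smul_im]
    simp [rot, UpperHalfPlane.I_re, UpperHalfPlane.I_im]

/-- Intermediate value theorem: the half turn at `θ = π / 2` reverses the sign of the numerator `f`
of the real part. -/
theorem exists_rot_re_eq_zero (w : ℍ) : ∃ θ : ℝ, (rot θ • w).re = 0 := by
  let f : ℝ → ℝ := fun θ => (rot θ • w).re * ((-Real.sin θ * w.re + Real.cos θ) ^ 2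
    + (-Real.sin θ * w.im) ^ 2)
  have hf : ∀ θ, f θ = Real.cos θ * (-Real.sin θ) * (w.re ^ 2 + w.im ^ 2)
      + (Real.cos θ * Real.cos θ + Real.sin θ * (-Real.sin θ)) * w.re
      + Real.sin θ * Real.cos θ := by
    intro θ
    have h := denom_sq_pos (rot θ) w
    simp only [f, smul_re]
    simp only [rot, mkSL_zero_zero, mkSL_zero_one, mkSL_one_zero, mkSL_one_one] at h ⊢
    rw [div_mul_cancel₀ _ h.ne']
  have hc : Continuous f := by
    rw [funext hf]; fun_prop
  have h0 : f 0 = w.re := by rw [hf]; simp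
  have h1 : f (Real.pi / 2) = -w.re := by rw [hf]; simp
  have : (0 : ℝ) ∈ f '' uIcc 0 (Real.pi / 2) := by
    refine intermediate_value_uIcc hc.continuousOn ?_
    rw [h0, h1, mem_uIcc]
    rcases le_total 0 w.re with h | h
    · right; constructor <;> linarith
    · left; constructor <;> linarith
  obtain ⟨θ, -, hθ⟩ := this
  refine ⟨θ, ?_⟩
  have h := denom_sq_pos (rot θ) w
  simp only [rot, mkSL_one_zero, mkSL_one_one] at h
  exact (mul_eq_zero.1 hθ).resolve_right h.ne'

theorem rot_half_pi_smul_expI (t : ℝ) : rot (Real.pi / 2) • expI t = expI (-t) := by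
  apply ext_re_im
  · rw [smul_re]; simp [rot]
  · rw [smul_im]; simp [rot, Real.exp_neg]; field_simp

/-- The normal form behind all rigidity statements: transitivity on points, a rotation about `I`,
and if necessary the half turn, which reverses the imaginary axis. -/
theorem exists_smul_pair (p q : ℍ) :
    ∃ M : SL(2, ℝ), M • p = expI 0 ∧ M • q = expI (dist p q) := by
  obtain ⟨M, hM⟩ := MulAction.exists_smul_eq SL(2, ℝ) p UpperHalfPlane.I
  obtain ⟨θ, hθ⟩ := exists_rot_re_eq_zero (M • q)
  have hp : (rot θ * M) • p = expI 0 := by rw [mul_smul, hM, rot_smul_I, expI_zero]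
  have hq := expI_log hθ
  set t := Real.log (rot θ • M • q).im
  have hd : dist p q = |t| := by
    rw [← dist_smul (rot θ * M), hp, mul_smul, ← hq, isometry_expI.dist_eq, Real.dist_eq]
    simp
  rcases le_total 0 t with h | h
  · exact ⟨rot θ * M, hp, by rw [hd, abs_of_nonneg h, hq, mul_smul]⟩
  · refine ⟨rot (Real.pi / 2) * (rot θ * M), ?_, ?_⟩
    · rw [mul_smul, hp, rot_half_pi_smul_expI, neg_zero]
    · rw [mul_smul, mul_smul, ← hq, rot_half_pi_smul_expI, hd, abs_of_nonpos h]

theorem IsGeodesicCurve.exists_eq {c : ℝ → ℍ} (hc : IsGeodesicCurve c) :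
    ∃ N : SL(2, ℝ), ∀ t, c t = N • expI t := by
  obtain ⟨M, h0, h1⟩ := exists_smul_pair (c 0) (c 1)
  refine ⟨M⁻¹, fun t => ?_⟩
  rw [eq_inv_smul_iff]
  have hd : dist (c 0) (c 1) = 1 := by rw [hc.dist_eq]; simp
  rw [hd] at h1
  have e0 : dist (M • c t) (expI 0) = dist (expI t) (expI 0) := by
    rw [← h0, dist_smul, hc.dist_eq, h0, isometry_expI.dist_eq]
  have e1 : dist (M • c t) (expI 1) = dist (expI t) (expI 1) := by
    rw [← h1, dist_smul, hc.dist_eq, h1, isometry_expI.dist_eq]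
  obtain ⟨a, b⟩ := im_eq_of_dist_expI one_ne_zero e0 e1
  refine ext_re_im ?_ a
  simpa using b

theorem isGeodesicCurve_smul_expI (N : SL(2, ℝ)) : IsGeodesicCurve fun t => N • expI t :=
  (isometry_smul ℍ N).comp isometry_expI

theorem isGeodesic_iff {s : Set ℍ} :
    IsGeodesic s ↔ ∃ M : SL(2, ℝ), s = {z | (M • z).re = 0} := by
  have key : ∀ N : SL(2, ℝ), range (fun t => N • expI t) = {z | (N⁻¹ • z).re = 0} := by
    intro N
    rw [range_comp' (fun z => N • z) expI, range_expI]
    ext z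
    constructor
    · rintro ⟨w, hw, rfl⟩; simpa using hw
    · intro h; exact ⟨N⁻¹ • z, h, by simp⟩
  constructor
  · rintro ⟨c, hc, rfl⟩
    obtain ⟨N, hN⟩ := hc.exists_eq
    exact ⟨N⁻¹, by rw [← key, funext hN]⟩
  · rintro ⟨M, rfl⟩
    exact ⟨_, isGeodesicCurve_smul_expI M⁻¹, by rw [key, inv_inv]⟩

theorem dist_reflect (z w : ℍ) : dist (⟨⟨-z.re, z.im⟩, z.im_pos⟩ : ℍ) ⟨⟨-w.re, w.im⟩, w.im_pos⟩
    = dist z w := by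
  rw [dist_eq_iff_cosh, cosh_dist_eq, cosh_dist_eq]
  congr 1
  show (-z.re - -w.re) ^ 2 + z.im ^ 2 + w.im ^ 2 = _
  ring

/-- The reflection in the imaginary axis. -/
def reflect : ℍ ≃ᵢ ℍ where
  toFun z := ⟨⟨-z.re, z.im⟩, z.im_pos⟩
  invFun z := ⟨⟨-z.re, z.im⟩, z.im_pos⟩
  left_inv _ := ext_re_im (neg_neg _) rfl
  right_inv _ := ext_re_im (neg_neg _) rfl
  isometry_toFun := Isometry.of_dist_eq dist_reflect

@[simp] theorem reflect_re (z : ℍ) : (reflect z).re = -z.re := rfl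
@[simp] theorem reflect_im (z : ℍ) : (reflect z).im = z.im := rfl

/-- A distance preserving map of a subset of the hyperbolic plane with at least two points is given
by a Möbius transformation, or by one composed with the reflection. -/
theorem exists_smul_of_dist_eq {A : Set ℍ} {ψ : ℍ → ℍ}
    (h : ∀ x ∈ A, ∀ y ∈ A, dist (ψ x) (ψ y) = dist x y) {p q : ℍ} (hp : p ∈ A) (hq : q ∈ A)
    (hpq : p ≠ q) : ∃ M N : SL(2, ℝ), (∀ x ∈ A, ψ x = M • N • x) ∨
      (∀ x ∈ A, ψ x = M • reflect (N • x)) := by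
  obtain ⟨N, hN0, hN1⟩ := exists_smul_pair p q
  obtain ⟨L, hL0, hL1⟩ := exists_smul_pair (ψ p) (ψ q)
  rw [h p hp q hq] at hL1
  have hr : dist p q ≠ 0 := by simpa using hpq
  have key : ∀ x ∈ A, (L • ψ x).im = (N • x).im ∧ (L • ψ x).re ^ 2 = (N • x).re ^ 2 := by
    intro x hx
    refine im_eq_of_dist_expI hr ?_ ?_
    · rw [← hL0, dist_smul, h x hx p hp, hL0, ← hN0, dist_smul]
    · rw [← hL1, dist_smul, h x hx q hq, hL1, ← hN1, dist_smul]
  refine ⟨L⁻¹, N, ?_⟩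
  -- Each point keeps or changes the sign of its real part. One point `x₀` with a genuine change
  -- forces the change everywhere: a point that keeps a nonzero real part would get a wrong distance
  -- from `x₀`.
  by_cases hall : ∀ x ∈ A, (L • ψ x).re = (N • x).re
  · left
    intro x hx
    rw [eq_inv_smul_iff]
    exact ext_re_im (hall x hx) (key x hx).1
  · right
    push Not at hall
    obtain ⟨x₀, hx₀, hne⟩ := hall
    have h0 : (L • ψ x₀).re = -(N • x₀).re := (sq_eq_sq_iff_eq_or_eq_neg.1 (key x₀ hx₀).2).resolve_left hne
    have h00 : (N • x₀).re ≠ 0 := by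
      intro h'; rw [h0, h'] at hne; simp at hne
    intro x hx
    rw [eq_inv_smul_iff]
    refine ext_re_im ?_ (key x hx).1
    rw [reflect_re]
    rcases sq_eq_sq_iff_eq_or_eq_neg.1 (key x hx).2 with h1 | h1
    · have hd : dist (L • ψ x) (L • ψ x₀) = dist (N • x) (N • x₀) := by
        rw [dist_smul, dist_smul, h x hx x₀ hx₀]
      rw [dist_eq_iff_cosh, cosh_dist_eq, cosh_dist_eq, (key x hx).1, (key x₀ hx₀).1, h0, h1] at hd
      have := (N • x).im_pos
      have := (N • x₀).im_pos
      rw [div_left_inj' (by positivity)] at hd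
      have : (N • x).re * (N • x₀).re = 0 := by linarith
      have := (mul_eq_zero.1 this).resolve_right h00
      rw [h1, this, neg_zero]
    · exact h1

theorem exists_isometryEquiv_of_dist_eq {A : Set ℍ} {ψ : ℍ → ℍ}
    (h : ∀ x ∈ A, ∀ y ∈ A, dist (ψ x) (ψ y) = dist x y) {p q : ℍ} (hp : p ∈ A) (hq : q ∈ A)
    (hpq : p ≠ q) : ∃ F : ℍ ≃ᵢ ℍ, ∀ x ∈ A, F x = ψ x := by
  obtain ⟨M, N, hM | hM⟩ := exists_smul_of_dist_eq h hp hq hpq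
  · exact ⟨(IsometryEquiv.constSMul N).trans (IsometryEquiv.constSMul M), fun x hx => (hM x hx).symm⟩
  · exact ⟨((IsometryEquiv.constSMul N).trans reflect).trans (IsometryEquiv.constSMul M),
      fun x hx => (hM x hx).symm⟩

theorem reflect_smul (N : SL(2, ℝ)) : ∃ N' : SL(2, ℝ), ∀ z : ℍ, reflect (N • z) = N' • reflect z := by
  have hd := det_entries N
  refine ⟨mkSL (N 0 0) (-N 0 1) (-N 1 0) (N 1 1) (by linarith), fun z => ?_⟩
  apply ext_re_im
  · rw [reflect_re, smul_re, smul_re]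
    simp
    rw [← neg_div]
    congr 1
    ring
  · rw [reflect_im, smul_im, smul_im]
    simp

theorem isometryEquiv_eq_smul (F : ℍ ≃ᵢ ℍ) :
    ∃ M : SL(2, ℝ), (∀ z, F z = M • z) ∨ (∀ z, F z = M • reflect z) := by
  have hne : expI 0 ≠ expI 1 := fun h => by
    have := isometry_expI.injective h
    norm_num at this
  obtain ⟨M, N, h | h⟩ := exists_smul_of_dist_eq (A := univ) (ψ := F)
    (fun x _ y _ => F.isometry.dist_eq x y) (mem_univ (expI 0)) (mem_univ (expI 1)) hne
  · exact ⟨M * N, Or.inl fun z => by rw [h z (mem_univ z), mul_smul]⟩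
  · obtain ⟨N', hN'⟩ := reflect_smul N
    exact ⟨M * N', Or.inr fun z => by rw [h z (mem_univ z), hN', mul_smul]⟩

theorem exists_pos_expI_mem {O : Set ℍ} (hO : IsOpen O) (h : expI 0 ∈ O) :
    ∃ r ≠ 0, expI r ∈ O ∧ ∃ w ∈ O, w.re ≠ 0 := by
  have h1 : ∀ᶠ t in 𝓝 (0 : ℝ), expI t ∈ O :=
    isometry_expI.continuous.continuousAt.eventually_mem (hO.mem_nhds h)
  have h2 : ∀ᶠ t in 𝓝 (0 : ℝ), (t +ᵥ expI 0 : ℍ) ∈ O := by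
    have hc : Continuous fun t : ℝ => (t +ᵥ expI 0 : ℍ) := by
      rw [UpperHalfPlane.isEmbedding_coe.continuous_iff]
      have : (UpperHalfPlane.coe ∘ fun t : ℝ => (t +ᵥ expI 0 : ℍ)) = fun t : ℝ => (t : ℂ) + expI 0 := by
        ext t; simp
      rw [this]; fun_prop
    exact hc.continuousAt.eventually_mem (hO.mem_nhds (by simpa using h))
  obtain ⟨r, ⟨hr1, hr2⟩, hr0⟩ := ((h1.and h2).filter_mono nhdsWithin_le_nhds |>.and
    (self_mem_nhdsWithin : {(0 : ℝ)}ᶜ ∈ 𝓝[≠] (0 : ℝ))).exists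
  exact ⟨r, hr0, hr1, _, hr2, by simpa using hr0⟩

/-- Two fixed points on the imaginary axis leave `z` and its mirror image as the only candidates for
`E z`; a fixed point off the axis excludes the mirror image. -/
theorem isometryEquiv_eq_self_of_eqOn_open {E : ℍ ≃ᵢ ℍ} {O : Set ℍ} (hO : IsOpen O)
    (h0 : expI 0 ∈ O) (h : ∀ z ∈ O, E z = z) (z : ℍ) : E z = z := by
  obtain ⟨r, hr, hrO, w, hw, hw0⟩ := exists_pos_expI_mem hO h0
  have key : (E z).im = z.im ∧ (E z).re ^ 2 = z.re ^ 2 := by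
    refine im_eq_of_dist_expI hr ?_ ?_
    · conv_lhs => rw [← h _ h0]
      exact E.isometry.dist_eq _ _
    · conv_lhs => rw [← h _ hrO]
      exact E.isometry.dist_eq _ _
  refine ext_re_im ?_ key.1
  rcases sq_eq_sq_iff_eq_or_eq_neg.1 key.2 with h1 | h1
  · exact h1
  · have hd : dist (E z) w = dist z w := by
      conv_lhs => rw [← h _ hw]
      exact E.isometry.dist_eq _ _
    rw [dist_eq_iff_cosh, cosh_dist_eq, cosh_dist_eq, key.1, h1] at hd
    have := z.im_pos
    have := w.im_pos
    rw [div_left_inj' (by positivity)] at hd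
    have : z.re * w.re = 0 := by linarith
    have := (mul_eq_zero.1 this).resolve_right hw0
    rw [h1, this, neg_zero]

theorem isometryEquiv_eq_of_eqOn_open {F G : ℍ ≃ᵢ ℍ} {O : Set ℍ} (hO : IsOpen O)
    (hne : O.Nonempty) (h : EqOn F G O) : F = G := by
  obtain ⟨p, hp⟩ := hne
  obtain ⟨M, hM⟩ := MulAction.exists_smul_eq SL(2, ℝ) (expI 0) p
  let m : ℍ ≃ᵢ ℍ := IsometryEquiv.constSMul M
  let E : ℍ ≃ᵢ ℍ := ((m.trans F).trans G.symm).trans m.symm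
  have hE : ∀ z, E z = z := by
    refine isometryEquiv_eq_self_of_eqOn_open (hO.preimage m.continuous) ?_ ?_
    · show M • expI 0 ∈ O
      rwa [hM]
    · intro z hz
      show m.symm (G.symm (F (m z))) = z
      rw [h hz]; simp
  ext1 z
  have := hE (m.symm z)
  simp only [E, IsometryEquiv.trans_apply, IsometryEquiv.apply_symm_apply] at this
  have := m.symm.injective this
  rw [IsometryEquiv.symm_apply_eq] at this
  exact this

/-! ### Convexity -/

/-- Coordinates of the hyperbolic plane in which the geodesics are segments of straight lines. -/
def par (z : ℍ) : ℝ × ℝ := (z.re, z.re ^ 2 + z.im ^ 2)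

/-- Convexity with respect to the hyperbolic metric. -/
def IsHConvex (D : Set ℍ) : Prop := ∃ C : Set (ℝ × ℝ), Convex ℝ C ∧ D = par ⁻¹' C

theorem IsHConvex.inter {D E : Set ℍ} : IsHConvex D → IsHConvex E → IsHConvex (D ∩ E) := by
  rintro ⟨C, hC, rfl⟩ ⟨C', hC', rfl⟩
  exact ⟨C ∩ C', hC.inter hC', rfl⟩

theorem IsHConvex.sInter {𝒟 : Set (Set ℍ)} (h : ∀ D ∈ 𝒟, IsHConvex D) : IsHConvex (⋂₀ 𝒟) := by
  choose! C hC hD using h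
  refine ⟨⋂ D ∈ 𝒟, C D, convex_iInter₂ hC, ?_⟩
  ext z
  simp only [mem_sInter, mem_preimage, mem_iInter]
  exact forall₂_congr fun D hD' => by conv_lhs => rw [hD D hD', mem_preimage]

theorem combo_pos (p z : ℍ) (t : unitInterval) : 0 < (1 - (t : ℝ)) * p.im ^ 2 + t * z.im ^ 2
    + t * (1 - t) * (p.re - z.re) ^ 2 := by
  obtain ⟨t, h0, h1⟩ := t
  have hp := p.im_pos
  have hz := z.im_pos
  rcases h0.eq_or_lt with rfl | h
  · simp; positivity
  · have : 0 ≤ 1 - t := by linarith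
    simp only
    positivity

/-- The point that divides the geodesic segment from `p` to `z`, in the coordinates `par`, in the
ratio `t : 1 - t`. -/
def combo (p z : ℍ) (t : unitInterval) : ℍ :=
  ⟨⟨(1 - t) * p.re + t * z.re, √((1 - t) * p.im ^ 2 + t * z.im ^ 2
    + t * (1 - t) * (p.re - z.re) ^ 2)⟩, Real.sqrt_pos.2 (combo_pos p z t)⟩

theorem par_combo (p z : ℍ) (t : unitInterval) :
    par (combo p z t) = (1 - (t : ℝ)) • par p + (t : ℝ) • par z := by
  have h : (combo p z t).im ^ 2 = (1 - t) * p.im ^ 2 + t * z.im ^ 2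
    + t * (1 - t) * (p.re - z.re) ^ 2 := Real.sq_sqrt (combo_pos p z t).le
  have h' : (combo p z t).re = (1 - t) * p.re + t * z.re := rfl
  ext
  · simp [par, h']
  · simp only [par, h, h', Prod.snd_add, Prod.smul_snd, smul_eq_mul]
    ring

theorem combo_zero (p z : ℍ) : combo p z 0 = p :=
  ext_re_im (show (1 - ((0 : unitInterval) : ℝ)) * p.re + ((0 : unitInterval) : ℝ) * z.re = p.re by simp)
    (show √((1 - ((0 : unitInterval) : ℝ)) * p.im ^ 2 + ((0 : unitInterval) : ℝ) * z.im ^ 2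
      + ((0 : unitInterval) : ℝ) * (1 - (0 : unitInterval)) * (p.re - z.re) ^ 2) = p.im by
      simp [p.im_pos.le])

theorem combo_one (p z : ℍ) : combo p z 1 = z :=
  ext_re_im (show (1 - ((1 : unitInterval) : ℝ)) * p.re + ((1 : unitInterval) : ℝ) * z.re = z.re by simp)
    (show √((1 - ((1 : unitInterval) : ℝ)) * p.im ^ 2 + ((1 : unitInterval) : ℝ) * z.im ^ 2
      + ((1 : unitInterval) : ℝ) * (1 - (1 : unitInterval)) * (p.re - z.re) ^ 2) = z.im by
      simp [z.im_pos.le])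

theorem combo_self (p : ℍ) (t : unitInterval) : combo p p t = p := by
  refine ext_re_im ?_ ?_
  · show (1 - (t : ℝ)) * p.re + t * p.re = p.re
    ring
  · show √((1 - (t : ℝ)) * p.im ^ 2 + t * p.im ^ 2 + t * (1 - t) * (p.re - p.re) ^ 2) = p.im
    rw [show (1 - (t : ℝ)) * p.im ^ 2 + t * p.im ^ 2 + t * (1 - t) * (p.re - p.re) ^ 2
      = p.im ^ 2 by ring, Real.sqrt_sq p.im_pos.le]

theorem continuous_combo (p : ℍ) : Continuous fun x : unitInterval × ℍ => combo p x.2 x.1 := by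
  rw [UpperHalfPlane.isEmbedding_coe.continuous_iff]
  have : (UpperHalfPlane.coe ∘ fun x : unitInterval × ℍ => combo p x.2 x.1) =
    fun x => (((1 - (x.1 : ℝ)) * p.re + x.1 * x.2.re : ℝ) : ℂ)
      + ((√((1 - (x.1 : ℝ)) * p.im ^ 2 + x.1 * x.2.im ^ 2
    + x.1 * (1 - x.1) * (p.re - x.2.re) ^ 2) : ℝ) : ℂ) * Complex.I := by
    funext x
    exact Complex.mk_eq_add_mul_I _ _
  rw [this]
  have h1 := UpperHalfPlane.continuous_re
  have h2 := UpperHalfPlane.continuous_im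
  fun_prop

theorem IsHConvex.combo_mem {D : Set ℍ} (hD : IsHConvex D) {p z : ℍ} (hp : p ∈ D) (hz : z ∈ D)
    (t : unitInterval) : combo p z t ∈ D := by
  obtain ⟨C, hC, rfl⟩ := hD
  rw [mem_preimage, par_combo]
  exact hC hp hz (by linarith [t.2.2]) t.2.1 (by ring)

theorem IsHConvex.isPreconnected {D : Set ℍ} (hD : IsHConvex D) : IsPreconnected D := by
  refine isPreconnected_of_forall_pair fun p hp z hz => ?_
  refine ⟨range (combo p z), ?_, ⟨0, combo_zero p z⟩, ⟨1, combo_one p z⟩, ?_⟩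
  · rintro _ ⟨t, rfl⟩
    exact hD.combo_mem hp hz t
  · exact isPreconnected_range ((continuous_combo p).comp (by fun_prop : Continuous fun t => (t, z)))

/-- The contraction of a convex region to one of its points. -/
def IsHConvex.contraction {D : Set ℍ} (hD : IsHConvex D) (p : D) : C(unitInterval × D, D) where
  toFun x := ⟨combo p x.2 x.1, hD.combo_mem p.2 x.2.2 x.1⟩
  continuous_toFun := by
    refine Continuous.subtype_mk ((continuous_combo p).comp
      (by fun_prop : Continuous fun x : unitInterval × D => (x.1, (x.2 : ℍ)))) _

/-! ### Half planes -/

/-- The open half plane that the Möbius transformation `M` maps to the right half plane. -/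
def halfPlane (M : SL(2, ℝ)) : Set ℍ := {z | 0 < (M • z).re}

/-- An open half plane. -/
def IsHalfPlane (K : Set ℍ) : Prop := ∃ M, K = halfPlane M

/-- The quadratic expression whose zeros form the geodesic that `M` maps to the imaginary axis. -/
def form (M : SL(2, ℝ)) (z : ℍ) : ℝ := M 0 0 * M 1 0 * (z.re ^ 2 + z.im ^ 2)
  + (M 0 0 * M 1 1 + M 0 1 * M 1 0) * z.re + M 0 1 * M 1 1

theorem smul_re_pos_iff (M : SL(2, ℝ)) (z : ℍ) : 0 < (M • z).re ↔ 0 < form M z := by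
  rw [smul_re, div_pos_iff_of_pos_right (denom_sq_pos M z)]; rfl

theorem smul_re_nonneg_iff (M : SL(2, ℝ)) (z : ℍ) : 0 ≤ (M • z).re ↔ 0 ≤ form M z := by
  rw [smul_re, le_div_iff₀ (denom_sq_pos M z), zero_mul]; rfl

theorem smul_re_nonpos_iff (M : SL(2, ℝ)) (z : ℍ) : (M • z).re ≤ 0 ↔ form M z ≤ 0 := by
  rw [← not_lt, ← not_lt, smul_re_pos_iff]

theorem smul_re_eq_zero_iff (M : SL(2, ℝ)) (z : ℍ) : (M • z).re = 0 ↔ form M z = 0 := by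
  rw [le_antisymm_iff, le_antisymm_iff, smul_re_nonneg_iff, smul_re_nonpos_iff]

theorem continuous_smul_re (M : SL(2, ℝ)) : Continuous fun z : ℍ => (M • z).re :=
  UpperHalfPlane.continuous_re.comp (isometry_smul ℍ M).continuous

/-- `form M` is an affine function of the coordinates `par`, in which half planes therefore become
affine half planes (the Klein model). -/
theorem isHConvex_form (M : SL(2, ℝ)) {I : Set ℝ} (hI : Convex ℝ I) :
    IsHConvex {z | form M z ∈ I} := by
  let l : ℝ × ℝ →ₗ[ℝ] ℝ := (M 0 0 * M 1 0) • LinearMap.snd ℝ ℝ ℝ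
    + (M 0 0 * M 1 1 + M 0 1 * M 1 0) • LinearMap.fst ℝ ℝ ℝ
  refine ⟨l ⁻¹' ((fun x => x + M 0 1 * M 1 1) ⁻¹' I),
    (hI.translate_preimage_left _).linear_preimage l, ?_⟩
  ext z
  simp [form, par, l]

theorem isHConvex_halfPlane (M : SL(2, ℝ)) : IsHConvex (halfPlane M) := by
  simpa only [halfPlane, smul_re_pos_iff, mem_Ioi] using isHConvex_form M (convex_Ioi 0)

theorem isHConvex_compl_halfPlane (M : SL(2, ℝ)) : IsHConvex (halfPlane M)ᶜ := by
  simpa only [halfPlane, compl_ofPred, not_lt, smul_re_nonpos_iff, mem_Iic] using isHConvex_form M (convex_Iic 0)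

theorem isHConvex_closed (M : SL(2, ℝ)) : IsHConvex {z : ℍ | 0 ≤ (M • z).re} := by
  simpa only [smul_re_nonneg_iff, mem_Ici] using isHConvex_form M (convex_Ici 0)

theorem isOpen_halfPlane (M : SL(2, ℝ)) : IsOpen (halfPlane M) :=
  isOpen_lt continuous_const (continuous_smul_re M)

theorem tendsto_vadd_zero (z : ℍ) : Filter.Tendsto (fun t : ℝ => (t +ᵥ z : ℍ)) (𝓝 0) (𝓝 z) := by
  have hc : Continuous fun t : ℝ => (t +ᵥ z : ℍ) := by
    rw [UpperHalfPlane.isEmbedding_coe.continuous_iff]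
    have : (UpperHalfPlane.coe ∘ fun t : ℝ => (t +ᵥ z : ℍ)) = fun t : ℝ => (t : ℂ) + z := by
      ext t; simp
    rw [this]; fun_prop
  simpa using hc.tendsto 0

theorem closure_halfPlane (M : SL(2, ℝ)) : closure (halfPlane M) = {z | 0 ≤ (M • z).re} := by
  refine subset_antisymm (closure_minimal (fun z hz => le_of_lt (show 0 < (M • z).re from hz))
    (isClosed_le continuous_const (continuous_smul_re M))) fun z hz => ?_
  have h1 : Filter.Tendsto (fun t : ℝ => M⁻¹ • (t +ᵥ (M • z) : ℍ)) (𝓝[>] 0) (𝓝 z) := by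
    have := ((isometry_smul ℍ M⁻¹).continuous.tendsto (M • z)).comp (tendsto_vadd_zero (M • z))
    rw [inv_smul_smul] at this
    exact this.mono_left nhdsWithin_le_nhds
  refine mem_closure_of_tendsto h1 ?_
  filter_upwards [self_mem_nhdsWithin] with t ht
  show 0 < (M • M⁻¹ • (t +ᵥ (M • z) : ℍ)).re
  rw [smul_inv_smul, UpperHalfPlane.vadd_re]
  exact add_pos_of_pos_of_nonneg ht hz

theorem frontier_halfPlane (M : SL(2, ℝ)) : frontier (halfPlane M) = {z | (M • z).re = 0} := by
  rw [(isOpen_halfPlane M).frontier_eq, closure_halfPlane]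
  ext z
  simp only [halfPlane, mem_sdiff, mem_ofPred_eq, not_lt]
  exact ⟨fun h => le_antisymm h.2 h.1, fun h => ⟨h.ge, h.le⟩⟩

/-- `rot (π / 2)` is `z ↦ -1 / z`, which exchanges the two sides of the imaginary axis. -/
theorem rot_half_pi_smul_re (z : ℍ) : ∃ k : ℝ, 0 < k ∧ (rot (Real.pi / 2) • z).re = -(k * z.re) := by
  have h := denom_sq_pos (rot (Real.pi / 2)) z
  refine ⟨_, inv_pos.2 h, ?_⟩
  rw [smul_re, div_eq_inv_mul, ← mul_neg]
  congr 1
  simp [rot]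

/-- The other half plane with the same boundary. -/
theorem halfPlane_rot (M : SL(2, ℝ)) : halfPlane (rot (Real.pi / 2) * M) = {z | (M • z).re < 0} := by
  ext z
  obtain ⟨k, hk, h⟩ := rot_half_pi_smul_re (M • z)
  simp only [halfPlane, mem_ofPred_eq, mul_smul, h]
  rw [neg_pos, mul_neg_iff]
  constructor
  · rintro (⟨-, h⟩ | ⟨h, -⟩)
    · exact h
    · linarith
  · exact fun h => Or.inl ⟨hk, h⟩

theorem smul_halfPlane (N M : SL(2, ℝ)) : N • halfPlane M = halfPlane (M * N⁻¹) := by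
  ext z
  rw [mem_smul_set_iff_inv_smul_mem]
  simp [halfPlane, mul_smul]

namespace IsHalfPlane
variable {K L : Set ℍ}

protected theorem isOpen (hK : IsHalfPlane K) : IsOpen K := by
  obtain ⟨M, rfl⟩ := hK; exact isOpen_halfPlane M

theorem isHConvex (hK : IsHalfPlane K) : IsHConvex K := by
  obtain ⟨M, rfl⟩ := hK; exact isHConvex_halfPlane M

theorem isHConvex_compl (hK : IsHalfPlane K) : IsHConvex Kᶜ := by
  obtain ⟨M, rfl⟩ := hK; exact isHConvex_compl_halfPlane M

protected theorem smul (hK : IsHalfPlane K) (N : SL(2, ℝ)) : IsHalfPlane (N • K) := by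
  obtain ⟨M, rfl⟩ := hK; exact ⟨_, smul_halfPlane N M⟩

theorem isGeodesic_frontier (hK : IsHalfPlane K) : IsGeodesic (frontier K) := by
  obtain ⟨M, rfl⟩ := hK; exact isGeodesic_iff.2 ⟨M, frontier_halfPlane M⟩

theorem frontier_subset_compl (hK : IsHalfPlane K) : frontier K ⊆ Kᶜ := by
  rw [hK.isOpen.frontier_eq]; exact fun z hz => hz.2

theorem closure_eq (hK : IsHalfPlane K) : closure K = K ∪ frontier K := by
  rw [hK.isOpen.frontier_eq, union_sdiff_cancel subset_closure]

theorem nonempty (hK : IsHalfPlane K) : K.Nonempty := by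
  obtain ⟨M, rfl⟩ := hK
  refine ⟨M⁻¹ • ((1 : ℝ) +ᵥ expI 0 : ℍ), ?_⟩
  simp [halfPlane]

end IsHalfPlane

theorem IsGeodesic.nonempty {s : Set ℍ} (hs : IsGeodesic s) : s.Nonempty := by
  obtain ⟨c, -, rfl⟩ := hs; exact range_nonempty c

theorem IsGeodesic.isPreconnected {s : Set ℍ} (hs : IsGeodesic s) : IsPreconnected s := by
  obtain ⟨c, hc, rfl⟩ := hs; exact isPreconnected_range hc.continuous

theorem IsGeodesic.smul {s : Set ℍ} (hs : IsGeodesic s) (N : SL(2, ℝ)) : IsGeodesic (N • s) := by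
  obtain ⟨c, hc, rfl⟩ := hs
  exact ⟨fun t => N • c t, (isometry_smul ℍ N).comp hc, by rw [range_comp' (fun z => N • z) c]; rfl⟩

namespace IsComponentOf
variable {U V T s : Set ℍ}

theorem subset (h : IsComponentOf U s) : U ⊆ s := by
  obtain ⟨x, -, rfl⟩ := h; exact connectedComponentIn_subset s x

theorem isPreconnected (h : IsComponentOf U s) : IsPreconnected U := by
  obtain ⟨x, -, rfl⟩ := h; exact isPreconnected_connectedComponentIn

theorem nonempty (h : IsComponentOf U s) : U.Nonempty := by
  obtain ⟨x, hx, rfl⟩ := h; exact ⟨x, mem_connectedComponentIn hx⟩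

theorem subset_of_isPreconnected (h : IsComponentOf U s) (hT : IsPreconnected T) (hTs : T ⊆ s)
    (hne : (T ∩ U).Nonempty) : T ⊆ U := by
  obtain ⟨x, hx, rfl⟩ := h
  obtain ⟨y, hyT, hyU⟩ := hne
  rw [connectedComponentIn_eq hyU]
  exact hT.subset_connectedComponentIn hyT hTs

theorem eq_of_inter_nonempty (hU : IsComponentOf U s) (hV : IsComponentOf V s)
    (hne : (U ∩ V).Nonempty) : U = V :=
  (hV.subset_of_isPreconnected hU.isPreconnected hU.subset hne).antisymm
    (hU.subset_of_isPreconnected hV.isPreconnected hV.subset (by rwa [inter_comm]))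

end IsComponentOf

theorem IsHalfPlane.isComponentOf {K : Set ℍ} (hK : IsHalfPlane K) :
    IsComponentOf K (frontier K)ᶜ := by
  obtain ⟨x, hx⟩ := hK.nonempty
  have hd : Disjoint K (frontier K) := disjoint_left.2 fun z hz hz' => hK.frontier_subset_compl hz' hz
  refine ⟨x, fun h => hK.frontier_subset_compl h hx, ?_⟩
  refine subset_antisymm (hK.isHConvex.isPreconnected.subset_connectedComponentIn hx
    hd.subset_compl_right) ?_
  have hc : IsPreconnected (connectedComponentIn (frontier K)ᶜ x) := isPreconnected_connectedComponentIn
  refine hc.subset_left_of_subset_union hK.isOpen isClosed_closure.isOpen_compl (v := (closure K)ᶜ)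
    (disjoint_compl_right_iff_subset.2 subset_closure) ?_
    ⟨x, mem_connectedComponentIn (fun h => hK.frontier_subset_compl h hx), hx⟩
  intro z hz
  have h1 := connectedComponentIn_subset _ _ hz
  by_cases h : z ∈ closure K
  · left
    rw [hK.closure_eq] at h
    exact h.resolve_right h1
  · exact Or.inr h

theorem IsComponentOf.isHalfPlane {U s : Set ℍ} (hs : IsGeodesic s) (hU : IsComponentOf U sᶜ) :
    IsHalfPlane U ∧ frontier U = s := by
  obtain ⟨M, rfl⟩ := isGeodesic_iff.1 hs
  obtain ⟨x, hx⟩ := hU.nonempty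
  have key : ∀ N, {z : ℍ | (M • z).re = 0} = {z : ℍ | (N • z).re = 0} → 0 < (N • x).re →
      U = halfPlane N ∧ frontier U = {z : ℍ | (M • z).re = 0} := by
    intro N hN hpos
    have h1 := (IsHalfPlane.isComponentOf ⟨N, rfl⟩ : IsComponentOf (halfPlane N) _)
    rw [frontier_halfPlane, ← hN] at h1
    have h2 := hU.eq_of_inter_nonempty h1 ⟨x, hx, hpos⟩
    refine ⟨h2, by rw [h2, frontier_halfPlane, hN]⟩
  have hx0 : (M • x).re ≠ 0 := hU.subset hx
  rcases hx0.lt_or_gt with h | h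
  · have := key (rot (Real.pi / 2) * M) (by
      rw [← frontier_halfPlane (_ * M), ← frontier_halfPlane M]
      ext z
      rw [frontier_halfPlane, frontier_halfPlane]
      obtain ⟨k, hk, h⟩ := rot_half_pi_smul_re (M • z)
      simp [mul_smul, h, hk.ne'])
      (by
        have : x ∈ halfPlane (rot (Real.pi / 2) * M) := by rw [halfPlane_rot]; exact h
        exact this)
    exact ⟨⟨_, this.1⟩, this.2⟩
  · have := key M rfl h
    exact ⟨⟨_, this.1⟩, this.2⟩

/-- The connected set `Kᶜ` misses the frontier of `L`, so it lies on one side of it; a point of the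
frontier of `K` shows that this side is `L`. -/
theorem IsHalfPlane.disjoint_compl {K L : Set ℍ} (hK : IsHalfPlane K) (hL : IsHalfPlane L)
    (h : frontier L ⊆ K) (h' : frontier K ⊆ L) : Disjoint Kᶜ Lᶜ := by
  rw [disjoint_compl_right_iff_subset]
  refine hL.isComponentOf.subset_of_isPreconnected hK.isHConvex_compl.isPreconnected
    (compl_subset_compl.2 h) ?_
  obtain ⟨x, hx⟩ := hK.isGeodesic_frontier.nonempty
  exact ⟨x, hK.frontier_subset_compl hx, h' hx⟩

/-! ### Locally finite families of half planes -/

/-- The coefficients `(A, B, C)` of `form M` are a unit spacelike vector for the Lorentzian form `B²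
- 4AC`. The estimates that follow are computations in this model. -/
theorem form_disc (M : SL(2, ℝ)) :
    (M 0 0 * M 1 1 + M 0 1 * M 1 0) ^ 2 - 4 * (M 0 0 * M 1 0) * (M 0 1 * M 1 1) = 1 := by
  have h := det_entries M
  linear_combination (M 0 0 * M 1 1 - M 0 1 * M 1 0 + 1) * h

theorem mul_entries (M N : SL(2, ℝ)) (i j : Fin 2) :
    (M * N) i j = M i 0 * N 0 j + M i 1 * N 1 j := by
  rw [Matrix.SpecialLinearGroup.coe_mul, Matrix.mul_apply, Fin.sum_univ_two]

/-- Values on the line `x = 0` give `A, C ≥ 0`, values to the left of it give `B ≤ 0`, and then `B²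
= 1 + 4AC ≥ 1`. -/
theorem middle_le_neg_one {A B C : ℝ} (hd : B ^ 2 - 4 * A * C = 1)
    (h : ∀ x y : ℝ, x ≤ 0 → 0 < y → 0 < A * (x ^ 2 + y ^ 2) + B * x + C) : B ≤ -1 := by
  have hA : 0 ≤ A := by
    by_contra! hA
    have h1 := h 0 (√(|C| / (-A) + 1)) le_rfl (Real.sqrt_pos.2 (by
      have := div_nonneg (abs_nonneg C) (neg_pos.2 hA).le
      linarith))
    rw [Real.sq_sqrt (by have := div_nonneg (abs_nonneg C) (neg_pos.2 hA).le; linarith)] at h1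
    have h2 : A * (|C| / (-A)) = -|C| := by have := hA.ne; field_simp
    have := le_abs_self C
    nlinarith
  have hC : 0 ≤ C := by
    by_contra! hC
    have h1 := h 0 (√(-C / (A + 1))) le_rfl (Real.sqrt_pos.2 (by
      have : 0 < -C := by linarith
      positivity))
    rw [Real.sq_sqrt (div_nonneg (by linarith) (by linarith))] at h1
    have h2 : (A + 1) * (-C / (A + 1)) = -C := by field_simp
    have h3 : 0 < -C / (A + 1) := div_pos (by linarith) (by linarith)
    nlinarith
  have hB : B ≤ 0 := by
    by_contra! hB
    rcases hA.eq_or_lt with rfl | hA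
    · have := h (-(C + 1) / B) 1 (div_nonpos_of_nonpos_of_nonneg (by linarith) hB.le) one_pos
      have h2 : B * (-(C + 1) / B) = -(C + 1) := by field_simp
      linarith
    -- The top of the semicircle on which the form vanishes, with centre `-B / (2A)` and radius `1 /
    -- (2A)`.
    · have := h (-B / (2 * A)) (1 / (2 * A)) (div_nonpos_of_nonpos_of_nonneg (by linarith) (by linarith))
        (by positivity)
      have h2 : A * ((-B / (2 * A)) ^ 2 + (1 / (2 * A)) ^ 2) + B * (-B / (2 * A)) + C
        = (1 - (B ^ 2 - 4 * A * C)) / (4 * A) := by field_simp; ring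
      rw [h2, hd] at this
      simp at this
  nlinarith [mul_nonneg hA hC]

/-- The left side is the polarisation of the discriminant, which is invariant under a change of
coordinates by `R⁻¹`. With `R` moved to the identity it becomes the middle coefficient of `S * R⁻¹`.
-/
theorem form_product_le {R S : SL(2, ℝ)} (h : Disjoint (halfPlane R)ᶜ (halfPlane S)ᶜ) :
    (R 0 0 * R 1 1 + R 0 1 * R 1 0) * (S 0 0 * S 1 1 + S 0 1 * S 1 0)
      - 2 * (R 0 0 * R 1 0) * (S 0 1 * S 1 1) - 2 * (S 0 0 * S 1 0) * (R 0 1 * R 1 1) ≤ -1 := by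
  set T := S * R⁻¹ with hT
  have hS : S = T * R := by simp [hT]
  have hR := det_entries R
  have key : T 0 0 * T 1 1 + T 0 1 * T 1 0 ≤ -1 := by
    refine middle_le_neg_one (form_disc T) fun x y hx hy => ?_
    let w : ℍ := ⟨⟨x, y⟩, hy⟩
    have h1 : R⁻¹ • w ∈ (halfPlane R)ᶜ := by
      simp only [halfPlane, mem_compl_iff, mem_ofPred_eq, smul_inv_smul, not_lt]
      exact hx
    have h2 := disjoint_left.1 h h1
    simp only [halfPlane, mem_compl_iff, mem_ofPred_eq, not_not] at h2
    rw [← mul_smul, smul_re_pos_iff] at h2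
    exact h2
  have : (R 0 0 * R 1 1 + R 0 1 * R 1 0) * (S 0 0 * S 1 1 + S 0 1 * S 1 0)
      - 2 * (R 0 0 * R 1 0) * (S 0 1 * S 1 1) - 2 * (S 0 0 * S 1 0) * (R 0 1 * R 1 1)
      = (T 0 0 * T 1 1 + T 0 1 * T 1 0) * (R 0 0 * R 1 1 - R 0 1 * R 1 0) ^ 2 := by
    rw [hS]
    simp only [mul_entries]
    ring
  rw [this, hR]
  linarith

/-- Points near `I`. -/
def nearI : Set ℍ := {w | 16 * ((w.re ^ 2 + w.im ^ 2 - 1) ^ 2 + 4 * w.re ^ 2)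
  < (w.re ^ 2 + w.im ^ 2 + 1) ^ 2}

theorem isOpen_nearI : IsOpen nearI := by
  have h1 := UpperHalfPlane.continuous_re
  have h2 := UpperHalfPlane.continuous_im
  exact isOpen_lt (by fun_prop) (by fun_prop)

/-- `nearI` is the disc `tanh (dist w I) < 1 / 4`, and `A + C` is the hyperbolic sine of the signed
distance of `I` from the geodesic. A closed half plane that meets the disc without having `I` in its
interior is thus near, with `sinh² ≤ (1/16) / (15/16) = 1/15`. The computation is Cauchy-Schwarz for
`(A - C, B)` and `(s - 1, 2x)`. -/
theorem sq_le_of_nearI {M : SL(2, ℝ)} {w : ℍ} (hw : w ∈ nearI) (h : form M w ≤ 0)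
    (h0 : 0 ≤ M 0 0 * M 1 0 + M 0 1 * M 1 1) :
    15 * (M 0 0 * M 1 0 + M 0 1 * M 1 1) ^ 2 ≤ 1 := by
  have hd := form_disc M
  unfold form at h
  have hw' : 16 * ((w.re ^ 2 + w.im ^ 2 - 1) ^ 2 + 4 * w.re ^ 2) < (w.re ^ 2 + w.im ^ 2 + 1) ^ 2 := hw
  set A := M 0 0 * M 1 0
  set B := M 0 0 * M 1 1 + M 0 1 * M 1 0
  set C := M 0 1 * M 1 1
  set s := w.re ^ 2 + w.im ^ 2
  have hs : 0 ≤ s := by positivity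
  set x := w.re
  have h1 : (A + C) * (s + 1) ≤ -((A - C) * (s - 1) + 2 * B * x) := by linarith
  have h2 : ((A + C) * (s + 1)) ^ 2 ≤ ((A - C) * (s - 1) + 2 * B * x) ^ 2 := by
    rw [← neg_sq ((A - C) * (s - 1) + 2 * B * x)]
    exact pow_le_pow_left₀ (by positivity) h1 2
  have h3 : ((A - C) * (s - 1) + 2 * B * x) ^ 2
      ≤ ((A - C) ^ 2 + B ^ 2) * ((s - 1) ^ 2 + 4 * x ^ 2) := by
    nlinarith [sq_nonneg ((A - C) * (2 * x) - B * (s - 1))]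
  have h4 : (A - C) ^ 2 + B ^ 2 = 1 + (A + C) ^ 2 := by linarith
  rw [h4] at h3
  have h5 : (1 + (A + C) ^ 2) * (16 * ((s - 1) ^ 2 + 4 * x ^ 2)) ≤ (1 + (A + C) ^ 2) * (s + 1) ^ 2 :=
    mul_le_mul_of_nonneg_left hw'.le (by positivity)
  have h6 : 16 * (A + C) ^ 2 * (s + 1) ^ 2 ≤ (1 + (A + C) ^ 2) * (s + 1) ^ 2 := by nlinarith
  have h7 := le_of_mul_le_mul_right h6 (by positivity)
  linarith

/-- The sum of three unit vectors with products at most -1 has Lorentzian square at most `3 - 6 =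
-3`, so its time component, the sum of the `A + C`, has square at least 3. But each `(A + C)²` is at
most `1/15`, which bounds that square by `9/15`. -/
theorem not_three_near {M : Fin 3 → SL(2, ℝ)}
    (hdisj : ∀ i j, i ≠ j → Disjoint (halfPlane (M i))ᶜ (halfPlane (M j))ᶜ)
    (h0 : ∀ i, 0 ≤ M i 0 0 * M i 1 0 + M i 0 1 * M i 1 1)
    (hn : ∀ i, ¬ nearI ⊆ halfPlane (M i)) : False := by
  have hτ : ∀ i, 15 * (M i 0 0 * M i 1 0 + M i 0 1 * M i 1 1) ^ 2 ≤ 1 := by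
    intro i
    obtain ⟨w, hw, hw'⟩ := not_subset.1 (hn i)
    refine sq_le_of_nearI hw ?_ (h0 i)
    rw [← smul_re_nonpos_iff]
    exact not_lt.1 hw'
  have q01 := form_product_le (hdisj 0 1 (by decide))
  have q02 := form_product_le (hdisj 0 2 (by decide))
  have q12 := form_product_le (hdisj 1 2 (by decide))
  have t0 := hτ 0
  have t1 := hτ 1
  have t2 := hτ 2
  have d0 := form_disc (M 0)
  have d1 := form_disc (M 1)
  have d2 := form_disc (M 2)
  set A₀ := M 0 0 0 * M 0 1 0
  set B₀ := M 0 0 0 * M 0 1 1 + M 0 0 1 * M 0 1 0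
  set C₀ := M 0 0 1 * M 0 1 1
  set A₁ := M 1 0 0 * M 1 1 0
  set B₁ := M 1 0 0 * M 1 1 1 + M 1 0 1 * M 1 1 0
  set C₁ := M 1 0 1 * M 1 1 1
  set A₂ := M 2 0 0 * M 2 1 0
  set B₂ := M 2 0 0 * M 2 1 1 + M 2 0 1 * M 2 1 0
  set C₂ := M 2 0 1 * M 2 1 1
  have e1 : 0 ≤ (B₀ + B₁ + B₂) ^ 2 + ((A₀ + A₁ + A₂) - (C₀ + C₁ + C₂)) ^ 2 := by positivity
  have e2 : ((A₀ + C₀) + (A₁ + C₁) + (A₂ + C₂)) ^ 2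
      ≤ 3 * ((A₀ + C₀) ^ 2 + (A₁ + C₁) ^ 2 + (A₂ + C₂) ^ 2) := by
    nlinarith [sq_nonneg ((A₀ + C₀) - (A₁ + C₁)), sq_nonneg ((A₀ + C₀) - (A₂ + C₂)),
      sq_nonneg ((A₁ + C₁) - (A₂ + C₂))]
  have e3 : (B₀ + B₁ + B₂) ^ 2 + ((A₀ + A₁ + A₂) - (C₀ + C₁ + C₂)) ^ 2
      = ((A₀ + C₀) + (A₁ + C₁) + (A₂ + C₂)) ^ 2
        + (B₀ ^ 2 - 4 * A₀ * C₀) + (B₁ ^ 2 - 4 * A₁ * C₁) + (B₂ ^ 2 - 4 * A₂ * C₂)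
        + 2 * (B₀ * B₁ - 2 * A₀ * C₁ - 2 * A₁ * C₀) + 2 * (B₀ * B₂ - 2 * A₀ * C₂ - 2 * A₂ * C₀)
        + 2 * (B₁ * B₂ - 2 * A₁ * C₂ - 2 * A₂ * C₁) := by ring
  rw [d0, d1, d2] at e3
  linarith

/-- A family of half planes with mutually disjoint complements. -/
structure IsFamily (𝒦 : Set (Set ℍ)) : Prop where
  isHalfPlane : ∀ K ∈ 𝒦, IsHalfPlane K
  disjoint_compl : ∀ K ∈ 𝒦, ∀ L ∈ 𝒦, K ≠ L → Disjoint Kᶜ Lᶜ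

namespace IsFamily
variable {𝒦 : Set (Set ℍ)}

/-- If the point is outside the closure of one member, a neighbourhood lies in all the others. If it
is in all closures, it is moved to `I`, and `not_three_near` leaves at most two exceptional members.
-/
theorem locallyFinite (h : IsFamily 𝒦) (p : ℍ) :
    ∃ O, IsOpen O ∧ p ∈ O ∧ {K ∈ 𝒦 | ¬ O ⊆ K}.Finite := by
  by_cases hin : ∃ K ∈ 𝒦, p ∉ closure K
  · obtain ⟨K, hK, hp⟩ := hin
    refine ⟨(closure K)ᶜ, isClosed_closure.isOpen_compl, hp, (finite_singleton K).subset ?_⟩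
    rintro L ⟨hL, hL'⟩
    by_contra hne
    refine hL' ?_
    have := (h.disjoint_compl K hK L hL (Ne.symm hne)).subset_compl_right
    rw [compl_compl] at this
    exact (compl_subset_compl.2 subset_closure).trans this
  · push Not at hin
    obtain ⟨N, hN⟩ := MulAction.exists_smul_eq SL(2, ℝ) UpperHalfPlane.I p
    have hmem : UpperHalfPlane.I ∈ nearI := by
      simp only [nearI, mem_ofPred_eq, UpperHalfPlane.I_re, UpperHalfPlane.I_im]
      norm_num
    refine ⟨N • nearI, isOpen_nearI.smul N, ⟨_, hmem, hN⟩, ?_⟩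
    by_contra hinf
    obtain ⟨t, ht, hcard⟩ := (show Set.Infinite _ from hinf).exists_subset_card_eq 3
    let e := t.equivFinOfCardEq hcard
    let K : Fin 3 → Set ℍ := fun i => (e.symm i : Set ℍ)
    have hK : ∀ i, K i ∈ 𝒦 ∧ ¬ N • nearI ⊆ K i := fun i => ht (e.symm i).2
    choose M hM using fun i => h.isHalfPlane (K i) (hK i).1
    have hMN : ∀ i, N⁻¹ • K i = halfPlane (M i * N) := fun i => by
      rw [hM, smul_halfPlane, inv_inv]
    refine not_three_near (M := fun i => M i * N) ?_ ?_ ?_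
    · intro i j hij
      rw [← hMN, ← hMN, ← smul_set_compl, ← smul_set_compl, disjoint_smul_set]
      refine h.disjoint_compl _ (hK i).1 _ (hK j).1 fun he => hij ?_
      exact e.symm.injective (Subtype.ext he)
    · intro i
      have h1 := hin _ (hK i).1
      rw [hM, closure_halfPlane, mem_ofPred_eq, ← hN, ← mul_smul, smul_re_nonneg_iff] at h1
      simpa [form, UpperHalfPlane.I_re, UpperHalfPlane.I_im] using h1
    · intro i hi
      refine (hK i).2 ?_
      rw [← hMN, ← smul_set_subset_iff_subset_inv_smul_set] at hi
      exact hi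

theorem isOpen_sInter (h : IsFamily 𝒦) : IsOpen (⋂₀ 𝒦) := by
  rw [isOpen_iff_mem_nhds]
  intro p hp
  obtain ⟨O, hO, hpO, hfin⟩ := h.locallyFinite p
  have : O ∩ ⋂₀ {K ∈ 𝒦 | ¬ O ⊆ K} ∈ 𝓝 p := by
    refine Filter.inter_mem (hO.mem_nhds hpO) ((hfin.isOpen_sInter fun K hK =>
      (h.isHalfPlane K hK.1).isOpen).mem_nhds fun K hK => hp K hK.1)
  refine Filter.mem_of_superset this ?_
  rintro z ⟨hz, hz'⟩ K hK
  by_cases hOK : O ⊆ K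
  · exact hOK hz
  · exact hz' K ⟨hK, hOK⟩

theorem isHConvex (h : IsFamily 𝒦) : IsHConvex (⋂₀ 𝒦) :=
  IsHConvex.sInter fun K hK => (h.isHalfPlane K hK).isHConvex

theorem mono {ℒ : Set (Set ℍ)} (h : IsFamily 𝒦) (hs : ℒ ⊆ 𝒦) : IsFamily ℒ :=
  ⟨fun K hK => h.isHalfPlane K (hs hK), fun K hK L hL => h.disjoint_compl K (hs hK) L (hs hL)⟩

/-- A point of the frontier of `K` lies in all other members, whose intersection is open by local
finiteness. Near this point only `K` bounds the region. -/
theorem frontier_subset_frontier_sInter (h : IsFamily 𝒦) {K : Set ℍ} (hK : K ∈ 𝒦) :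
    frontier K ⊆ frontier (⋂₀ 𝒦) := by
  intro p hp
  have hHP := h.isHalfPlane K hK
  rw [h.isOpen_sInter.frontier_eq]
  refine ⟨?_, fun hmem => hHP.frontier_subset_compl hp (hmem K hK)⟩
  have h1 : p ∈ ⋂₀ (𝒦 \ {K}) := by
    rintro L ⟨hL, hne⟩
    by_contra hpL
    exact disjoint_left.1 (h.disjoint_compl L hL K hK hne) hpL (hHP.frontier_subset_compl hp)
  have h2 := (h.mono sdiff_subset : IsFamily (𝒦 \ {K})).isOpen_sInter.inter_closure
    (t := K) ⟨h1, frontier_subset_closure hp⟩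
  refine closure_mono ?_ h2
  rintro z ⟨hz, hzK⟩ L hL
  by_cases hLK : L = K
  · rwa [hLK]
  · exact hz L ⟨hL, hLK⟩

theorem frontier_sInter_subset (h : IsFamily 𝒦) : frontier (⋂₀ 𝒦) ⊆ ⋃ K ∈ 𝒦, frontier K := by
  intro p hp
  rw [h.isOpen_sInter.frontier_eq] at hp
  have h2 := hp.2
  simp only [mem_sInter, not_forall] at h2
  obtain ⟨K, hK, hpK⟩ := h2
  refine mem_iUnion₂.2 ⟨K, hK, ?_⟩
  rw [(h.isHalfPlane K hK).isOpen.frontier_eq]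
  exact ⟨closure_mono (sInter_subset_of_mem hK) hp.1, hpK⟩

end IsFamily

theorem form_expI (M : SL(2, ℝ)) (t : ℝ) :
    form M (expI t) = M 0 0 * M 1 0 * Real.exp t ^ 2 + M 0 1 * M 1 1 := by
  simp [form]

/-- A geodesic on one side of another geodesic that it touches is equal to it. -/
theorem IsGeodesic.eq_frontier {s K : Set ℍ} (hs : IsGeodesic s) (hK : IsHalfPlane K)
    (h : s ⊆ closure K) (hne : (s ∩ frontier K).Nonempty) : s = frontier K := by
  obtain ⟨M, rfl⟩ := hK
  obtain ⟨c, hc, rfl⟩ := hs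
  obtain ⟨N, hN⟩ := hc.exists_eq
  obtain rfl : c = fun t => N • expI t := funext hN
  rw [closure_halfPlane] at h
  rw [frontier_halfPlane] at hne ⊢
  obtain ⟨_, ⟨u, rfl⟩, hu⟩ := hne
  have hd := det_entries (M * N)
  -- Along the geodesic the form is `A e^(2t) + C`. It is monotone in `t`, nonnegative, and zero at
  -- `u`, hence `A = C = 0`, and the form is a nonzero multiple of the real part.
  have hnn : ∀ t, 0 ≤ form (M * N) (expI t) := fun t => by
    rw [← smul_re_nonneg_iff, mul_smul]
    exact h ⟨t, rfl⟩
  have h0 : form (M * N) (expI u) = 0 := by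
    rw [← smul_re_eq_zero_iff, mul_smul]
    exact hu
  simp only [form_expI] at hnn h0
  set A := (M * N) 0 0 * (M * N) 1 0 with hA
  set C := (M * N) 0 1 * (M * N) 1 1 with hC
  have h1 := hnn (u + 1)
  have h2 := hnn (u - 1)
  rw [Real.exp_add] at h1
  rw [Real.exp_sub] at h2
  have he : 1 < Real.exp 1 := by simp
  have hu := Real.exp_pos u
  have hA0 : A = 0 := by
    refine le_antisymm ?_ ?_
    · by_contra! hpos
      have : (Real.exp u / Real.exp 1) ^ 2 < Real.exp u ^ 2 :=
        pow_lt_pow_left₀ (div_lt_self hu he) (by positivity) two_ne_zero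
      nlinarith
    · by_contra! hneg
      have : Real.exp u ^ 2 < (Real.exp u * Real.exp 1) ^ 2 :=
        pow_lt_pow_left₀ (lt_mul_of_one_lt_right hu he) (by positivity) two_ne_zero
      nlinarith
  have hC0 : C = 0 := by rw [hA0] at h0; linarith
  rw [hA] at hA0
  rw [hC] at hC0
  ext z
  constructor
  · rintro ⟨t, rfl⟩
    rw [mem_ofPred_eq, ← mul_smul, smul_re_eq_zero_iff, form_expI, hA0, hC0]
    simp
  · intro hz
    rw [mem_ofPred_eq] at hz
    have hw : (N⁻¹ • z).re = 0 := by
      have h3 : ((M * N) • (N⁻¹ • z)).re = 0 := by rw [mul_smul, smul_inv_smul]; exact hz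
      rw [smul_re_eq_zero_iff, form, hA0, hC0] at h3
      simp only [zero_mul, zero_add, add_zero] at h3
      refine (mul_eq_zero.1 h3).resolve_left fun h4 => ?_
      have hdisc := form_disc (M * N)
      rw [h4, hA0, hC0] at hdisc
      norm_num at hdisc
    exact ⟨_, by show N • expI _ = z; rw [expI_log hw, smul_inv_smul]⟩

theorem IsFamily.boundaryGeodesics_eq {𝒦 : Set (Set ℍ)} (h : IsFamily 𝒦) :
    boundaryGeodesics (⋂₀ 𝒦) = frontier '' 𝒦 := by
  ext s
  constructor
  · rintro ⟨hs, hsub⟩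
    obtain ⟨p, hp⟩ := hs.nonempty
    obtain ⟨K, hK, hpK⟩ := mem_iUnion₂.1 (h.frontier_sInter_subset (hsub hp))
    exact ⟨K, hK, (hs.eq_frontier (h.isHalfPlane K hK)
      ((hsub.trans frontier_subset_closure).trans (closure_mono (sInter_subset_of_mem hK)))
      ⟨p, hp, hpK⟩).symm⟩
  · rintro ⟨K, hK, rfl⟩
    exact ⟨(h.isHalfPlane K hK).isGeodesic_frontier, h.frontier_subset_frontier_sInter hK⟩

/-! ### The regions of the construction -/

theorem frontier_smul_set (N : SL(2, ℝ)) (K : Set ℍ) : frontier (N • K) = N • frontier K :=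
  ((IsometryEquiv.constSMul N : ℍ ≃ᵢ ℍ).toHomeomorph.image_frontier K).symm

theorem IsFamily.isFace {𝒦 : Set (Set ℍ)} (h : IsFamily 𝒦) (hne : (⋂₀ 𝒦).Nonempty) :
    IsFace (frontier '' 𝒦) (⋂₀ 𝒦) := by
  obtain ⟨x, hx⟩ := hne
  have hsub : ⋂₀ 𝒦 ⊆ (⋃₀ (frontier '' 𝒦))ᶜ := by
    rintro z hz ⟨_, ⟨K, hK, rfl⟩, hzK⟩
    exact (h.isHalfPlane K hK).frontier_subset_compl hzK (hz K hK)
  refine ⟨⟨x, hsub hx, subset_antisymm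
    (h.isHConvex.isPreconnected.subset_connectedComponentIn hx hsub) ?_⟩, ?_⟩
  · refine subset_sInter fun K hK => ?_
    refine (h.isHalfPlane K hK).isComponentOf.subset_of_isPreconnected
      isPreconnected_connectedComponentIn ?_ ⟨x, mem_connectedComponentIn (hsub hx), hx K hK⟩
    exact (connectedComponentIn_subset _ _).trans
      (compl_subset_compl.2 (subset_sUnion_of_mem (mem_image_of_mem _ hK)))
  · rintro _ ⟨K, hK, rfl⟩
    exact h.frontier_subset_frontier_sInter hK

/-- The translates of the half plane `U` by the powers of `γ` have mutually disjoint complements,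
and `𝒢₀` is a collection of mutually disjoint geodesics in the complement of `U`. -/
structure IsCore (γ : SL(2, ℝ)) (U : Set ℍ) (𝒢₀ : Set (Set ℍ)) : Prop where
  isHalfPlane : IsHalfPlane U
  disjoint : ∀ i j : ℤ, i ≠ j → Disjoint (γ ^ i • U)ᶜ (γ ^ j • U)ᶜ
  nonempty : 𝒢₀.Nonempty
  geodesics : ∀ a ∈ 𝒢₀, IsGeodesic a
  pairwiseDisjoint : 𝒢₀.PairwiseDisjoint id
  subset_compl : ∀ a ∈ 𝒢₀, a ⊆ Uᶜ

/-- The hypothesis compares translates with `g` only; applying `γ ^ i` to `γ ^ (j - i) • g ⊆ U`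
extends it to all pairs of indices. -/
theorem IsSetup.exists_isCore {γ : SL(2, ℝ)} {g : Set ℍ} {𝒢₀ : Set (Set ℍ)} (h : IsSetup γ g 𝒢₀)
    (hfree : ∀ i : ℤ, i ≠ 0 → γ ^ i • g ≠ g) :
    ∃ U, IsComponentOf U gᶜ ∧ frontier U = g ∧ IsCore γ U 𝒢₀ := by
  obtain ⟨U, hU, hsub, h𝒢⟩ := h.half_plane
  obtain ⟨hHP, hfr⟩ := hU.isHalfPlane h.geodesic
  refine ⟨U, hU, hfr, hHP, fun i j hij => ?_, h.nonempty, h.geodesics, h.pairwiseDisjoint, h𝒢⟩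
  have key : ∀ i j : ℤ, i ≠ j → frontier (γ ^ j • U) ⊆ γ ^ i • U := by
    intro i j hij
    rw [frontier_smul_set, hfr]
    have h1 := hsub (j - i) (hfree _ (by omega))
    have h2 := smul_set_mono (a := γ ^ i) h1
    rwa [smul_smul, ← zpow_add, add_sub_cancel] at h2
  exact (hHP.smul _).disjoint_compl (hHP.smul _) (key i j hij) (key j i hij.symm)

/-- The translates of the half planes `S a`, `a ∈ 𝒢₀`, by the powers of `γ` with exponents in
`A`. -/
def sides (γ : SL(2, ℝ)) (𝒢₀ : Set (Set ℍ)) (S : Set ℍ → Set ℍ) (A : Set ℤ) : Set (Set ℍ) :=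
  {K | ∃ i ∈ A, ∃ a ∈ 𝒢₀, K = γ ^ i • S a}

/-- `S a` is the side of `a` that contains `U`, for all `a ∈ 𝒢₀`. -/
def IsSide (𝒢₀ : Set (Set ℍ)) (U : Set ℍ) (S : Set ℍ → Set ℍ) : Prop :=
  ∀ a ∈ 𝒢₀, IsHalfPlane (S a) ∧ frontier (S a) = a ∧ U ⊆ S a

section
variable {γ : SL(2, ℝ)} {U : Set ℍ} {𝒢₀ : Set (Set ℍ)} {S : Set ℍ → Set ℍ} {A : Set ℤ} {D : Set ℍ}

theorem IsCore.exists_isSide (h : IsCore γ U 𝒢₀) : ∃ S, IsSide 𝒢₀ U S := by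
  obtain ⟨x, hx⟩ := h.isHalfPlane.nonempty
  refine ⟨fun a => connectedComponentIn aᶜ x, fun a ha => ?_⟩
  have hsub : U ⊆ aᶜ := subset_compl_comm.1 (h.subset_compl a ha)
  have hc : IsComponentOf (connectedComponentIn aᶜ x) aᶜ := ⟨x, hsub hx, rfl⟩
  obtain ⟨h1, h2⟩ := hc.isHalfPlane (h.geodesics a ha)
  exact ⟨h1, h2, h.isHalfPlane.isHConvex.isPreconnected.subset_connectedComponentIn hx hsub⟩

theorem IsSide.frontier_image_sides (hS : IsSide 𝒢₀ U S) :
    frontier '' sides γ 𝒢₀ S A = translates γ 𝒢₀ A := by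
  ext s
  constructor
  · rintro ⟨_, ⟨i, hi, a, ha, rfl⟩, rfl⟩
    exact ⟨i, hi, a, ha, by rw [frontier_smul_set, (hS a ha).2.1]⟩
  · rintro ⟨i, hi, a, ha, rfl⟩
    exact ⟨_, ⟨i, hi, a, ha, rfl⟩, by rw [frontier_smul_set, (hS a ha).2.1]⟩

theorem IsCore.translate_subset_smul (h : IsCore γ U 𝒢₀) {i j : ℤ} (hij : i ≠ j) {a : Set ℍ}
    (ha : a ∈ 𝒢₀) : γ ^ j • a ⊆ γ ^ i • U := by
  have h1 := (h.disjoint j i hij.symm).subset_compl_right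
  rw [compl_compl, ← smul_set_compl] at h1
  exact (smul_set_mono (h.subset_compl a ha)).trans h1

/-- `D` is connected and misses `γ ^ i • a`, so it lies on one side. A translate with another index
`j ∈ A` decides which: it lies in the closure of `D` and in `γ ^ i • U`. This is why `A` needs two
elements. -/
theorem IsCore.subset_side (h : IsCore γ U 𝒢₀) (hS : IsSide 𝒢₀ U S) (hA : A.Nontrivial)
    (hD : IsFace (translates γ 𝒢₀ A) D) {K : Set ℍ} (hK : K ∈ sides γ 𝒢₀ S A) : D ⊆ K := by
  obtain ⟨i, hi, a, ha, rfl⟩ := hK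
  obtain ⟨j, hj, hji⟩ := hA.exists_ne i
  obtain ⟨h1, h2, h3⟩ := hS a ha
  obtain ⟨b, hb⟩ := h.nonempty
  have hK := h1.smul (γ ^ i)
  refine hK.isComponentOf.subset_of_isPreconnected hD.1.isPreconnected ?_ ?_
  · rw [frontier_smul_set, h2]
    exact hD.1.subset.trans (compl_subset_compl.2 (subset_sUnion_of_mem ⟨i, hi, a, ha, rfl⟩))
  · obtain ⟨x, hx⟩ := ((h.geodesics b hb).smul (γ ^ j)).nonempty
    have hxK : x ∈ γ ^ i • S a := smul_set_mono h3 (h.translate_subset_smul hji.symm hb hx)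
    have hxD : x ∈ closure D := frontier_subset_closure (hD.2 _ ⟨j, hj, b, hb, rfl⟩ hx)
    obtain ⟨y, hy⟩ := mem_closure_iff.1 hxD _ hK.isOpen hxK
    exact ⟨y, hy.2, hy.1⟩

/-- Different members are bounded by disjoint geodesics. Each of these lies in the closure of `D`,
hence in the closure of the other half plane, and by disjointness in its interior. -/
theorem IsCore.isFamily (h : IsCore γ U 𝒢₀) (hS : IsSide 𝒢₀ U S) (hA : A.Nontrivial)
    (hD : IsFace (translates γ 𝒢₀ A) D) : IsFamily (sides γ 𝒢₀ S A) := by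
  constructor
  · rintro _ ⟨i, -, a, ha, rfl⟩
    exact (hS a ha).1.smul _
  · have key : ∀ K ∈ sides γ 𝒢₀ S A, ∀ s ∈ translates γ 𝒢₀ A, Disjoint s (frontier K) → s ⊆ K := by
      intro K hK s hs hd x hx
      have h1 : x ∈ closure K :=
        closure_mono (h.subset_side hS hA hD hK) (frontier_subset_closure (hD.2 s hs hx))
      obtain ⟨i, hi, a, ha, rfl⟩ := hK
      rw [((hS a ha).1.smul _).closure_eq] at h1
      exact h1.resolve_right fun h2 => disjoint_left.1 hd hx h2
    rintro _ ⟨i, hi, a, ha, rfl⟩ _ ⟨j, hj, b, hb, rfl⟩ hne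
    have hd : Disjoint (γ ^ i • a) (γ ^ j • b) := by
      by_cases hij : i = j
      · subst hij
        rw [disjoint_smul_set]
        exact h.pairwiseDisjoint ha hb fun hab => hne (by rw [hab])
      · have h1 := h.translate_subset_smul hij hb
        rw [disjoint_comm]
        refine disjoint_left.2 fun x hx hx' => ?_
        have h2 := smul_set_mono (a := γ ^ i) (h.subset_compl a ha) hx'
        rw [smul_set_compl] at h2
        exact h2 (h1 hx)
    have e1 : frontier (γ ^ i • S a) = γ ^ i • a := by rw [frontier_smul_set, (hS a ha).2.1]
    have e2 : frontier (γ ^ j • S b) = γ ^ j • b := by rw [frontier_smul_set, (hS b hb).2.1]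
    refine ((hS a ha).1.smul _).disjoint_compl ((hS b hb).1.smul _) ?_ ?_
    · exact e2 ▸ key _ ⟨i, hi, a, ha, rfl⟩ _ ⟨j, hj, b, hb, rfl⟩ (e1 ▸ hd.symm)
    · exact e1 ▸ key _ ⟨j, hj, b, hb, rfl⟩ _ ⟨i, hi, a, ha, rfl⟩ (e2 ▸ hd)

theorem IsCore.eq_sInter (h : IsCore γ U 𝒢₀) (hS : IsSide 𝒢₀ U S) (hA : A.Nontrivial)
    (hD : IsFace (translates γ 𝒢₀ A) D) : D = ⋂₀ sides γ 𝒢₀ S A := by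
  refine subset_antisymm (subset_sInter fun K hK => h.subset_side hS hA hD hK) ?_
  have hfam := h.isFamily hS hA hD
  refine hD.1.subset_of_isPreconnected hfam.isHConvex.isPreconnected ?_ ?_
  · rw [← hS.frontier_image_sides]
    rintro z hz ⟨_, ⟨K, hK, rfl⟩, hzK⟩
    exact (hfam.isHalfPlane K hK).frontier_subset_compl hzK (hz K hK)
  · obtain ⟨x, hx⟩ := hD.1.nonempty
    exact ⟨x, mem_sInter.2 fun K hK => h.subset_side hS hA hD hK hx, hx⟩

theorem IsCore.isFamily_singleton {g : Set ℍ} (h : IsCore γ U {g}) (A : Set ℤ) :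
    IsFamily (sides γ {g} (fun _ => U) A) := by
  constructor
  · rintro _ ⟨i, -, a, -, rfl⟩
    exact h.isHalfPlane.smul _
  · rintro _ ⟨i, hi, a, ha, rfl⟩ _ ⟨j, hj, b, hb, rfl⟩ hne
    exact h.disjoint i j fun hij => hne (by rw [hij])

theorem IsCore.exists_isFace {g : Set ℍ} (h : IsCore γ U {g}) (hfr : frontier U = g) {x : ℍ}
    (hx : ∀ i : ℤ, x ∈ γ ^ i • U) (A : Set ℤ) : ∃ D, IsFace (translates γ {g} A) D := by
  refine ⟨⋂₀ sides γ {g} (fun _ => U) A, ?_⟩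
  have hS : IsSide {g} U fun _ => U := by
    rintro a rfl
    exact ⟨h.isHalfPlane, hfr, subset_rfl⟩
  rw [← hS.frontier_image_sides]
  refine (h.isFamily_singleton A).isFace ⟨x, ?_⟩
  rintro _ ⟨i, -, a, -, rfl⟩
  exact hx i

theorem zpow_smul_mem_sInter_sides {m : ℤ} (hA : ∀ i, i ∈ A → i - m ∈ A) {z : ℍ}
    (hz : z ∈ ⋂₀ sides γ 𝒢₀ S A) : γ ^ m • z ∈ ⋂₀ sides γ 𝒢₀ S A := by
  rintro _ ⟨i, hi, a, ha, rfl⟩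
  have := hz _ ⟨i - m, hA i hi, a, ha, rfl⟩
  rw [mem_smul_set_iff_inv_smul_mem, ← zpow_neg] at this ⊢
  rw [smul_smul, ← zpow_add]
  convert this using 3
  ring

end

/-! ### Normal forms of parabolic and hyperbolic isometries -/

/-- The translation `z ↦ z + t`. -/
def trans (t : ℝ) : SL(2, ℝ) := mkSL 1 t 0 1 (by ring)

/-- The dilation `z ↦ exp t * z`. -/
def dil (t : ℝ) : SL(2, ℝ) := mkSL (Real.exp (t / 2)) 0 0 (Real.exp (-t / 2)) (by
  rw [← Real.exp_add]; ring_nf; simp)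

@[simp] theorem trans_smul_re (t : ℝ) (z : ℍ) : (trans t • z).re = z.re + t := by
  rw [smul_re]; simp [trans]

@[simp] theorem trans_smul_im (t : ℝ) (z : ℍ) : (trans t • z).im = z.im := by
  rw [smul_im]; simp [trans]

theorem exp_half_sq (t : ℝ) : Real.exp (t / 2) ^ 2 = Real.exp t := by
  rw [sq, ← Real.exp_add]; ring_nf

@[simp] theorem dil_smul_re (t : ℝ) (z : ℍ) : (dil t • z).re = Real.exp t * z.re := by
  rw [smul_re]
  simp only [dil, mkSL_zero_zero, mkSL_zero_one, mkSL_one_zero, mkSL_one_one]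
  have h1 : Real.exp (-t / 2) = (Real.exp (t / 2))⁻¹ := by rw [← Real.exp_neg]; ring_nf
  rw [h1, ← exp_half_sq t]
  have := Real.exp_pos (t / 2)
  field_simp
  ring

@[simp] theorem dil_smul_im (t : ℝ) (z : ℍ) : (dil t • z).im = Real.exp t * z.im := by
  rw [smul_im]
  simp only [dil, mkSL_one_zero, mkSL_one_one]
  have h1 : Real.exp (-t / 2) = (Real.exp (t / 2))⁻¹ := by rw [← Real.exp_neg]; ring_nf
  rw [h1, ← exp_half_sq t]
  have := Real.exp_pos (t / 2)
  field_simp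
  ring

theorem dil_smul_expI (t s : ℝ) : dil t • expI s = expI (t + s) :=
  ext_re_im (by simp) (by simp [Real.exp_add])

theorem zpow_smul_of_flow {γ N : SL(2, ℝ)} {φ : ℝ → SL(2, ℝ)}
    (hφ0 : ∀ z : ℍ, φ 0 • z = z) (hφ : ∀ s t, ∀ z : ℍ, φ (s + t) • z = φ s • φ t • z) {t : ℝ}
    (h : ∀ z : ℍ, γ • N • z = N • φ t • z) (k : ℤ) (z : ℍ) : γ ^ k • N • z = N • φ (k * t) • z := by
  induction k generalizing z with
  | zero => simp [hφ0]
  | succ k ih =>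
    rw [zpow_add_one, mul_smul, h, ih, ← hφ]
    push_cast
    ring_nf
  | pred k ih =>
    have h' : ∀ z : ℍ, γ⁻¹ • N • z = N • φ (-t) • z := fun z => by
      rw [inv_smul_eq_iff, h, ← hφ, add_neg_cancel, hφ0]
    rw [zpow_sub_one, mul_smul, h', ih, ← hφ]
    push_cast
    ring_nf

/-- `N` conjugates `γ` to the translation by `t`. -/
def IsTranslation (γ N : SL(2, ℝ)) (t : ℝ) : Prop := t ≠ 0 ∧ ∀ z : ℍ, γ • N • z = N • trans t • z

/-- `N` conjugates `γ` to the dilation by `exp t`. -/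
def IsDilation (γ N : SL(2, ℝ)) (t : ℝ) : Prop := t ≠ 0 ∧ ∀ z : ℍ, γ • N • z = N • dil t • z

theorem IsTranslation.zpow_smul {γ N : SL(2, ℝ)} {t : ℝ} (h : IsTranslation γ N t) (k : ℤ) (z : ℍ) :
    γ ^ k • N • z = N • trans (k * t) • z :=
  zpow_smul_of_flow (fun z => ext_re_im (by simp) (by simp))
    (fun s t z => ext_re_im (by simp; ring) (by simp)) h.2 k z

theorem IsDilation.zpow_smul {γ N : SL(2, ℝ)} {t : ℝ} (h : IsDilation γ N t) (k : ℤ) (z : ℍ) :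
    γ ^ k • N • z = N • dil (k * t) • z :=
  zpow_smul_of_flow (fun z => ext_re_im (by simp) (by simp))
    (fun s t z => ext_re_im (by simp [Real.exp_add]; ring) (by simp [Real.exp_add]; ring)) h.2 k z

theorem Parabolic.exists_isTranslation {γ : SL(2, ℝ)} (h : Parabolic γ) :
    ∃ N t, IsTranslation γ N t := by
  obtain ⟨h1, h2⟩ := h
  have hd := det_entries γ
  rw [Matrix.discr_fin_two, Matrix.trace_fin_two, γ.det_coe] at h2
  -- A parabolic matrix has a double eigenvalue `e = ± 1`, whose sign does not affect the action.
  have aux : ∀ (N : SL(2, ℝ)) (e t : ℝ) (he : e * e = 1), γ * N = N * mkSL e (e * t) 0 e (by rw [he]; ring) →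
      ∀ z : ℍ, γ • N • z = N • trans t • z := by
    intro N e t he hN z
    have he' : e ^ 2 = 1 := by rw [sq, he]
    rw [← mul_smul, hN, mul_smul]
    congr 1
    apply ext_re_im
    · rw [smul_re, trans_smul_re]
      simp only [mkSL_zero_zero, mkSL_zero_one, mkSL_one_zero, mkSL_one_one]
      simp only [mul_zero, zero_mul, zero_add, add_zero, he', he, ne_eq, OfNat.ofNat_ne_zero, not_false_eq_true, zero_pow, div_one, one_mul]
      linear_combination t * he
    · rw [smul_im, trans_smul_im]
      simp [he']
  by_cases hc : γ 1 0 = 0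
  · have hda : γ 0 0 = γ 1 1 := by
      rw [hc] at hd
      nlinarith [sq_nonneg (γ 0 0 - γ 1 1)]
    have ha : γ 0 0 * γ 0 0 = 1 := by rw [hc, ← hda] at hd; linarith
    have ha0 : γ 0 0 ≠ 0 := fun h => by rw [h] at ha; simp at ha
    refine ⟨1, γ 0 1 * γ 0 0, ?_, aux 1 (γ 0 0) _ ha ?_⟩
    · refine mul_ne_zero (fun hb => h1 ⟨γ 0 0, ?_⟩) ha0
      ext i j
      fin_cases i <;> fin_cases j <;> simp [hc, hb, hda]
    · ext i j
      rw [mul_one, one_mul]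
      fin_cases i <;> fin_cases j
      · rfl
      · show γ 0 1 = γ 0 0 * (γ 0 1 * γ 0 0)
        linear_combination -γ 0 1 * ha
      · exact hc
      · exact hda.symm
  -- `x` is the only fixed point of `γ` on the real line; the conjugating matrix maps `∞` to it.
  · set x := (γ 0 0 - γ 1 1) / (2 * γ 1 0) with hx
    set e := (γ 0 0 + γ 1 1) / 2 with he
    have hee : e * e = 1 := by rw [he]; linear_combination h2 / 4
    have he0 : e ≠ 0 := fun h => by rw [h] at hee; simp at hee
    refine ⟨mkSL x (-1) 1 0 (by ring), -(γ 1 0 * e), neg_ne_zero.2 (mul_ne_zero hc he0),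
      aux _ e _ hee ?_⟩
    have hxc : γ 1 0 * x = (γ 0 0 - γ 1 1) / 2 := by rw [hx]; field_simp
    have hq : γ 0 0 * x + γ 0 1 = x * e := by
      apply mul_left_cancel₀ hc
      linear_combination (γ 0 0 - e) * hxc + h2 / 4 - hd
    ext i j
    rw [mul_entries, mul_entries]
    fin_cases i <;> fin_cases j <;> simp
    · exact hq
    · linear_combination hxc * e * e + (γ 0 0 - γ 1 1) / 2 * hee
    · linear_combination hxc
    · linear_combination (-γ 1 0) * hee

theorem HyperbolicWithSide.exists_isDilation {γ : SL(2, ℝ)} {g H : Set ℍ}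
    (h : HyperbolicWithSide γ g H) : ∃ N t, IsDilation γ N t ∧ H = {z | 0 ≤ (N⁻¹ • z).re} ∧
      g ⊆ halfPlane N⁻¹ := by
  obtain ⟨hγ, h, hh, hinv, hd, W, hW, hgW, rfl⟩ := h
  obtain ⟨hHP, hfr⟩ := hW.isHalfPlane hh
  obtain ⟨M, rfl⟩ := hHP
  have hH : halfPlane M ∪ h = {z | 0 ≤ (M • z).re} := by
    rw [← closure_halfPlane, IsHalfPlane.closure_eq ⟨M, rfl⟩, hfr]
  rw [frontier_halfPlane] at hfr
  -- `P` preserves the imaginary axis, so it is diagonal or antidiagonal. An antidiagonal matrix has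
  -- trace zero and is not hyperbolic.
  set P := M * γ * M⁻¹ with hP
  have hax : ∀ s, form P (expI s) = 0 := by
    intro s
    rw [← smul_re_eq_zero_iff, hP, mul_smul, mul_smul]
    have h1 : M⁻¹ • expI s ∈ h := by rw [← hfr]; simp
    have h2 : γ • M⁻¹ • expI s ∈ h := by rw [← hinv]; exact smul_mem_smul_set h1
    rw [← hfr] at h2
    exact h2
  have h0 := hax 0
  have h1 := hax 1
  rw [form_expI] at h0 h1
  rw [Real.exp_zero] at h0
  have he : 1 < Real.exp 1 := by simp
  have hA : P 0 0 * P 1 0 = 0 := by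
    have h3 : P 0 0 * P 1 0 * (Real.exp 1 ^ 2 - 1) = 0 := by linear_combination h1 - h0
    exact (mul_eq_zero.1 h3).resolve_right (by nlinarith)
  have hC : P 0 1 * P 1 1 = 0 := by rw [hA] at h0; linarith
  have hdet := det_entries P
  have htr : P 0 0 + P 1 1 = γ 0 0 + γ 1 1 := by
    have hMd := det_entries M
    have hM : (M⁻¹) 0 0 = M 1 1 ∧ (M⁻¹) 0 1 = -M 0 1 ∧ (M⁻¹) 1 0 = -M 1 0 ∧ (M⁻¹) 1 1 = M 0 0 := by
      rw [Matrix.SpecialLinearGroup.SL2_inv_expl M]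
      exact ⟨rfl, rfl, rfl, rfl⟩
    rw [hP]
    simp only [mul_entries, hM]
    linear_combination (γ 0 0 + γ 1 1) * hMd
  have hdisc : 4 < (P 0 0 + P 1 1) ^ 2 := by
    have h4 : 0 < (γ : Matrix (Fin 2) (Fin 2) ℝ).discr := hγ
    rw [Matrix.discr_fin_two, Matrix.trace_fin_two, γ.det_coe] at h4
    rw [htr]; linarith
  have ha : P 0 0 ≠ 0 := by
    intro ha
    have hd' : P 1 1 = 0 := by
      refine (mul_eq_zero.1 hC).resolve_left fun hb => ?_
      rw [ha, hb] at hdet; simp at hdet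
    rw [ha, hd'] at hdisc; norm_num at hdisc
  have hc : P 1 0 = 0 := (mul_eq_zero.1 hA).resolve_left ha
  have hdd : P 1 1 ≠ 0 := fun hdd => by rw [hc, hdd] at hdet; simp at hdet
  have hb : P 0 1 = 0 := (mul_eq_zero.1 hC).resolve_right hdd
  have had : P 0 0 * P 1 1 = 1 := by rw [hb] at hdet; linarith
  have hpos : 0 < P 0 0 ^ 2 := by positivity
  refine ⟨M⁻¹, Real.log (P 0 0 ^ 2), ⟨?_, fun z => ?_⟩, ?_, ?_⟩
  · intro hlog
    have h5 : P 0 0 ^ 2 = 1 := by rw [← Real.exp_log hpos, hlog, Real.exp_zero]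
    have h6 : P 1 1 ^ 2 = 1 := by nlinarith
    nlinarith
  · have h5 : P • z = dil (Real.log (P 0 0 ^ 2)) • z := by
      have h6 : P 1 1 ^ 2 * P 0 0 ^ 2 = 1 := by
        rw [← mul_pow, mul_comm, had, one_pow]
      apply ext_re_im
      · rw [smul_re, dil_smul_re, Real.exp_log hpos, hc, hb]
        simp only [mul_zero, zero_mul, add_zero, zero_add, ne_eq, OfNat.ofNat_ne_zero, not_false_eq_true, zero_pow]
        rw [div_eq_iff (by positivity), had]
        linear_combination -z.re * h6
      · rw [smul_im, dil_smul_im, Real.exp_log hpos, hc]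
        simp only [zero_mul, add_zero, zero_add, ne_eq, OfNat.ofNat_ne_zero, not_false_eq_true, zero_pow]
        rw [div_eq_iff (by positivity)]
        linear_combination -z.im * h6
    rw [← h5, hP, mul_smul, mul_smul, inv_smul_smul]
  · rw [inv_inv]; exact hH
  · rw [inv_inv]; exact hgW

/-! ### Translations and dilations act freely -/

/-- The powers of `γ` act freely and properly discontinuously. -/
def ActsFreely (γ : SL(2, ℝ)) : Prop :=
  ∀ p : ℍ, ∃ ε > 0, ∀ j : ℤ, j ≠ 0 → ε ≤ dist p (γ ^ j • p)

theorem one_le_abs_intCast {j : ℤ} (hj : j ≠ 0) : (1 : ℝ) ≤ |(j : ℝ)| := by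
  exact_mod_cast Int.one_le_abs hj

theorem dist_trans_smul (t : ℝ) (w : ℍ) :
    Real.cosh (dist w (trans t • w)) = 1 + t ^ 2 / (2 * w.im ^ 2) := by
  have := w.im_pos
  rw [cosh_dist_eq, trans_smul_re, trans_smul_im]
  field_simp
  ring

/-- The smallest displacement is that of `γ` itself. It has to depend on the point, as it tends to
zero towards the cusp. -/
theorem IsTranslation.actsFreely {γ N : SL(2, ℝ)} {t : ℝ} (h : IsTranslation γ N t) :
    ActsFreely γ := by
  intro p
  set w := N⁻¹ • p with hw
  have hp : p = N • w := by simp [hw]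
  refine ⟨dist w (trans t • w), dist_pos.2 fun he => h.1 ?_, fun j hj => ?_⟩
  · have := congrArg UpperHalfPlane.re he
    rw [trans_smul_re] at this
    linarith
  · rw [hp, h.zpow_smul, dist_smul, ← abs_of_nonneg (dist_nonneg (x := w) (y := trans t • w)),
      ← abs_of_nonneg (dist_nonneg (x := w) (y := trans (j * t) • w)), ← Real.cosh_le_cosh,
      dist_trans_smul, dist_trans_smul, mul_pow]
    have h1 : (1 : ℝ) ≤ (j : ℝ) ^ 2 := by
      rw [← sq_abs]; nlinarith [one_le_abs_intCast hj]
    have := w.im_pos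
    have h2 : t ^ 2 ≤ (j : ℝ) ^ 2 * t ^ 2 := le_mul_of_one_le_left (sq_nonneg t) h1
    gcongr

theorem IsDilation.actsFreely {γ N : SL(2, ℝ)} {t : ℝ} (h : IsDilation γ N t) : ActsFreely γ := by
  intro p
  set w := N⁻¹ • p with hw
  have hp : p = N • w := by simp [hw]
  refine ⟨|t|, abs_pos.2 h.1, fun j hj => ?_⟩
  rw [hp, h.zpow_smul, dist_smul]
  refine le_trans ?_ (UpperHalfPlane.dist_log_im_le _ _)
  rw [dil_smul_im, Real.log_mul (Real.exp_ne_zero _) w.im_pos.ne', Real.log_exp, Real.dist_eq,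
    show Real.log w.im - (j * t + Real.log w.im) = -(j * t) by ring, abs_neg, abs_mul]
  exact le_mul_of_one_le_left (abs_nonneg t) (one_le_abs_intCast hj)

/-- The form of an invariant geodesic would vanish at three points of an orbit in arithmetic
progression: second differences give `A = 0`, first differences `B = 0`, against discriminant 1. -/
theorem IsTranslation.zpow_smul_ne {γ N : SL(2, ℝ)} {t : ℝ} (h : IsTranslation γ N t) {g : Set ℍ}
    (hg : IsGeodesic g) {i : ℤ} (hi : i ≠ 0) : γ ^ i • g ≠ g := by
  intro heq
  obtain ⟨M, rfl⟩ := isGeodesic_iff.1 hg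
  have hT : (i * t : ℝ) ≠ 0 := mul_ne_zero (Int.cast_ne_zero.2 hi) h.1
  set T : ℝ := i * t
  have step : ∀ w : ℍ, form (M * N) w = 0 → form (M * N) (trans T • w) = 0 := by
    intro w hw
    rw [← smul_re_eq_zero_iff, mul_smul] at hw ⊢
    rw [← h.zpow_smul]
    have : γ ^ i • N • w ∈ {z : ℍ | (M • z).re = 0} := by
      rw [← heq]; exact smul_mem_smul_set hw
    exact this
  obtain ⟨z, hz⟩ := hg.nonempty
  have h0 : form (M * N) (N⁻¹ • z) = 0 := by
    rw [← smul_re_eq_zero_iff, mul_smul, smul_inv_smul]; exact hz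
  have h1 := step _ h0
  have h2 := step _ h1
  have hd := form_disc (M * N)
  simp only [form, trans_smul_re, trans_smul_im] at h0 h1 h2
  set A := (M * N) 0 0 * (M * N) 1 0
  set B := (M * N) 0 0 * (M * N) 1 1 + (M * N) 0 1 * (M * N) 1 0
  have hA : A = 0 := by
    have : A * T ^ 2 = 0 := by linear_combination (h2 - 2 * h1 + h0) / 2
    exact (mul_eq_zero.1 this).resolve_right (pow_ne_zero 2 hT)
  have hB : B = 0 := by
    rw [hA] at h0 h1
    have : B * T = 0 := by linear_combination h1 - h0
    exact (mul_eq_zero.1 this).resolve_right hT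
  rw [hA, hB] at hd
  norm_num at hd

/-- Again three points of one orbit annihilate `A` and `B`. The position off the axis is essential,
since the axis itself is invariant. -/
theorem IsDilation.zpow_smul_ne {γ N : SL(2, ℝ)} {t : ℝ} (h : IsDilation γ N t) {g : Set ℍ}
    (hg : IsGeodesic g) (hsub : g ⊆ halfPlane N⁻¹) {i : ℤ} (hi : i ≠ 0) : γ ^ i • g ≠ g := by
  intro heq
  obtain ⟨M, rfl⟩ := isGeodesic_iff.1 hg
  have hT : (i * t : ℝ) ≠ 0 := mul_ne_zero (Int.cast_ne_zero.2 hi) h.1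
  set T : ℝ := i * t
  have step : ∀ w : ℍ, form (M * N) w = 0 → form (M * N) (dil T • w) = 0 := by
    intro w hw
    rw [← smul_re_eq_zero_iff, mul_smul] at hw ⊢
    rw [← h.zpow_smul]
    have : γ ^ i • N • w ∈ {z : ℍ | (M • z).re = 0} := by
      rw [← heq]; exact smul_mem_smul_set hw
    exact this
  obtain ⟨z, hz⟩ := hg.nonempty
  have h0 : form (M * N) (N⁻¹ • z) = 0 := by
    rw [← smul_re_eq_zero_iff, mul_smul, smul_inv_smul]; exact hz
  have hpos : 0 < (N⁻¹ • z).re := hsub hz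
  set w := N⁻¹ • z
  have h1 := step _ h0
  have h2 := step _ h1
  have hd := form_disc (M * N)
  simp only [form, dil_smul_re, dil_smul_im] at h0 h1 h2
  set A := (M * N) 0 0 * (M * N) 1 0
  set B := (M * N) 0 0 * (M * N) 1 1 + (M * N) 0 1 * (M * N) 1 0
  set C := (M * N) 0 1 * (M * N) 1 1
  have hE : 0 < Real.exp T := Real.exp_pos T
  have hE1 : Real.exp T - 1 ≠ 0 := fun h' => hT (by
    have : Real.exp T = 1 := by linarith
    simpa using this)
  set E := Real.exp T
  have e1 : A * (w.re ^ 2 + w.im ^ 2) * (E + 1) + B * w.re = 0 := by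
    apply mul_left_cancel₀ hE1
    linear_combination h1 - h0
  have e2 : A * (w.re ^ 2 + w.im ^ 2) * E ^ 2 * (E + 1) + B * w.re * E = 0 := by
    apply mul_left_cancel₀ hE1
    linear_combination h2 - h1
  have e3 : A * (w.re ^ 2 + w.im ^ 2) * (E * (E + 1) * (E - 1)) = 0 := by
    linear_combination e2 - E * e1
  have hs : 0 < w.re ^ 2 + w.im ^ 2 := by positivity
  have hA : A = 0 := by
    have h3 := (mul_eq_zero.1 e3).resolve_right (mul_ne_zero (by positivity) hE1)
    exact (mul_eq_zero.1 h3).resolve_right hs.ne'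
  have hB : B = 0 := by
    rw [hA] at e1
    have : B * w.re = 0 := by linarith
    exact (mul_eq_zero.1 this).resolve_right hpos.ne'
  rw [hA, hB] at hd
  norm_num at hd

theorem IsTranslation.exists_horoball {γ N : SL(2, ℝ)} {t : ℝ} (h : IsTranslation γ N t)
    {U : Set ℍ} {𝒢₀ : Set (Set ℍ)} (hc : IsCore γ U 𝒢₀) :
    ∃ r > 0, ∀ z : ℍ, r < z.im → ∀ i : ℤ, N • z ∈ γ ^ i • U := by
  obtain ⟨M, hM⟩ := hc.isHalfPlane
  have hmem : ∀ (i : ℤ) (z : ℍ), N • z ∈ γ ^ i • U ↔ 0 < form (M * N) (trans (-i * t) • z) := by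
    intro i z
    rw [mem_smul_set_iff_inv_smul_mem, ← zpow_neg, h.zpow_smul, hM]
    simp only [halfPlane, mem_ofPred_eq]
    rw [← mul_smul, smul_re_pos_iff]
    push_cast
    rfl
  have hd := form_disc (M * N)
  have hpair : ∀ z : ℍ, 0 < form (M * N) z ∨ 0 < form (M * N) (trans (-t) • z) := by
    intro z
    by_contra! hcon
    refine disjoint_left.1 (hc.disjoint 0 1 (by norm_num)) (?_ : N • z ∈ _) ?_
    · rw [mem_compl_iff, hmem, not_lt]
      have : trans (-((0 : ℤ) : ℝ) * t) • z = z := ext_re_im (by simp) (by simp)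
      rw [this]; exact hcon.1
    · rw [mem_compl_iff, hmem, not_lt]
      simpa using hcon.2
  simp only [form, trans_smul_re, trans_smul_im] at hpair hmem
  set A := (M * N) 0 0 * (M * N) 1 0
  set B := (M * N) 0 0 * (M * N) 1 1 + (M * N) 0 1 * (M * N) 1 0
  set C := (M * N) 0 1 * (M * N) 1 1
  -- If `A ≤ 0`, the complement of `U` contains a vertical half plane or everything outside a
  -- semicircle. A point far enough out (`A = 0`) or high enough (`A < 0`) then lies in it together
  -- with its translate, against `hpair`.
  have hA : 0 < A := by
    by_contra! hA
    rcases hA.eq_or_lt with hA | hA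
    · rw [hA] at hpair hd
      have hB : B ≠ 0 := fun hB => by rw [hB] at hd; norm_num at hd
      let z : ℍ := ⟨⟨-(|C| + |B * t|) / B, 1⟩, one_pos⟩
      have hz : B * z.re = -(|C| + |B * t|) := by
        show B * (-(|C| + |B * t|) / B) = _
        field_simp
      have := le_abs_self C
      have := neg_abs_le (B * t)
      have := abs_nonneg (B * t)
      rcases hpair z with h1 | h1
      · linarith
      · have : B * (z.re + -t) = B * z.re - B * t := by ring
        linarith
    · set Q := |B * t| + |C| + |A| * t ^ 2
      have hQ : 0 ≤ Q := by positivity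
      let z : ℍ := ⟨⟨0, √(Q / (-A) + 1)⟩, Real.sqrt_pos.2 (by
        have := div_nonneg hQ (neg_pos.2 hA).le
        linarith)⟩
      have hz : A * z.im ^ 2 = -Q + A := by
        show A * √(Q / (-A) + 1) ^ 2 = _
        rw [Real.sq_sqrt (by have := div_nonneg hQ (neg_pos.2 hA).le; linarith)]
        have := hA.ne
        field_simp
      have hzr : z.re = 0 := rfl
      have := le_abs_self C
      have := neg_abs_le (B * t)
      have := abs_nonneg (B * t)
      have hAt : 0 ≤ |A| * t ^ 2 := by positivity
      have hAt' : A * t ^ 2 ≤ 0 := mul_nonpos_of_nonpos_of_nonneg hA.le (sq_nonneg t)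
      rcases hpair z with h1 | h1
      · rw [hzr] at h1
        have : A * (0 ^ 2 + z.im ^ 2) = A * z.im ^ 2 := by ring
        simp only [Q] at hz
        linarith
      · rw [hzr] at h1
        have : A * ((0 + -t) ^ 2 + z.im ^ 2) = A * t ^ 2 + A * z.im ^ 2 := by ring
        simp only [Q] at hz
        linarith
  -- The Euclidean radius of the semicircle that bounds `U` in these coordinates, hence a height
  -- that no translate exceeds.
  refine ⟨1 / (2 * A), by positivity, fun z hz i => ?_⟩
  rw [hmem]
  set x := z.re + -(i : ℝ) * t
  have h1 : 4 * A * (A * (x ^ 2 + z.im ^ 2) + B * x + C) = (2 * A * x + B) ^ 2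
      + ((2 * A * z.im) ^ 2 - 1) := by linear_combination -hd
  have h2 : 1 < 2 * A * z.im := by
    rw [div_lt_iff₀ (by positivity)] at hz
    linarith
  have h3 : 0 < 4 * A * (A * (x ^ 2 + z.im ^ 2) + B * x + C) := by
    rw [h1]; nlinarith [sq_nonneg (2 * A * x + B)]
  exact pos_of_mul_pos_right h3 (by positivity)

theorem IsDilation.smul_axis_iff {γ N : SL(2, ℝ)} {t : ℝ} (h : IsDilation γ N t) (i : ℤ) (z : ℍ) :
    (N⁻¹ • γ ^ i • z).re = Real.exp (i * t) * (N⁻¹ • z).re := by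
  have : γ ^ i • z = N • dil (i * t) • N⁻¹ • z := by rw [← h.zpow_smul, smul_inv_smul]
  rw [this, inv_smul_smul, dil_smul_re]

/-- The axis lies in all translates of `U`, and the complement of `U` lies on one side of the axis. -/
theorem IsDilation.axis_subset {γ N : SL(2, ℝ)} {t : ℝ} (h : IsDilation γ N t)
    {U : Set ℍ} {𝒢₀ : Set (Set ℍ)} (hc : IsCore γ U 𝒢₀) (hsub : frontier U ⊆ halfPlane N⁻¹) :
    (∀ i : ℤ, {z : ℍ | (N⁻¹ • z).re = 0} ⊆ γ ^ i • U) ∧ Uᶜ ⊆ halfPlane N⁻¹ := by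
  set a := {z : ℍ | (N⁻¹ • z).re = 0} with ha
  have hag : IsGeodesic a := isGeodesic_iff.2 ⟨_, rfl⟩
  have hinv : ∀ (i : ℤ) z, z ∈ a → γ ^ i • z ∈ a := by
    intro i z hz
    show (N⁻¹ • γ ^ i • z).re = 0
    rw [h.smul_axis_iff, show (N⁻¹ • z).re = 0 from hz, mul_zero]
  -- The axis misses the frontier of `U`, so it lies inside `U` or outside. Being invariant, in the
  -- latter case it would lie in two disjoint complements.
  have hU : a ⊆ U := by
    by_cases hne : (a ∩ U).Nonempty
    · refine hc.isHalfPlane.isComponentOf.subset_of_isPreconnected hag.isPreconnected ?_ hne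
      intro z hz hz'
      have : 0 < (N⁻¹ • z).re := hsub hz'
      rw [show (N⁻¹ • z).re = 0 from hz] at this
      exact lt_irrefl _ this
    · exfalso
      obtain ⟨z, hz⟩ := hag.nonempty
      have hout : ∀ z ∈ a, z ∉ U := fun z hz hzU => hne ⟨z, hz, hzU⟩
      refine disjoint_left.1 (hc.disjoint 0 1 (by norm_num)) (?_ : z ∈ _) ?_
      · simpa using hout z hz
      · rw [mem_compl_iff, mem_smul_set_iff_inv_smul_mem, ← zpow_neg]
        exact hout _ (hinv _ z hz)
  refine ⟨fun i z hz => ?_, ?_⟩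
  · rw [mem_smul_set_iff_inv_smul_mem, ← zpow_neg]
    exact hU (hinv _ z hz)
  · refine (IsHalfPlane.isComponentOf ⟨N⁻¹, rfl⟩).subset_of_isPreconnected
      hc.isHalfPlane.isHConvex_compl.isPreconnected ?_ ?_
    · rw [frontier_halfPlane]
      exact compl_subset_compl.2 hU
    · obtain ⟨x, hx⟩ := hc.isHalfPlane.isGeodesic_frontier.nonempty
      exact ⟨x, hc.isHalfPlane.frontier_subset_compl hx, hsub hx⟩

/-! ### Quotient surfaces -/

/-- The projection of `D` to `D / Γ`. -/
def proj (Γ : Subgroup SL(2, ℝ)) (D : Set ℍ) : D → QuotientSurface Γ D :=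
  Quotient.mk (quotientSetoid Γ D)

/-- The region `D` is mapped into itself by `Γ`. -/
def IsInvariant (Γ : Subgroup SL(2, ℝ)) (D : Set ℍ) : Prop := ∀ δ ∈ Γ, ∀ z ∈ D, δ • z ∈ D

/-- The action of `Γ` on the hyperbolic plane is free, up to elements that act trivially, and
properly discontinuous. -/
def IsDiscontinuous (Γ : Subgroup SL(2, ℝ)) : Prop :=
  ∀ p : ℍ, ∃ ε > 0, ∀ δ ∈ Γ, (∀ z : ℍ, δ • z = z) ∨ ε ≤ dist p (δ • p)

theorem ActsFreely.isDiscontinuous {γ : SL(2, ℝ)} (h : ActsFreely γ) (m : ℕ) :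
    IsDiscontinuous (Subgroup.zpowers (γ ^ m)) := by
  intro p
  obtain ⟨ε, hε, hj⟩ := h p
  refine ⟨ε, hε, ?_⟩
  rintro _ ⟨k, rfl⟩
  have e : (γ ^ m) ^ k = γ ^ (m * k : ℤ) := by rw [zpow_mul, zpow_natCast]
  simp only [e]
  by_cases h0 : (m * k : ℤ) = 0
  · left; intro z; rw [h0]; simp
  · exact Or.inr (hj _ h0)

section
variable {Γ : Subgroup SL(2, ℝ)} {D : Set ℍ}

theorem proj_surjective : Function.Surjective (proj Γ D) := Quotient.mk_surjective

theorem proj_eq_iff {x y : D} : proj Γ D x = proj Γ D y ↔ ∃ δ ∈ Γ, δ • (x : ℍ) = y := Quotient.eq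

theorem dist_proj (x y : D) : dist (proj Γ D x) (proj Γ D y) = orbitDist Γ x y := rfl

theorem orbitDist_le_dist (z w : ℍ) : orbitDist Γ z w ≤ dist z w := by
  simpa using orbitDist_le Γ z w Γ.one_mem

theorem exists_dist_lt_of_orbitDist_lt {z w : ℍ} {r : ℝ} (h : orbitDist Γ z w < r) :
    ∃ δ ∈ Γ, dist z (δ • w) < r := by
  obtain ⟨δ, hδ⟩ := exists_lt_of_ciInf_lt h
  exact ⟨δ, δ.2, hδ⟩

theorem continuous_proj : Continuous (proj Γ D) := by
  refine (LipschitzWith.of_dist_le_mul (K := 1) fun x y => ?_).continuous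
  rw [dist_proj, NNReal.coe_one, one_mul]
  exact orbitDist_le_dist _ _

/-- An element that moves `p` by at least `ε` takes `y` to a point at distance at least `ε - 2 · ε /
4 = ε / 2` from `x`, which exceeds `dist x y`. -/
theorem orbitDist_eq_dist {p : ℍ} {ε : ℝ} (h : ∀ δ ∈ Γ, (∀ z : ℍ, δ • z = z) ∨ ε ≤ dist p (δ • p))
    {x y : ℍ} (hx : dist p x < ε / 4) (hy : dist p y < ε / 4) : orbitDist Γ x y = dist x y := by
  refine le_antisymm (orbitDist_le_dist x y) (le_ciInf fun δ => ?_)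
  rcases h δ δ.2 with h1 | h1
  · rw [h1]
  · have h2 := dist_triangle4 p x ((δ : SL(2, ℝ)) • y) ((δ : SL(2, ℝ)) • p)
    rw [dist_smul, dist_comm y] at h2
    have h3 := dist_triangle_left x y p
    linarith

theorem isOpen_image_proj (hD : IsInvariant Γ D) {O : Set ℍ} (hO : IsOpen O) :
    IsOpen (proj Γ D '' {x : D | (x : ℍ) ∈ O}) := by
  rw [Metric.isOpen_iff]
  rintro _ ⟨x, hx, rfl⟩
  obtain ⟨ε, hε, hball⟩ := Metric.isOpen_iff.1 hO x hx
  refine ⟨ε, hε, fun q hq => ?_⟩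
  obtain ⟨y, rfl⟩ := proj_surjective q
  rw [Metric.mem_ball, dist_comm, dist_proj] at hq
  obtain ⟨δ, hδ, hd⟩ := exists_dist_lt_of_orbitDist_lt hq
  exact ⟨⟨δ • (y : ℍ), hD δ hδ y y.2⟩, hball (by rwa [Metric.mem_ball, dist_comm]),
    (proj_eq_iff.2 ⟨δ, hδ, rfl⟩ : proj Γ D y = _).symm⟩

theorem eq_of_dist_proj_eq_zero (hΓ : IsDiscontinuous Γ) {p q : QuotientSurface Γ D}
    (h : dist p q = 0) : p = q := by
  obtain ⟨x, rfl⟩ := proj_surjective p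
  obtain ⟨y, rfl⟩ := proj_surjective q
  obtain ⟨ε, hε, hd⟩ := hΓ x
  rw [dist_proj] at h
  obtain ⟨δ, hδ, hlt⟩ := exists_dist_lt_of_orbitDist_lt (h.trans_lt (by linarith : 0 < ε / 4))
  have h1 : orbitDist Γ x (δ • (y : ℍ)) = dist (x : ℍ) (δ • (y : ℍ)) :=
    orbitDist_eq_dist hd (by simp; linarith) hlt
  rw [orbitDist_smul_right _ _ _ hδ, h] at h1
  exact (proj_eq_iff.2 ⟨δ, hδ, (dist_eq_zero.1 h1.symm).symm⟩ : proj Γ D y = _).symm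

theorem connectedSpace_quotient (hD : IsHConvex D) (hne : D.Nonempty) :
    ConnectedSpace (QuotientSurface Γ D) := by
  have : ConnectedSpace D := Subtype.connectedSpace ⟨hne, hD.isPreconnected⟩
  exact proj_surjective.connectedSpace continuous_proj

/-- Serves interior and boundary points alike: `T` is the trace of the region in coordinates centred
at the point, a disc or a half disc. -/
theorem exists_chart (hΓ : IsDiscontinuous Γ) (hD : IsInvariant Γ D) (p : D) {ρ : ℝ} (hρ : 0 < ρ) :
    ∃ r > 0, r ≤ ρ ∧ ∀ (M : SL(2, ℝ)) (T : Set ℍ), M⁻¹ • UpperHalfPlane.I = (p : ℍ) →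
      (∀ w, w ∈ T ↔ w ∈ Metric.ball UpperHalfPlane.I r ∧ M⁻¹ • w ∈ D) →
      ∃ e : Metric.ball (proj Γ D p) r ≃ᵢ T, ∀ q : Metric.ball (proj Γ D p) r, ∃ h, (q : QuotientSurface Γ D)
        = proj Γ D ⟨M⁻¹ • (e q : ℍ), h⟩ := by
  obtain ⟨ε, hε, hd⟩ := hΓ p
  refine ⟨min ρ (ε / 4), lt_min hρ (by linarith), min_le_left _ _, fun M T hM hT => ?_⟩
  set r := min ρ (ε / 4)
  have hr : r ≤ ε / 4 := min_le_right _ _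
  have hdist : ∀ w : ℍ, dist (p : ℍ) (M⁻¹ • w) = dist w UpperHalfPlane.I := fun w => by
    rw [← hM, dist_smul, dist_comm]
  have hlt : ∀ w ∈ T, dist (p : ℍ) (M⁻¹ • w) < r := fun w hw => by
    rw [hdist]; exact ((hT w).1 hw).1
  have hpp : dist (p : ℍ) p < ε / 4 := by rw [dist_self]; linarith
  let f : T → Metric.ball (proj Γ D p) r := fun w =>
    ⟨proj Γ D ⟨M⁻¹ • (w : ℍ), ((hT w).1 w.2).2⟩, by
      rw [Metric.mem_ball, dist_comm, dist_proj]
      exact (orbitDist_le_dist _ _).trans_lt (hlt w w.2)⟩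
  have hf : Isometry f := by
    refine Isometry.of_dist_eq fun w w' => ?_
    show orbitDist Γ (M⁻¹ • (w : ℍ)) (M⁻¹ • (w' : ℍ)) = dist (w : ℍ) w'
    rw [orbitDist_eq_dist hd ((hlt w w.2).trans_le hr) ((hlt w' w'.2).trans_le hr), dist_smul]
  have hsurj : Function.Surjective f := by
    rintro ⟨q, hq⟩
    obtain ⟨y, rfl⟩ := proj_surjective q
    rw [Metric.mem_ball, dist_comm, dist_proj] at hq
    obtain ⟨δ, hδ, hlt'⟩ := exists_dist_lt_of_orbitDist_lt hq
    have hmem : M • δ • (y : ℍ) ∈ T := by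
      rw [hT, inv_smul_smul, Metric.mem_ball, ← hdist, inv_smul_smul]
      exact ⟨hlt', hD δ hδ y y.2⟩
    refine ⟨⟨_, hmem⟩, Subtype.ext ?_⟩
    exact (proj_eq_iff.2 ⟨δ, hδ, by simp⟩ : proj Γ D y = _).symm
  let E : T ≃ᵢ Metric.ball (proj Γ D p) r :=
    ⟨Equiv.ofBijective f ⟨hf.injective, hsurj⟩, hf⟩
  refine ⟨E.symm, fun q => ⟨((hT _).1 (E.symm q).2).2, ?_⟩⟩
  have : (q : QuotientSurface Γ D) = (E (E.symm q) : QuotientSurface Γ D) := by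
    rw [E.apply_symm_apply]
  exact this

theorem exists_interior_chart (hΓ : IsDiscontinuous Γ) (hD : IsInvariant Γ D) (p : D)
    (hp : (p : ℍ) ∈ interior D) : ∃ ε > 0,
      Nonempty (Metric.ball (proj Γ D p) ε ≃ᵢ Metric.ball (UpperHalfPlane.I : ℍ) ε) := by
  obtain ⟨ρ, hρ, hball⟩ := Metric.isOpen_iff.1 isOpen_interior _ hp
  obtain ⟨r, hr, hrρ, hchart⟩ := exists_chart hΓ hD p hρ
  obtain ⟨M, hM⟩ := MulAction.exists_smul_eq SL(2, ℝ) UpperHalfPlane.I (p : ℍ)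
  obtain ⟨e, -⟩ := hchart M⁻¹ (Metric.ball UpperHalfPlane.I r) (by rw [inv_inv, hM]) fun w => by
    refine ⟨fun hw => ⟨hw, interior_subset (hball ?_)⟩, fun hw => hw.1⟩
    rw [Metric.mem_ball, inv_inv, ← hM, dist_smul]
    exact lt_of_lt_of_le hw hrρ
  exact ⟨r, hr, ⟨e⟩⟩

theorem isHyperbolicSurface_of_isOpen (hΓ : IsDiscontinuous Γ) (hD : IsInvariant Γ D)
    (hconv : IsHConvex D) (hne : D.Nonempty) (hopen : IsOpen D) :
    IsHyperbolicSurface (QuotientSurface Γ D) ∅ where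
  connected := connectedSpace_quotient hconv hne
  interior_chart p _ := by
    obtain ⟨x, rfl⟩ := proj_surjective p
    exact exists_interior_chart hΓ hD x (by rw [hopen.interior_eq]; exact x.2)
  boundary_chart p hp := hp.elim

end

/-! ### Cusps and closed geodesic boundary curves -/

theorem isTranslation_unitTranslation : IsTranslation unitTranslation 1 1 := by
  refine ⟨one_ne_zero, fun z => ?_⟩
  rw [one_smul, one_smul]
  congr 1

theorem IsTranslation.pow {γ N : SL(2, ℝ)} {t : ℝ} (h : IsTranslation γ N t) {m : ℕ} (hm : 0 < m) :
    IsTranslation (γ ^ m) N (m * t) := by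
  refine ⟨mul_ne_zero (by positivity) h.1, fun z => ?_⟩
  have := h.zpow_smul m z
  rwa [zpow_natCast, Int.cast_natCast] at this

theorem IsDilation.pow {γ N : SL(2, ℝ)} {t : ℝ} (h : IsDilation γ N t) {m : ℕ} (hm : 0 < m) :
    IsDilation (γ ^ m) N (m * t) := by
  refine ⟨mul_ne_zero (by positivity) h.1, fun z => ?_⟩
  have := h.zpow_smul m z
  rwa [zpow_natCast, Int.cast_natCast] at this

/-- Rescaling by `|t|` normalises the step only up to sign: `z + 1` and `z - 1` are not conjugate by
an orientation-preserving isometry. -/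
theorem IsTranslation.exists_unit {γ N : SL(2, ℝ)} {t : ℝ} (h : IsTranslation γ N t) :
    ∃ s : ℤ, s * s = 1 ∧ IsTranslation γ (N * dil (Real.log |t|)) s := by
  have key : ∀ s : ℤ, s * s = 1 → |t| * s = t → IsTranslation γ (N * dil (Real.log |t|)) s := by
    intro s hs hts
    refine ⟨fun h0 => ?_, fun z => ?_⟩
    · rw [Int.cast_eq_zero.1 h0] at hs; simp at hs
    · rw [mul_smul, h.2, mul_smul]
      congr 1
      apply ext_re_im
      · simp only [trans_smul_re, dil_smul_re, Real.exp_log (abs_pos.2 h.1)]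
        rw [mul_add, hts]
      · simp
  rcases abs_cases t with ⟨ht, -⟩ | ⟨ht, -⟩
  · exact ⟨1, by norm_num, key 1 (by norm_num) (by simp [ht])⟩
  · exact ⟨-1, by norm_num, key (-1) (by norm_num) (by simp [ht])⟩

theorem IsTranslation.hasCusp {γ N : SL(2, ℝ)} {t : ℝ} (h : IsTranslation γ N t) {D : Set ℍ}
    (hD : IsInvariant (Subgroup.zpowers γ) D) {r : ℝ} (hr : 0 < r)
    (hball : ∀ z : ℍ, r < z.im → N • z ∈ D) : HasCusp (QuotientSurface (Subgroup.zpowers γ) D) := by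
  obtain ⟨s, hs, hN⟩ := h.exists_unit
  set κ := Real.log |t|
  have hκ : ∀ z : ℍ, r / Real.exp κ < z.im → (N * dil κ) • z ∈ D := by
    intro z hz
    rw [mul_smul]
    refine hball _ ?_
    rw [div_lt_iff₀ (Real.exp_pos κ)] at hz
    simpa [mul_comm] using hz
  have hu : ∀ (k : ℤ) (z : ℍ), unitTranslation ^ k • z = trans k • z := by
    intro k z
    have := isTranslation_unitTranslation.zpow_smul k z
    rwa [one_smul, one_smul, mul_one] at this
  have hγ : ∀ (k : ℤ) (z : ℍ), γ ^ k • (N * dil κ) • z = (N * dil κ) • unitTranslation ^ (k * s) • z := by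
    intro k z
    rw [hN.zpow_smul, hu]
    push_cast; rfl
  have hγ' : ∀ (k : ℤ) (z : ℍ), (N * dil κ) • unitTranslation ^ k • z = γ ^ (k * s) • (N * dil κ) • z := by
    intro k z
    rw [hγ, mul_assoc, hs, mul_one]
  have hdist : ∀ z w : ℍ, orbitDist (Subgroup.zpowers γ) ((N * dil κ) • z) ((N * dil κ) • w)
      = orbitDist (Subgroup.zpowers unitTranslation) z w := by
    intro z w
    refine le_antisymm (le_ciInf ?_) (le_ciInf ?_)
    · rintro ⟨_, k, rfl⟩
      refine (orbitDist_le _ _ _ (Subgroup.zpow_mem_zpowers γ (k * s))).trans (le_of_eq ?_)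
      rw [← hγ', dist_smul]
    · rintro ⟨_, k, rfl⟩
      refine (orbitDist_le _ _ _ (Subgroup.zpow_mem_zpowers unitTranslation (k * s))).trans (le_of_eq ?_)
      simp only
      rw [hγ, dist_smul]
  refine ⟨r / Real.exp κ, by positivity, Quotient.lift (fun z => proj (Subgroup.zpowers γ) D
    ⟨(N * dil κ) • (z : ℍ), hκ z z.2⟩) ?_, ?_, ?_⟩
  · rintro x y ⟨_, ⟨k, rfl⟩, hk⟩
    refine proj_eq_iff.2 ⟨γ ^ (k * s), ⟨_, rfl⟩, ?_⟩
    show γ ^ (k * s) • (N * dil κ) • (x : ℍ) = (N * dil κ) • (y : ℍ)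
    rw [← hγ', ← hk]
  · refine Isometry.of_dist_eq ?_
    rintro ⟨x⟩ ⟨y⟩
    exact hdist x y
  · convert isOpen_image_proj hD (O := (N * dil κ) • {z : ℍ | r / Real.exp κ < z.im})
      ((isOpen_lt continuous_const UpperHalfPlane.continuous_im).smul _) using 1
    ext q
    constructor
    · rintro ⟨⟨x⟩, rfl⟩
      exact ⟨_, smul_mem_smul_set x.2, rfl⟩
    · rintro ⟨⟨x, hx⟩, ⟨z, hz, rfl⟩, rfl⟩
      exact ⟨Quotient.mk _ ⟨z, hz⟩, rfl⟩

theorem IsDilation.hasOneGeodesicBoundary {γ N : SL(2, ℝ)} {t : ℝ} (h : IsDilation γ N t)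
    {D : Set ℍ} (hΓ : IsDiscontinuous (Subgroup.zpowers γ))
    (hD : IsInvariant (Subgroup.zpowers γ) (D ∩ {z | 0 ≤ (N⁻¹ • z).re}))
    (hconv : IsHConvex D) (hopen : IsOpen D) (haxis : {z : ℍ | (N⁻¹ • z).re = 0} ⊆ D) :
    HasOneGeodesicBoundary (QuotientSurface (Subgroup.zpowers γ) (D ∩ {z | 0 ≤ (N⁻¹ • z).re})) := by
  set E := D ∩ {z : ℍ | 0 ≤ (N⁻¹ • z).re}
  set Γ := Subgroup.zpowers γ
  have hmem : ∀ s, N • expI s ∈ E := fun s => ⟨haxis (by simp), by simp⟩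
  let φ : ℝ → E := fun s => ⟨N • expI s, hmem s⟩
  have hφ : Continuous φ := (isGeodesicCurve_smul_expI N).continuous.subtype_mk _
  have hpφ : Continuous fun s => proj Γ E (φ s) := continuous_proj.comp hφ
  have hB : ∀ x : E, proj Γ E x ∈ range (fun s => proj Γ E (φ s)) ↔ (N⁻¹ • (x : ℍ)).re = 0 := by
    intro x
    constructor
    · rintro ⟨s, hs⟩
      obtain ⟨_, ⟨k, rfl⟩, hk⟩ := proj_eq_iff.1 hs
      rw [← hk]
      simp only
      rw [h.smul_axis_iff]
      simp [φ]
    · intro hx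
      refine ⟨Real.log (N⁻¹ • (x : ℍ)).im, congrArg _ (Subtype.ext ?_)⟩
      show N • expI _ = (x : ℍ)
      rw [expI_log hx, smul_inv_smul]
  refine ⟨range fun s => proj Γ E (φ s), ⟨connectedSpace_quotient
    (hconv.inter (isHConvex_closed N⁻¹)) ⟨_, hmem 0⟩, ?_, ?_⟩, isConnected_range hpφ, ?_⟩
  · intro p hp
    obtain ⟨x, rfl⟩ := proj_surjective p
    refine exists_interior_chart hΓ hD x ?_
    rw [hB] at hp
    have hx : (x : ℍ) ∈ D ∩ halfPlane N⁻¹ := ⟨x.2.1, lt_of_le_of_ne x.2.2 (Ne.symm hp)⟩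
    refine mem_interior.2 ⟨_, ?_, hopen.inter (isOpen_halfPlane N⁻¹), hx⟩
    exact fun z hz => ⟨hz.1, le_of_lt (show 0 < (N⁻¹ • z).re from hz.2)⟩
  · rintro _ ⟨s, rfl⟩
    obtain ⟨ρ, hρ, hball⟩ := Metric.isOpen_iff.1 hopen (N • expI s) (hmem s).1
    obtain ⟨r, hr, hrρ, hchart⟩ := exists_chart hΓ hD (φ s) hρ
    have hI : (N * dil s) • UpperHalfPlane.I = N • expI s := by
      rw [mul_smul, ← expI_zero, dil_smul_expI, add_zero]
    have hre : ∀ w : ℍ, (N⁻¹ • (N * dil s) • w).re = Real.exp s * w.re := fun w => by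
      rw [mul_smul, inv_smul_smul, dil_smul_re]
    obtain ⟨e, he⟩ := hchart (N * dil s)⁻¹ {w : ℍ | w ∈ Metric.ball UpperHalfPlane.I r ∧ 0 ≤ w.re}
      (by rw [inv_inv]; exact hI) fun w => by
        rw [inv_inv]
        have h1 : (N * dil s) • w ∈ {z : ℍ | 0 ≤ (N⁻¹ • z).re} ↔ 0 ≤ w.re := by
          rw [mem_ofPred_eq, hre]
          exact mul_nonneg_iff_of_pos_left (Real.exp_pos s)
        constructor
        · rintro ⟨hw, hw'⟩
          refine ⟨hw, hball ?_, h1.2 hw'⟩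
          rw [Metric.mem_ball, ← hI, dist_smul]
          exact lt_of_lt_of_le hw hrρ
        · rintro ⟨hw, -, hw'⟩
          exact ⟨hw, h1.1 hw'⟩
    refine ⟨r, hr, e, fun q => ?_⟩
    obtain ⟨hq, hq'⟩ := he q
    rw [hq', hB]
    simp only [inv_inv]
    rw [hre]
    simp
  · have : range (fun s => proj Γ E (φ s)) = (fun s => proj Γ E (φ s)) '' Icc 0 |t| := by
      refine subset_antisymm ?_ (image_subset_range _ _)
      rintro _ ⟨s, rfl⟩
      obtain ⟨k, hk, -⟩ := existsUnique_add_zsmul_mem_Ico (abs_pos.2 h.1) s 0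
      have hk' : ∃ j : ℤ, (k : ℝ) * |t| = j * t := by
        rcases abs_cases t with ⟨ht, -⟩ | ⟨ht, -⟩
        · exact ⟨k, by rw [ht]⟩
        · exact ⟨-k, by rw [ht]; push_cast; ring⟩
      obtain ⟨j, hj⟩ := hk'
      refine ⟨s + k • |t|, ⟨hk.1, by simpa using hk.2.le⟩, ?_⟩
      refine (proj_eq_iff.2 ⟨γ ^ j, ⟨j, rfl⟩, ?_⟩ : proj Γ E (φ s) = _).symm
      show γ ^ j • N • expI s = N • expI _
      rw [h.zpow_smul, dil_smul_expI, zsmul_eq_mul, hj, add_comm]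
    rw [this]
    exact isCompact_Icc.image hpφ

/-! ### Sets of vertices of the cycle -/

/-- The residue of an integer modulo `k`. -/
def res (k : ℕ) [NeZero k] (i : ℤ) : Fin k :=
  ⟨(i % k).toNat, by
    have h0 : (0 : ℤ) < k := by exact_mod_cast Nat.pos_of_neZero k
    have := Int.emod_lt_of_pos i h0
    have := Int.emod_nonneg i h0.ne'
    omega⟩

section
variable {k : ℕ} [NeZero k]

theorem coe_res (i : ℤ) : ((res k i : ℕ) : ℤ) = i % k := by
  have h0 : (0 : ℤ) < k := by exact_mod_cast Nat.pos_of_neZero k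
  exact Int.toNat_of_nonneg (Int.emod_nonneg i h0.ne')

theorem res_eq_iff {i j : ℤ} : res k i = res k j ↔ i % k = j % k := by
  rw [← coe_res, ← coe_res, Fin.ext_iff, Nat.cast_inj]

theorem res_coe (v : Fin k) : res k ((v : ℕ) : ℤ) = v := by
  rw [Fin.ext_iff, ← Nat.cast_inj (R := ℤ), coe_res]
  exact Int.emod_eq_of_lt (by positivity) (by exact_mod_cast v.2)

theorem res_add_injective (d : ℤ) : Function.Injective fun v : Fin k => res k ((v : ℕ) + d) := by
  intro v w h
  rw [← res_coe v, ← res_coe w, res_eq_iff]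
  have h1 := res_eq_iff.1 h
  have := Int.ModEq.add_right_cancel' d h1
  exact this

theorem res_add (i d : ℤ) : res k (i + d) = res k ((res k i : ℕ) + d) := by
  rw [res_eq_iff, coe_res, Int.emod_add_emod]

/-- With `Y` the shift of `X` by `-d`, the two sets are `X ∩ Y` and the complement of `X ∪ Y`, and
`|X ∪ Y| = k - |X ∩ Y|` because `|X| + |Y| = k`. -/
theorem card_pairs {X : Finset (Fin k)} (hX : X.card + X.card = k) (d : ℤ) :
    (Finset.univ.filter fun v : Fin k => v ∈ X ∧ res k ((v : ℕ) + d) ∈ X).card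
      = (Finset.univ.filter fun v : Fin k => v ∈ Xᶜ ∧ res k ((v : ℕ) + d) ∈ Xᶜ).card := by
  let e : Fin k ≃ Fin k := Equiv.ofBijective _ (Finite.injective_iff_bijective.1 (res_add_injective (k := k) d))
  set Y := X.map e.symm.toEmbedding
  have hmem : ∀ v, v ∈ Y ↔ res k ((v : ℕ) + d) ∈ X := by
    intro v
    simp only [Y, Finset.mem_map_equiv, Equiv.symm_symm]
    rfl
  have hY : Y.card = X.card := Finset.card_map _
  have h1 : (Finset.univ.filter fun v : Fin k => v ∈ X ∧ res k ((v : ℕ) + d) ∈ X) = X ∩ Y := by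
    ext v; simp [hmem]
  have h2 : (Finset.univ.filter fun v : Fin k => v ∈ Xᶜ ∧ res k ((v : ℕ) + d) ∈ Xᶜ) = (X ∪ Y)ᶜ := by
    ext v; simp [hmem]
  rw [h1, h2, Finset.card_compl, Fintype.card_fin]
  have := Finset.card_union_add_card_inter X Y
  omega

theorem exists_perm_iff {α : Type*} [Fintype α] [DecidableEq α] {p q : α → Prop} [DecidablePred p]
    [DecidablePred q] (h : (Finset.univ.filter p).card = (Finset.univ.filter q).card) :
    ∃ e : Equiv.Perm α, ∀ v, p v ↔ q (e v) := by
  rw [← Fintype.card_subtype, ← Fintype.card_subtype] at h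
  let e := Fintype.equivOfCardEq h
  refine ⟨e.extendSubtype, fun v => ⟨fun hv => e.extendSubtype_mem v hv, fun hv => ?_⟩⟩
  by_contra hn
  exact e.extendSubtype_not_mem v hn hv

/-- The permutation of the integers that acts on the residues modulo `k` by `e`. -/
def liftPerm (e : Equiv.Perm (Fin k)) : Equiv.Perm ℤ where
  toFun i := i - (res k i : ℕ) + (e (res k i) : ℕ)
  invFun i := i - (res k i : ℕ) + (e.symm (res k i) : ℕ)
  left_inv i := by
    have h : res k (i - (res k i : ℕ) + (e (res k i) : ℕ)) = e (res k i) := by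
      rw [← res_coe (e (res k i)), res_coe (e (res k i)), ← res_coe (e (res k i)), res_eq_iff]
      simp [coe_res, Int.add_emod, Int.sub_emod]
    simp [h]
  right_inv i := by
    have h : res k (i - (res k i : ℕ) + (e.symm (res k i) : ℕ)) = e.symm (res k i) := by
      rw [← res_coe (e.symm (res k i)), res_coe (e.symm (res k i)), ← res_coe (e.symm (res k i)),
        res_eq_iff]
      simp [coe_res, Int.add_emod, Int.sub_emod]
    simp [h]

theorem res_liftPerm (e : Equiv.Perm (Fin k)) (i : ℤ) : res k (liftPerm e i) = e (res k i) := by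
  have : liftPerm e i = i - (res k i : ℕ) + (e (res k i) : ℕ) := rfl
  rw [this]
  conv_rhs => rw [← res_coe (e (res k i))]
  rw [res_eq_iff]
  simp [coe_res, Int.add_emod, Int.sub_emod]

theorem liftPerm_add (e : Equiv.Perm (Fin k)) (i j : ℤ) :
    liftPerm e (i + k * j) = liftPerm e i + k * j := by
  have h : res k (i + k * j) = res k i := by rw [res_eq_iff]; simp
  show i + k * j - (res k (i + k * j) : ℕ) + (e (res k (i + k * j)) : ℕ)
    = i - (res k i : ℕ) + (e (res k i) : ℕ) + k * j
  rw [h]; ring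

end

section
variable {n : ℕ} [NeZero (2 * n)]

theorem mem_cycleLift {X : Finset (Fin (2 * n))} {i : ℤ} : i ∈ cycleLift X ↔ res (2 * n) i ∈ X := by
  constructor
  · rintro ⟨v, hv, h⟩
    rwa [← res_coe v, res_eq_iff.2 (by rw [h]; simp : _ = i % ((2 * n : ℕ) : ℤ))] at hv
  · intro h
    exact ⟨_, h, coe_res i⟩

/-- A permutation of the residues that matches the two sets of `card_pairs`, lifted to `ℤ`. Its
periodicity will make the bijection of ortho geodesics descend to the quotients. -/
theorem exists_perm_cycleLift {X : Finset (Fin (2 * n))} (hX : X.card = n) (d : ℤ) :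
    ∃ ψ : Equiv.Perm ℤ, (∀ i j : ℤ, ψ (i + (2 * n : ℕ) * j) = ψ i + (2 * n : ℕ) * j) ∧
      ∀ i, (i ∈ cycleLift X ∧ i + d ∈ cycleLift X) ↔
        (ψ i ∈ cycleLift Xᶜ ∧ ψ i + d ∈ cycleLift Xᶜ) := by
  obtain ⟨e, he⟩ := exists_perm_iff (card_pairs (X := X) (by omega) d)
  refine ⟨liftPerm e, liftPerm_add e, fun i => ?_⟩
  simp only [mem_cycleLift]
  rw [res_add, he, res_add (liftPerm e i), res_liftPerm]

end

theorem cycleLift_add {n : ℕ} (X : Finset (Fin (2 * n))) {i m : ℤ} (h : ((2 * n : ℕ) : ℤ) ∣ m) :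
    i + m ∈ cycleLift X ↔ i ∈ cycleLift X := by
  obtain ⟨j, rfl⟩ := h
  simp [cycleLift]

/-! ### Ortho geodesics -/

theorem hasDerivAt_smul {c : ℝ → ℍ} {t : ℝ} {c' : ℂ} (h : HasDerivAt (fun v => (c v : ℂ)) c' t)
    (M : SL(2, ℝ)) : HasDerivAt (fun v => ((M • c v : ℍ) : ℂ))
      (c' / ((M 1 0 : ℂ) * c t + M 1 1) ^ 2) t := by
  have hden : (M 1 0 : ℂ) * c t + M 1 1 ≠ 0 := by
    intro h0
    have h1 := congrArg Complex.re h0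
    have h2 := congrArg Complex.im h0
    simp at h1 h2
    have := denom_sq_pos M (c t)
    rw [h1] at this
    rcases h2 with h2 | h2
    · simp [h2] at this
    · exact absurd h2 (c t).im_pos.ne'
  have hd : (M 0 0 : ℂ) * M 1 1 - M 0 1 * M 1 0 = 1 := by exact_mod_cast det_entries M
  have h1 := ((h.const_mul (M 0 0 : ℂ)).add_const (M 0 1 : ℂ)).div
    ((h.const_mul (M 1 0 : ℂ)).add_const (M 1 1 : ℂ)) hden
  have e : (fun v => ((M • c v : ℍ) : ℂ)) = fun v => ((M 0 0 : ℂ) * c v + M 0 1)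
    / ((M 1 0 : ℂ) * c v + M 1 1) := funext fun v => coe_smul_eq M (c v)
  rw [e]
  have e2 : c' = (M 0 0 : ℂ) * c' * ((M 1 0 : ℂ) * c t + M 1 1)
      - ((M 0 0 : ℂ) * c t + M 0 1) * ((M 1 0 : ℂ) * c') := by linear_combination -c' * hd
  rw [← e2] at h1
  exact h1

theorem IsGeodesicCurve.hasDerivAt {c : ℝ → ℍ} (hc : IsGeodesicCurve c) (t : ℝ) :
    HasDerivAt (fun v => (c v : ℂ)) (deriv (fun v => (c v : ℂ)) t) t := by
  obtain ⟨N, hN⟩ := hc.exists_eq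
  obtain rfl : c = fun t => N • expI t := funext hN
  have h1 : HasDerivAt (fun v => (expI v : ℂ)) ((Real.exp t : ℂ) * Complex.I) t := by
    have : (fun v => (expI v : ℂ)) = fun v => ((Real.exp v : ℝ) : ℂ) * Complex.I := by
      funext v
      exact (Complex.mk_eq_add_mul_I _ _).trans (by simp)
    rw [this]
    exact ((Real.hasDerivAt_exp t).ofReal_comp).mul_const _
  exact (hasDerivAt_smul h1 N).differentiableAt.hasDerivAt

theorem inner_div_eq_zero {u v : ℂ} (h : inner ℝ u v = 0) (w : ℂ) : inner ℝ (u / w) (v / w) = 0 := by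
  rw [div_eq_inv_mul, div_eq_inv_mul]
  rw [Complex.inner] at h ⊢
  have : w⁻¹ * v * (starRingEnd ℂ) (w⁻¹ * u)
      = ((Complex.normSq w⁻¹ : ℝ) : ℂ) * (v * (starRingEnd ℂ) u) := by
    rw [Complex.normSq_eq_conj_mul_self, map_mul]
    ring
  rw [this, Complex.re_ofReal_mul, h, mul_zero]

theorem IsGeodesicCurve.smul {c : ℝ → ℍ} (hc : IsGeodesicCurve c) (M : SL(2, ℝ)) :
    IsGeodesicCurve fun t => M • c t := (isometry_smul ℍ M).comp hc

/-- Conformality: both velocities are divided by the same complex number, the square of the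
denominator of `M`. -/
theorem OrthogonalAt.smul {c : ℝ → ℍ} (hc : IsGeodesicCurve c) {t : ℝ} {s : Set ℍ}
    (h : OrthogonalAt c t s) (M : SL(2, ℝ)) : OrthogonalAt (fun v => M • c v) t (M • s) := by
  obtain ⟨e, he, rfl, u, hu, h0⟩ := h
  refine ⟨fun v => M • e v, he.smul M, by rw [range_comp' (fun z => M • z) e]; rfl, u, by simp [hu], ?_⟩
  rw [(hasDerivAt_smul (hc.hasDerivAt t) M).deriv, (hasDerivAt_smul (he.hasDerivAt u) M).deriv, hu]
  exact inner_div_eq_zero h0 _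

theorem OrthogonalAt.mem {c : ℝ → ℍ} {t : ℝ} {s : Set ℍ} (h : OrthogonalAt c t s) : c t ∈ s := by
  obtain ⟨e, he, rfl, u, hu, -⟩ := h
  exact ⟨u, hu⟩

theorem smul_mem_orthoGeodesics {𝒢 𝒢' : Set (Set ℍ)} {l : ℝ} {σ : Set ℍ} (M : SL(2, ℝ))
    (h𝒢 : ∀ s ∈ 𝒢, M • s ∈ 𝒢') (h : σ ∈ orthoGeodesics 𝒢 l) : M • σ ∈ orthoGeodesics 𝒢' l := by
  obtain ⟨hl, c, hc, rfl, a, ha, b, hb, h1, h2⟩ := h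
  refine ⟨hl, fun t => M • c t, hc.smul M, ?_, M • a, h𝒢 a ha, M • b, h𝒢 b hb, h1.smul hc M,
    h2.smul hc M⟩
  exact image_image (fun z => M • z) c _

theorem IsGeodesicCurve.reverse {c : ℝ → ℍ} (hc : IsGeodesicCurve c) (l : ℝ) :
    IsGeodesicCurve fun t => c (l - t) := by
  refine Isometry.of_dist_eq fun x y => ?_
  rw [hc.dist_eq, Real.dist_eq, Real.dist_eq, abs_sub_comm]
  congr 1; ring

theorem image_reverse (c : ℝ → ℍ) (l : ℝ) : (fun t => c (l - t)) '' Icc 0 l = c '' Icc 0 l := by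
  rw [← image_image c (fun t => l - t)]
  simp

/-- The ends are the only two points of the segment at distance `l`, so the set determines them up
to order. This makes `endIndices` independent of the parametrisation. -/
theorem IsGeodesicCurve.start_eq {c c' : ℝ → ℍ} (hc : IsGeodesicCurve c) (hc' : IsGeodesicCurve c')
    {l : ℝ} (hl : 0 < l) (h : c '' Icc 0 l = c' '' Icc 0 l) : c' 0 = c 0 ∨ c' 0 = c l := by
  obtain ⟨s, hs, hs'⟩ : c' 0 ∈ c '' Icc 0 l := by rw [h]; exact ⟨0, ⟨le_rfl, hl.le⟩, rfl⟩
  obtain ⟨t, ht, ht'⟩ : c' l ∈ c '' Icc 0 l := by rw [h]; exact ⟨l, ⟨hl.le, le_rfl⟩, rfl⟩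
  have hd : |s - t| = l := by
    rw [← Real.dist_eq, ← hc.dist_eq, hs', ht', hc'.dist_eq, Real.dist_eq, zero_sub, abs_neg,
      abs_of_pos hl]
  rcases abs_cases (s - t) with ⟨h1, -⟩ | ⟨h1, -⟩
  · have : s = l := by linarith [hs.2, ht.1]
    right; rw [← hs', this]
  · have : s = 0 := by linarith [hs.1, ht.2]
    left; rw [← hs', this]

/-- The indices of the translates of the complement of `U` in which the segment `σ` of length `l`
ends. -/
def endIndices (γ : SL(2, ℝ)) (U : Set ℍ) (l : ℝ) (σ : Set ℍ) : Set ℤ :=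
  {i | ∃ c, IsGeodesicCurve c ∧ σ = c '' Icc 0 l ∧ c 0 ∈ (γ ^ i • U)ᶜ}

section
variable {γ : SL(2, ℝ)} {U : Set ℍ} {𝒢₀ 𝓔 : Set (Set ℍ)} {A : Set ℤ} {l : ℝ} {σ : Set ℍ}

theorem mem_endIndices_iff {c : ℝ → ℍ} (hc : IsGeodesicCurve c) (hl : 0 < l) {i : ℤ} :
    i ∈ endIndices γ U l (c '' Icc 0 l) ↔ c 0 ∈ (γ ^ i • U)ᶜ ∨ c l ∈ (γ ^ i • U)ᶜ := by
  constructor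
  · rintro ⟨c', hc', h, hi⟩
    rcases hc.start_eq hc' hl h with h1 | h1
    · left; rwa [← h1]
    · right; rwa [← h1]
  · rintro (h | h)
    · exact ⟨c, hc, rfl, h⟩
    · exact ⟨fun t => c (l - t), hc.reverse l, (image_reverse c l).symm, by simpa using h⟩

theorem endIndices_smul (k : ℤ) : endIndices γ U l (γ ^ k • σ) = (fun i => i + k) '' endIndices γ U l σ := by
  have key : ∀ (k i : ℤ) (σ : Set ℍ), i ∈ endIndices γ U l σ → i + k ∈ endIndices γ U l (γ ^ k • σ) := by
    rintro k i _ ⟨c, hc, rfl, hi⟩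
    refine ⟨fun t => γ ^ k • c t, hc.smul _, ?_, ?_⟩
    · exact image_image (fun z => γ ^ k • z) c _
    · rw [mem_compl_iff, mem_smul_set_iff_inv_smul_mem] at hi ⊢
      rw [smul_smul, ← zpow_neg, ← zpow_add]
      rw [← zpow_neg] at hi
      convert hi using 4
      ring
  ext i
  constructor
  · intro h
    have := key (-k) i _ h
    rw [smul_smul, ← zpow_add, neg_add_cancel, zpow_zero, one_smul] at this
    exact ⟨_, this, by ring⟩
  · rintro ⟨j, hj, rfl⟩
    exact key k j σ hj

/-- The translates of `𝒢₀` with indices in `A`, together with the geodesics of `𝓔`. -/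
def bdry (γ : SL(2, ℝ)) (𝒢₀ 𝓔 : Set (Set ℍ)) (A : Set ℤ) : Set (Set ℍ) := translates γ 𝒢₀ A ∪ 𝓔

theorem IsCore.exists_endIndices_eq (h : IsCore γ U 𝒢₀)
    (h𝓔 : ∀ s ∈ 𝓔, ∀ i : ℤ, s ⊆ γ ^ i • U) (hσ : σ ∈ orthoGeodesics (bdry γ 𝒢₀ 𝓔 A) l) :
    ∃ P Q : Set ℤ, endIndices γ U l σ = P ∪ Q ∧ P.Subsingleton ∧ Q.Subsingleton ∧ P ⊆ A ∧ Q ⊆ A := by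
  obtain ⟨hl, c, hc, rfl, a, ha, b, hb, h1, h2⟩ := hσ
  have key : ∀ x : ℍ, {i : ℤ | x ∈ (γ ^ i • U)ᶜ}.Subsingleton := by
    intro x i hi j hj
    by_contra hij
    exact disjoint_left.1 (h.disjoint i j hij) hi hj
  have key2 : ∀ s ∈ bdry γ 𝒢₀ 𝓔 A, ∀ x ∈ s, {i : ℤ | x ∈ (γ ^ i • U)ᶜ} ⊆ A := by
    rintro s (⟨j, hj, a, ha, rfl⟩ | hs) x hx i hi
    · have hxj : x ∈ (γ ^ j • U)ᶜ := by
        rw [← smul_set_compl]; exact smul_set_mono (h.subset_compl a ha) hx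
      rwa [key x hi hxj]
    · exact absurd (h𝓔 s hs i hx) hi
  refine ⟨{i | c 0 ∈ (γ ^ i • U)ᶜ}, {i | c l ∈ (γ ^ i • U)ᶜ}, ?_, key _, key _,
    key2 a ha _ h1.mem, key2 b hb _ h2.mem⟩
  ext i
  exact mem_endIndices_iff hc hl

/-- The complements of the translates of `U` are disjoint, so the position of an end fixes the index
of any translate of `𝒢₀` through it. -/
theorem IsCore.mem_orthoGeodesics_iff (h : IsCore γ U 𝒢₀)
    (h𝓔 : ∀ s ∈ 𝓔, ∀ i : ℤ, s ⊆ γ ^ i • U) : σ ∈ orthoGeodesics (bdry γ 𝒢₀ 𝓔 A) l ↔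
      σ ∈ orthoGeodesics (bdry γ 𝒢₀ 𝓔 univ) l ∧ endIndices γ U l σ ⊆ A := by
  constructor
  · intro hσ
    obtain ⟨P, Q, hPQ, -, -, hP, hQ⟩ := h.exists_endIndices_eq h𝓔 hσ
    refine ⟨?_, hPQ ▸ union_subset hP hQ⟩
    obtain ⟨hl, c, hc, rfl, a, ha, b, hb, h1, h2⟩ := hσ
    have hmono : bdry γ 𝒢₀ 𝓔 A ⊆ bdry γ 𝒢₀ 𝓔 univ := by
      refine union_subset_union_left _ ?_
      rintro _ ⟨i, -, a, ha, rfl⟩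
      exact ⟨i, mem_univ i, a, ha, rfl⟩
    exact ⟨hl, c, hc, rfl, a, hmono ha, b, hmono hb, h1, h2⟩
  · rintro ⟨⟨hl, c, hc, rfl, a, ha, b, hb, h1, h2⟩, hsub⟩
    have key : ∀ s ∈ bdry γ 𝒢₀ 𝓔 univ, ∀ x ∈ s, x = c 0 ∨ x = c l → s ∈ bdry γ 𝒢₀ 𝓔 A := by
      rintro s (⟨j, hj, a, ha, rfl⟩ | hs) x hx hxc
      · left
        refine ⟨j, hsub ((mem_endIndices_iff hc hl).2 ?_), a, ha, rfl⟩
        have hxj : x ∈ (γ ^ j • U)ᶜ := by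
          rw [← smul_set_compl]; exact smul_set_mono (h.subset_compl a ha) hx
        rcases hxc with rfl | rfl
        · exact Or.inl hxj
        · exact Or.inr hxj
      · exact Or.inr hs
    exact ⟨hl, c, hc, rfl, a, key a ha _ h1.mem (Or.inl rfl), b, key b hb _ h2.mem (Or.inr rfl),
      h1, h2⟩

/-- The case `d = 0` covers a single index: one end on the axis, or both ends in the same translate
of the complement of `U`. -/
theorem exists_eq_pair {P Q : Set ℤ} (hP : P.Subsingleton) (hQ : Q.Subsingleton) :
    P ∪ Q = ∅ ∨ ∃ i d : ℤ, 0 ≤ d ∧ P ∪ Q = {i, i + d} := by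
  have hpair : ∀ a b : ℤ, ∃ i d : ℤ, 0 ≤ d ∧ ({a} ∪ {b} : Set ℤ) = {i, i + d} := by
    intro a b
    rcases le_total a b with h | h
    · exact ⟨a, b - a, by omega, by rw [add_sub_cancel]; rfl⟩
    · exact ⟨b, a - b, by omega, by rw [add_sub_cancel, pair_comm]; rfl⟩
  rcases hP.eq_empty_or_singleton with rfl | ⟨a, rfl⟩ <;>
    rcases hQ.eq_empty_or_singleton with rfl | ⟨b, rfl⟩
  · left; simp
  · right; simpa using hpair b b
  · right; simpa using hpair a a
  · exact Or.inr (hpair a b)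

theorem pair_unique {i d i' d' : ℤ} (hd : 0 ≤ d) (hd' : 0 ≤ d')
    (h : ({i, i + d} : Set ℤ) = {i', i' + d'}) : i = i' ∧ d = d' := by
  have h1 : i ∈ ({i', i' + d'} : Set ℤ) := h ▸ mem_insert _ _
  have h2 : i + d ∈ ({i', i' + d'} : Set ℤ) := h ▸ mem_insert_of_mem _ rfl
  have h3 : i' ∈ ({i, i + d} : Set ℤ) := h.symm ▸ mem_insert _ _
  have h4 : i' + d' ∈ ({i, i + d} : Set ℤ) := h.symm ▸ mem_insert_of_mem _ rfl
  simp only [mem_insert_iff, mem_singleton_iff] at h1 h2 h3 h4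
  omega

end

/-- Counts orbits, with `R` the orbit map: representatives of the classes in `S` are pushed forward
by `Φ` to representatives of the classes in `S'`. -/
theorem encard_image_eq_of_bijOn {α β : Type*} {R : α → β} {S S' : Set α} {Φ : α → α}
    (hΦ : BijOn Φ S S') (h : ∀ σ ∈ S, ∀ τ ∈ S, R σ = R τ ↔ R (Φ σ) = R (Φ τ)) :
    (R '' S).encard = (R '' S').encard := by
  obtain ⟨S₀, hS₀, hb⟩ := exists_subset_bijOn S R
  have h1 : R '' S' = (fun σ => R (Φ σ)) '' S₀ := by
    rw [← hΦ.image_eq, ← image_comp]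
    refine subset_antisymm ?_ (image_mono hS₀)
    rintro _ ⟨σ, hσ, rfl⟩
    obtain ⟨τ, hτ, hτσ⟩ := hb.surjOn ⟨σ, hσ, rfl⟩
    exact ⟨τ, hτ, (h _ (hS₀ hτ) _ hσ).1 hτσ⟩
  have h2 : InjOn (fun σ => R (Φ σ)) S₀ := fun σ hσ τ hτ he =>
    hb.injOn hσ hτ ((h _ (hS₀ hσ) _ (hS₀ hτ)).2 he)
  rw [h1, h2.encard_image, ← hb.image_eq, hb.injOn.encard_image]

section
variable {γ : SL(2, ℝ)} {U : Set ℍ} {𝒢₀ 𝓔 : Set (Set ℍ)} {n : ℕ} {X : Finset (Fin (2 * n))}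

open Classical in
/-- The ortho geodesic `σ` is moved by a power of `γ` that depends only on the indices of the
translates of the complement of `U` in which it ends. -/
def shiftOrtho (γ : SL(2, ℝ)) (U : Set ℍ) (ψ : ℤ → Equiv.Perm ℤ) (l : ℝ) (σ : Set ℍ) : Set ℍ :=
  if h : ∃ x : ℤ × ℤ, 0 ≤ x.2 ∧ endIndices γ U l σ = {x.1, x.1 + x.2} then
    γ ^ (ψ h.choose.2 h.choose.1 - h.choose.1) • σ else σ

theorem shiftOrtho_eq {ψ : ℤ → Equiv.Perm ℤ} {l : ℝ} {σ : Set ℍ} {i d : ℤ} (hd : 0 ≤ d)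
    (h : endIndices γ U l σ = {i, i + d}) :
    shiftOrtho γ U ψ l σ = γ ^ (ψ d i - i) • σ := by
  have hex : ∃ x : ℤ × ℤ, 0 ≤ x.2 ∧ endIndices γ U l σ = {x.1, x.1 + x.2} := ⟨(i, d), hd, h⟩
  rw [shiftOrtho, dif_pos hex]
  obtain ⟨h1, h2⟩ := pair_unique hex.choose_spec.1 hd (hex.choose_spec.2.symm.trans h)
  rw [h1, h2]

theorem shiftOrtho_eq_self {ψ : ℤ → Equiv.Perm ℤ} {l : ℝ} {σ : Set ℍ}
    (h : endIndices γ U l σ = ∅) : shiftOrtho γ U ψ l σ = σ := by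
  rw [shiftOrtho, dif_neg]
  rintro ⟨x, -, hx⟩
  rw [h] at hx
  exact notMem_empty x.1 (hx ▸ mem_insert _ _)

theorem endIndices_smul_pair {l : ℝ} {σ : Set ℍ} {i d : ℤ} (h : endIndices γ U l σ = {i, i + d})
    (k : ℤ) : endIndices γ U l (γ ^ k • σ) = {i + k, i + k + d} := by
  rw [endIndices_smul, h, image_pair, add_right_comm]

theorem IsCore.sameOrthoSpectrum (h : IsCore γ U 𝒢₀) (h𝓔 : ∀ s ∈ 𝓔, ∀ i : ℤ, s ⊆ γ ^ i • U)
    (h𝓔γ : ∀ s ∈ 𝓔, ∀ i : ℤ, γ ^ i • s ∈ 𝓔) (hn : 0 < n) (hX : X.card = n) {m : ℕ} (hm : 2 * n ∣ m)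
    {D D' : Set ℍ} (hD : boundaryGeodesics D = bdry γ 𝒢₀ 𝓔 (cycleLift X))
    (hD' : boundaryGeodesics D' = bdry γ 𝒢₀ 𝓔 (cycleLift Xᶜ)) : SameOrthoSpectrum γ m D D' := by
  have : NeZero (2 * n) := ⟨by omega⟩
  choose ψ hψ hψX using fun d => exists_perm_cycleLift hX d
  have hO : ∀ (k : ℤ) (l : ℝ) (σ : Set ℍ), σ ∈ orthoGeodesics (bdry γ 𝒢₀ 𝓔 univ) l →
      γ ^ k • σ ∈ orthoGeodesics (bdry γ 𝒢₀ 𝓔 univ) l := by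
    intro k l σ
    refine smul_mem_orthoGeodesics (γ ^ k) ?_
    rintro s (⟨i, -, a, ha, rfl⟩ | hs)
    · exact Or.inl ⟨k + i, mem_univ _, a, ha, by rw [smul_smul, zpow_add]⟩
    · exact Or.inr (h𝓔γ s hs k)
  have hcases : ∀ (l : ℝ) (σ : Set ℍ), σ ∈ orthoGeodesics (bdry γ 𝒢₀ 𝓔 univ) l →
      endIndices γ U l σ = ∅ ∨ ∃ i d : ℤ, 0 ≤ d ∧ endIndices γ U l σ = {i, i + d} := by
    intro l σ hσ
    obtain ⟨P, Q, hPQ, hP, hQ, -⟩ := h.exists_endIndices_eq h𝓔 hσ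
    rw [hPQ]
    exact exists_eq_pair hP hQ
  -- The moved segment has indices `ψ d i` and `ψ d i + d`. They determine `d`, then `i`, and so the
  -- power of `γ` to be undone.
  have hinj : ∀ l, InjOn (shiftOrtho γ U ψ l) (orthoGeodesics (bdry γ 𝒢₀ 𝓔 univ) l) := by
    intro l σ hσ τ hτ heq
    rcases hcases l σ hσ with h1 | ⟨i, d, hd, h1⟩ <;> rcases hcases l τ hτ with h2 | ⟨j, e, he, h2⟩
    · rwa [shiftOrtho_eq_self h1, shiftOrtho_eq_self h2] at heq
    · rw [shiftOrtho_eq_self h1, shiftOrtho_eq he h2] at heq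
      rw [heq, endIndices_smul_pair h2] at h1
      exact absurd (h1 ▸ mem_insert _ _) (notMem_empty (j + (ψ e j - j)))
    · rw [shiftOrtho_eq_self h2, shiftOrtho_eq hd h1] at heq
      rw [← heq, endIndices_smul_pair h1] at h2
      exact absurd (h2 ▸ mem_insert _ _) (notMem_empty (i + (ψ d i - i)))
    · rw [shiftOrtho_eq hd h1, shiftOrtho_eq he h2] at heq
      have h3 := endIndices_smul_pair h1 (ψ d i - i)
      rw [heq, endIndices_smul_pair h2] at h3
      obtain ⟨h4, rfl⟩ := pair_unique he hd h3
      have h5 : i = j := (ψ e).injective (by omega)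
      rw [h5] at heq
      exact smul_left_cancel _ heq
  have hbij : ∀ l, BijOn (shiftOrtho γ U ψ l) (orthoGeodesics (bdry γ 𝒢₀ 𝓔 (cycleLift X)) l)
      (orthoGeodesics (bdry γ 𝒢₀ 𝓔 (cycleLift Xᶜ)) l) := by
    intro l
    refine ⟨fun σ hσ => ?_, (hinj l).mono fun σ hσ => ((h.mem_orthoGeodesics_iff h𝓔).1 hσ).1,
      fun τ hτ => ?_⟩
    · rw [h.mem_orthoGeodesics_iff h𝓔] at hσ ⊢
      rcases hcases l σ hσ.1 with h1 | ⟨i, d, hd, h1⟩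
      · rw [shiftOrtho_eq_self h1]
        exact ⟨hσ.1, by rw [h1]; exact empty_subset _⟩
      · rw [shiftOrtho_eq hd h1, endIndices_smul_pair h1]
        refine ⟨hO _ l σ hσ.1, ?_⟩
        rw [h1, insert_subset_iff, singleton_subset_iff] at hσ
        rw [insert_subset_iff, singleton_subset_iff, add_sub_cancel]
        exact (hψX d i).1 hσ.2
    · rw [h.mem_orthoGeodesics_iff h𝓔] at hτ
      rcases hcases l τ hτ.1 with h1 | ⟨j, d, hd, h1⟩
      · exact ⟨τ, (h.mem_orthoGeodesics_iff h𝓔).2 ⟨hτ.1, by rw [h1]; exact empty_subset _⟩,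
          shiftOrtho_eq_self h1⟩
      · set i := (ψ d).symm j with hi
        have hij : ψ d i = j := (ψ d).apply_symm_apply j
        have h2 := endIndices_smul_pair h1 (i - j)
        rw [add_sub_cancel] at h2
        refine ⟨γ ^ (i - j) • τ, (h.mem_orthoGeodesics_iff h𝓔).2 ⟨hO _ l τ hτ.1, ?_⟩, ?_⟩
        · rw [h1, insert_subset_iff, singleton_subset_iff] at hτ
          rw [h2, insert_subset_iff, singleton_subset_iff, hψX d i, hij]
          exact hτ.2
        · rw [shiftOrtho_eq hd h2, hij, smul_smul, ← zpow_add, show j - i + (i - j) = 0 by ring,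
            zpow_zero, one_smul]
  -- `m` is a multiple of `2n`, and `ψ d` commutes with translations by such multiples, so the shift
  -- `ψ d i - i` is the same for both segments.
  have hequiv : ∀ (l : ℝ) (k : ℤ) (σ : Set ℍ), σ ∈ orthoGeodesics (bdry γ 𝒢₀ 𝓔 univ) l →
      shiftOrtho γ U ψ l ((γ ^ m) ^ k • σ) = (γ ^ m) ^ k • shiftOrtho γ U ψ l σ := by
    intro l k σ hσ
    obtain ⟨q, rfl⟩ := hm
    have e : (γ ^ (2 * n * q)) ^ k = γ ^ (((2 * n : ℕ) : ℤ) * (q * k)) := by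
      rw [← mul_assoc, zpow_mul]
      congr 1
      rw [← zpow_natCast]
      push_cast
      rfl
    rw [e]
    rcases hcases l σ hσ with h1 | ⟨i, d, hd, h1⟩
    · have h2 : endIndices γ U l (γ ^ (((2 * n : ℕ) : ℤ) * (q * k)) • σ) = ∅ := by
        rw [endIndices_smul, h1, image_empty]
      rw [shiftOrtho_eq_self h1, shiftOrtho_eq_self h2]
    · rw [shiftOrtho_eq hd h1, shiftOrtho_eq hd (endIndices_smul_pair h1 _), hψ, smul_smul,
        smul_smul, ← zpow_add, ← zpow_add]
      congr 2
      ring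
  refine ⟨funext fun l => ?_, funext fun l => ?_⟩
  · simp only [surfaceOrthoSpectrum, hD, hD']
    have himg : ∀ S : Set (Set ℍ), {o : Set (Set ℍ) | ∃ σ ∈ S,
        o = MulAction.orbit (Subgroup.zpowers (γ ^ m)) σ}
        = (fun σ => MulAction.orbit (Subgroup.zpowers (γ ^ m)) σ) '' S := by
      intro S
      ext o
      exact exists_congr fun σ => and_congr_right fun _ => eq_comm
    rw [himg, himg]
    refine encard_image_eq_of_bijOn (hbij l) fun σ hσ τ hτ => ?_
    have hσ' := ((h.mem_orthoGeodesics_iff h𝓔).1 hσ).1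
    have hτ' := ((h.mem_orthoGeodesics_iff h𝓔).1 hτ).1
    simp only [MulAction.orbit_eq_iff]
    constructor
    · rintro ⟨⟨_, k, rfl⟩, hk⟩
      exact ⟨⟨_, k, rfl⟩, by rw [← hk]; exact (hequiv l k τ hτ').symm⟩
    · rintro ⟨⟨_, k, rfl⟩, hk⟩
      refine ⟨⟨_, k, rfl⟩, ?_⟩
      have hmem : (γ ^ m) ^ k • τ ∈ orthoGeodesics (bdry γ 𝒢₀ 𝓔 univ) l := by
        have := hO (m * k) l τ hτ'
        rwa [zpow_mul, zpow_natCast] at this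
      exact hinj l hmem hσ' ((hequiv l k τ hτ').trans hk)
  · simp only [orthoSpectrum, hD, hD']
    rw [← (hbij l).image_eq, (hbij l).injOn.encard_image]

end

/-! ### Developing locally isometric maps -/

theorem exists_ne_of_isOpen {O : Set ℍ} (hO : IsOpen O) (hne : O.Nonempty) :
    ∃ p ∈ O, ∃ q ∈ O, p ≠ q := by
  obtain ⟨z, hz⟩ := hne
  have h1 : ∀ᶠ t in 𝓝[≠] (0 : ℝ), (t +ᵥ z : ℍ) ∈ O :=
    ((tendsto_vadd_zero z).eventually (hO.mem_nhds hz)).filter_mono nhdsWithin_le_nhds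
  obtain ⟨t, ht, ht0⟩ := (h1.and (self_mem_nhdsWithin : {(0 : ℝ)}ᶜ ∈ 𝓝[≠] (0 : ℝ))).exists
  refine ⟨z, hz, _, ht, fun h => ht0 ?_⟩
  have := congrArg UpperHalfPlane.re h
  simpa using this

section
variable {Γ : Subgroup SL(2, ℝ)} {D D' : Set ℍ}

/-- Two isometries that agree up to `Γ` on an open set agree up to one element of `Γ`. -/
theorem IsDiscontinuous.exists_smul_eq (hΓ : IsDiscontinuous Γ) {F G : ℍ ≃ᵢ ℍ} {O : Set ℍ}
    (hO : IsOpen O) (hne : O.Nonempty) (h : ∀ y ∈ O, ∃ δ ∈ Γ, F y = δ • G y) :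
    ∃ δ ∈ Γ, ∀ z, F z = δ • G z := by
  obtain ⟨y₀, hy₀⟩ := hne
  obtain ⟨δ₀, hδ₀, h0⟩ := h y₀ hy₀
  obtain ⟨ε, hε, hd⟩ := hΓ (F y₀)
  -- Near `y₀` the element of `Γ` acts as `δ₀` does: otherwise `δ * δ₀⁻¹` would move `F y₀` by less
  -- than `ε`.
  have key : EqOn F (G.trans (IsometryEquiv.constSMul δ₀)) (O ∩ Metric.ball y₀ (ε / 4)) := by
    rintro y ⟨hy, hball⟩
    obtain ⟨δ, hδ, h1⟩ := h y hy
    show F y = δ₀ • G y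
    have h2 : F y = (δ * δ₀⁻¹) • δ₀ • G y := by rw [h1, smul_smul, inv_mul_cancel_right]
    rcases hd _ (Γ.mul_mem hδ (Γ.inv_mem hδ₀)) with h3 | h3
    · rw [h2, h3]
    · exfalso
      have h4 : dist (F y) ((δ * δ₀⁻¹) • F y₀) = dist y y₀ := by
        rw [h2, dist_smul, h0, dist_smul, G.dist_eq]
      have h5 := dist_triangle (F y₀) (F y) ((δ * δ₀⁻¹) • F y₀)
      rw [h4, F.dist_eq, dist_comm y₀] at h5
      rw [Metric.mem_ball] at hball
      linarith
  have := isometryEquiv_eq_of_eqOn_open (hO.inter Metric.isOpen_ball)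
    ⟨y₀, hy₀, Metric.mem_ball_self (by linarith)⟩ key
  exact ⟨δ₀, hδ₀, fun z => by rw [this]; rfl⟩

/-- A map of metric spaces that preserves the distances of nearby points. -/
def IsLocallyIsometric {Y S : Type} [PseudoMetricSpace Y] [PseudoMetricSpace S] (ψ : Y → S) : Prop :=
  ∀ x, ∃ U ∈ 𝓝 x, ∀ a ∈ U, ∀ b ∈ U, dist (ψ a) (ψ b) = dist a b

/-- The isometry `F` maps `x` to a representative of `ψ x`. -/
def Develops (ψ : D → QuotientSurface Γ D') (F : ℍ ≃ᵢ ℍ) (x : D) : Prop :=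
  ∃ h : F x ∈ D', ψ x = proj Γ D' ⟨F x, h⟩

theorem exists_isOpen_of_mem_nhds (hcl : D ⊆ closure (interior D)) {x : D} {V : Set D}
    (hV : V ∈ 𝓝 x) : ∃ O : Set ℍ, IsOpen O ∧ O.Nonempty ∧ ∀ y ∈ O, ∃ h : y ∈ D, (⟨y, h⟩ : D) ∈ V := by
  obtain ⟨u, hu, huV⟩ := mem_nhds_subtype _ _ _ |>.1 hV
  obtain ⟨w, hwu, hw, hxw⟩ := mem_nhds_iff.1 hu
  refine ⟨w ∩ interior D, hw.inter isOpen_interior, mem_closure_iff.1 (hcl x.2) w hw hxw, ?_⟩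
  exact fun y hy => ⟨interior_subset hy.2, huV (hwu hy.1)⟩

/-- Representatives of `ψ y` chosen near `w` turn `ψ` into a distance-preserving map of a
neighbourhood in `D`. It extends to `ℍ` because this neighbourhood contains two points, even if `x`
is on the boundary. -/
theorem exists_develops (hΓ : IsDiscontinuous Γ) (hD' : IsInvariant Γ D')
    (hcl : D ⊆ closure (interior D)) {ψ : D → QuotientSurface Γ D'} (hψ : IsLocallyIsometric ψ)
    (x : D) : ∃ F : ℍ ≃ᵢ ℍ, ∀ᶠ y in 𝓝 x, Develops ψ F y := by
  obtain ⟨w, hw⟩ := proj_surjective (ψ x)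
  obtain ⟨ε, hε, hd⟩ := hΓ w
  obtain ⟨U, hU, hUψ⟩ := hψ x
  have hV : U ∩ Metric.ball x (ε / 4) ∈ 𝓝 x :=
    Filter.inter_mem hU (Metric.ball_mem_nhds x (by linarith))
  have hrep : ∀ y : ℍ, ∃ y' : ℍ, ∀ h : y ∈ D, (⟨y, h⟩ : D) ∈ U ∩ Metric.ball x (ε / 4) →
      dist (w : ℍ) y' < ε / 4 ∧ ∃ h' : y' ∈ D', ψ ⟨y, h⟩ = proj Γ D' ⟨y', h'⟩ := by
    intro y
    by_cases hy : ∃ h : y ∈ D, (⟨y, h⟩ : D) ∈ U ∩ Metric.ball x (ε / 4)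
    · obtain ⟨h, hy⟩ := hy
      have h1 : dist (ψ x) (ψ ⟨y, h⟩) < ε / 4 := by
        rw [hUψ x (mem_of_mem_nhds hU) _ hy.1, dist_comm]
        exact hy.2
      obtain ⟨v, hv⟩ := proj_surjective (ψ ⟨y, h⟩)
      rw [← hw, ← hv, dist_proj] at h1
      obtain ⟨δ, hδ, h2⟩ := exists_dist_lt_of_orbitDist_lt h1
      refine ⟨δ • (v : ℍ), fun _ _ => ⟨h2, hD' δ hδ v v.2, ?_⟩⟩
      rw [← hv]
      exact proj_eq_iff.2 ⟨δ, hδ, rfl⟩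
    · exact ⟨y, fun h h' => absurd ⟨h, h'⟩ hy⟩
  choose χ hχ using hrep
  let A : Set ℍ := {y | ∃ h : y ∈ D, (⟨y, h⟩ : D) ∈ U ∩ Metric.ball x (ε / 4)}
  have hiso : ∀ y ∈ A, ∀ z ∈ A, dist (χ y) (χ z) = dist y z := by
    rintro y ⟨hy, hyV⟩ z ⟨hz, hzV⟩
    obtain ⟨h1, h1', h1''⟩ := hχ y hy hyV
    obtain ⟨h2, h2', h2''⟩ := hχ z hz hzV
    rw [← orbitDist_eq_dist hd h1 h2]
    have := hUψ _ hyV.1 _ hzV.1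
    rw [h1'', h2''] at this
    exact this
  obtain ⟨O, hO, hOne, hOV⟩ := exists_isOpen_of_mem_nhds hcl hV
  obtain ⟨p, hp, q, hq, hpq⟩ := exists_ne_of_isOpen hO hOne
  obtain ⟨F, hF⟩ := exists_isometryEquiv_of_dist_eq hiso (hOV p hp) (hOV q hq) hpq
  refine ⟨F, ?_⟩
  filter_upwards [hV] with y hy
  obtain ⟨-, h2, h3⟩ := hχ y y.2 hy
  have h4 : F y = χ y := hF y ⟨y.2, hy⟩
  unfold Develops
  rw [h4]
  exact ⟨h2, h3⟩

/-- The points near which `F` develops `ψ` form an open and closed set: at a limit point a local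
development `G` differs from `F` by one element of `Γ`, by rigidity on an open overlap. -/
theorem Develops.forall (hΓ : IsDiscontinuous Γ) (hD' : IsInvariant Γ D') (hconv : IsHConvex D)
    (hcl : D ⊆ closure (interior D)) {ψ : D → QuotientSurface Γ D'} (hψ : IsLocallyIsometric ψ)
    {F : ℍ ≃ᵢ ℍ} {x₀ : D} (h : ∀ᶠ y in 𝓝 x₀, Develops ψ F y) (x : D) : Develops ψ F x := by
  have : PreconnectedSpace D := Subtype.preconnectedSpace hconv.isPreconnected
  let E : Set D := {x | ∀ᶠ y in 𝓝 x, Develops ψ F y}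
  have hopen : IsOpen E := isOpen_setOfPred_eventually_nhds
  have hclosed : IsClosed E := by
    refine isClosed_of_closure_subset fun x hx => ?_
    obtain ⟨G, hG⟩ := exists_develops hΓ hD' hcl hψ x
    obtain ⟨y₀, hy₀G, hy₀⟩ := mem_closure_iff_nhds.1 hx _ hG.eventually_nhds
    obtain ⟨O, hO, hOne, hOV⟩ := exists_isOpen_of_mem_nhds hcl
      (show {y | Develops ψ F y ∧ Develops ψ G y} ∈ 𝓝 y₀ from
        Filter.Eventually.and hy₀ hy₀G)
    obtain ⟨δ, hδ, hFG⟩ := hΓ.exists_smul_eq (F := F) (G := G) hO hOne fun y hy => by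
      obtain ⟨h, ⟨h1, h1'⟩, ⟨h2, h2'⟩⟩ := hOV y hy
      obtain ⟨δ, hδ, h3⟩ := proj_eq_iff.1 (h2'.symm.trans h1')
      exact ⟨δ, hδ, h3.symm⟩
    show ∀ᶠ y in 𝓝 x, Develops ψ F y
    filter_upwards [hG] with y hy
    obtain ⟨h1, h2⟩ := hy
    unfold Develops
    rw [hFG]
    exact ⟨hD' δ hδ _ h1, h2.trans (proj_eq_iff.2 ⟨δ, hδ, rfl⟩)⟩
  have huniv := IsClopen.eq_univ ⟨hclosed, hopen⟩ ⟨x₀, h⟩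
  have hx : x ∈ E := huniv ▸ mem_univ x
  exact hx.self_of_nhds

end

/-- The contraction of `D` to `p`, read as a homotopy from a constant map to the identity and
composed with `π`, is lifted from `z₀`. Since it fixes `p`, the lifted path over `p` is constant. -/
theorem IsHConvex.exists_lift {D : Set ℍ} (hD : IsHConvex D) {Z S : Type} [TopologicalSpace Z]
    [TopologicalSpace S] {f : Z → S} (hf : IsCoveringMap f) {π : D → S} (hπ : Continuous π) {p : D}
    {z₀ : Z} (hz : f z₀ = π p) : ∃ s : D → Z, Continuous s ∧ f ∘ s = π ∧ s p = z₀ := by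
  let H : C(unitInterval × D, S) := (⟨π, hπ⟩ : C(D, S)).comp (hD.contraction p)
  have hH0 : ∀ a, H (0, a) = f (ContinuousMap.const D z₀ a) := by
    intro a
    show π ⟨combo p a 0, _⟩ = f z₀
    rw [hz]
    congr 1
    exact Subtype.ext (combo_zero _ _)
  have hL := hf.liftHomotopy_lifts H (ContinuousMap.const D z₀) hH0
  refine ⟨fun a => hf.liftHomotopy H _ hH0 (1, a), by fun_prop, ?_, ?_⟩
  · funext a
    refine (congrFun hL (1, a)).trans ?_
    show π ⟨combo p a 1, _⟩ = π a
    congr 1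
    exact Subtype.ext (combo_one _ _)
  · have := hf.eq_of_comp_eq (A := unitInterval)
      (g₁ := fun t => hf.liftHomotopy H _ hH0 (t, p)) (g₂ := fun _ => z₀) (by fun_prop) (by fun_prop)
      (by
        funext t
        refine (congrFun hL (t, p)).trans ?_
        show π ⟨combo p p t, _⟩ = f z₀
        rw [hz]
        congr 1
        exact Subtype.ext (combo_self _ _)) 0 (hf.liftHomotopy_zero H _ hH0 p)
    exact congrFun this 1

theorem isLocallyIsometric_proj {Γ : Subgroup SL(2, ℝ)} {D : Set ℍ} (hΓ : IsDiscontinuous Γ) :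
    IsLocallyIsometric (proj Γ D) := by
  intro x
  obtain ⟨ε, hε, hd⟩ := hΓ x
  refine ⟨Metric.ball x (ε / 4), Metric.ball_mem_nhds x (by linarith), fun a ha b hb => ?_⟩
  rw [Metric.mem_ball, dist_comm] at ha hb
  exact orbitDist_eq_dist hd ha hb

theorem isLocallyIsometric_comp_lift {Y Z S S' : Type} [PseudoMetricSpace Y] [PseudoMetricSpace Z]
    [PseudoMetricSpace S] [PseudoMetricSpace S'] {f : Z → S} {f' : Z → S'} {s : Y → Z}
    (hf : IsFiniteCover f) (hf' : IsFiniteCover f') (hs : Continuous s)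
    (h : IsLocallyIsometric (f ∘ s)) : IsLocallyIsometric (f' ∘ s) := by
  intro x
  obtain ⟨U, hU, h1⟩ := h x
  obtain ⟨V, hV, h2⟩ := hf.locally_isometric (s x)
  obtain ⟨W, hW, h3⟩ := hf'.locally_isometric (s x)
  refine ⟨U ∩ s ⁻¹' (V ∩ W), Filter.inter_mem hU (hs.continuousAt (Filter.inter_mem hV hW)), ?_⟩
  rintro a ⟨haU, haV, haW⟩ b ⟨hbU, hbV, hbW⟩
  rw [Function.comp_apply, Function.comp_apply, h3 _ haW _ hbW, ← h2 _ haV _ hbV]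
  exact h1 a haU b hbU

/-- A convex region with non-empty interior that is invariant under the discontinuous group `Γ`. -/
structure IsRegion (Γ : Subgroup SL(2, ℝ)) (D : Set ℍ) : Prop where
  discontinuous : IsDiscontinuous Γ
  invariant : IsInvariant Γ D
  convex : IsHConvex D
  nonempty : D.Nonempty
  subset_closure_interior : D ⊆ closure (interior D)

/-- Commensurable quotients of convex regions have isometric universal coverings, by an isometry
that conjugates powers of the generator of the group. -/
theorem AreCommensurable.exists_isometryEquiv {η : SL(2, ℝ)} {D D' : Set ℍ}
    (hD : IsRegion (Subgroup.zpowers η) D) (hD' : IsRegion (Subgroup.zpowers η) D')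
    (h : AreCommensurable (QuotientSurface (Subgroup.zpowers η) D)
      (QuotientSurface (Subgroup.zpowers η) D')) :
    ∃ F : ℍ ≃ᵢ ℍ, (∀ z, z ∈ D ↔ F z ∈ D') ∧
      ∃ k l : ℤ, k ≠ 0 ∧ ∀ z, F (η ^ k • z) = η ^ l • F z := by
  set Γ := Subgroup.zpowers η
  have hΓ := hD.discontinuous
  obtain ⟨Z, _, f, f', -, hf, hf'⟩ := h
  obtain ⟨p, hp⟩ := hD.nonempty
  have : PreconnectedSpace D := Subtype.preconnectedSpace hD.convex.isPreconnected
  obtain ⟨z₀, hz₀⟩ := hf.surjective (proj Γ D ⟨p, hp⟩)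
  obtain ⟨s, hs, hfs, hsp⟩ := hD.convex.exists_lift hf.covering continuous_proj hz₀
  have hψ : IsLocallyIsometric (f' ∘ s) := isLocallyIsometric_comp_lift hf hf' hs
    (by rw [hfs]; exact isLocallyIsometric_proj hΓ)
  obtain ⟨F, hF⟩ := exists_develops hΓ hD'.invariant hD.subset_closure_interior hψ ⟨p, hp⟩
  replace hF := fun x => Develops.forall hΓ hD'.invariant hD.convex hD.subset_closure_interior hψ hF x
  obtain ⟨hp', hFp⟩ := hF ⟨p, hp⟩
  have hz₀' : f' z₀ = proj Γ D' ⟨F p, hp'⟩ := by rw [← hFp, ← hsp]; rfl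
  obtain ⟨s', hs', hfs', hsp'⟩ := hD'.convex.exists_lift hf'.covering continuous_proj hz₀'
  have hψ' : IsLocallyIsometric (f ∘ s') := isLocallyIsometric_comp_lift hf' hf hs'
    (by rw [hfs']; exact isLocallyIsometric_proj hΓ)
  obtain ⟨G, hG⟩ := exists_develops hΓ hD.invariant hD'.subset_closure_interior hψ' ⟨F p, hp'⟩
  replace hG := fun x => Develops.forall hΓ hD.invariant hD'.convex hD'.subset_closure_interior hψ' hG x
  -- Uniqueness of lifts. It follows that `G ∘ F` covers the identity of `D / Γ`, so it is an
  -- element of `Γ`, and `F` maps `D` onto `D'`.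
  have hsF : (fun x : D => s' ⟨F x, (hF x).1⟩) = s := by
    refine hf'.covering.eq_of_comp_eq (hs'.comp ((F.continuous.comp continuous_subtype_val).subtype_mk _))
      hs ?_ ⟨p, hp⟩ ?_
    · funext x
      exact (congrFun hfs' _).trans (hF x).2.symm
    · rw [hsp]; exact hsp'
  have hint : (interior D).Nonempty := closure_nonempty_iff.1 ⟨p, hD.subset_closure_interior hp⟩
  obtain ⟨δ, hδ, hGF⟩ := hΓ.exists_smul_eq (F := F.trans G) (G := IsometryEquiv.refl ℍ)
    isOpen_interior hint fun y hy => by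
      have hy' := interior_subset hy
      obtain ⟨h1, h2⟩ := hG ⟨F y, (hF ⟨y, hy'⟩).1⟩
      have h3 : f (s ⟨y, hy'⟩) = proj Γ D ⟨G (F y), h1⟩ := by
        rw [← h2, ← hsF]; rfl
      have h4 : f (s ⟨y, hy'⟩) = proj Γ D ⟨y, hy'⟩ := congrFun hfs _
      obtain ⟨δ, hδ, h5⟩ := proj_eq_iff.1 (h4.symm.trans h3)
      exact ⟨δ, hδ, h5.symm⟩
  refine ⟨F, fun z => ⟨fun hz => (hF ⟨z, hz⟩).1, fun hz => ?_⟩, ?_⟩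
  · have h1 := (hG ⟨F z, hz⟩).1
    have h2 : G (F z) = δ • z := hGF z
    simp only [h2] at h1
    simpa using hD.invariant δ⁻¹ (Γ.inv_mem hδ) _ h1
  · have hinv : ∀ (k : ℤ) (x : D), η ^ k • (x : ℍ) ∈ D := fun k x =>
      hD.invariant _ (Subgroup.zpow_mem_zpowers η k) x x.2
    have hπ : ∀ (k : ℤ) (x : D), f (s ⟨η ^ k • (x : ℍ), hinv k x⟩) = proj Γ D x := fun k x =>
      (congrFun hfs _).trans
        (proj_eq_iff.2 ⟨η ^ k, Subgroup.zpow_mem_zpowers η k, rfl⟩ : proj Γ D x = _).symm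
    -- Pigeonhole in a finite fibre: `s` takes the same value at two of the points `η ^ k • p`. By
    -- unique lifting `s` is invariant under `η ^ (k - l)`, and so `F` and its composition with this
    -- power agree up to `Γ`.
    have hfin := (hf.finite_degree (proj Γ D ⟨p, hp⟩)).to_subtype
    obtain ⟨k, l, hkl, heq⟩ := Finite.exists_ne_map_eq_of_infinite
      (fun k : ℤ => (⟨s ⟨η ^ k • p, hinv k ⟨p, hp⟩⟩, hπ k ⟨p, hp⟩⟩ : f ⁻¹' {proj Γ D ⟨p, hp⟩}))
    have heq' : s ⟨η ^ k • p, hinv k ⟨p, hp⟩⟩ = s ⟨η ^ l • p, hinv l ⟨p, hp⟩⟩ := congrArg Subtype.val heq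
    have hsη : (fun x : D => s ⟨η ^ (k - l) • (x : ℍ), hinv (k - l) x⟩) = s := by
      refine hf.covering.eq_of_comp_eq (hs.comp
        (((isometry_smul ℍ (η ^ (k - l))).continuous.comp continuous_subtype_val).subtype_mk _)) hs ?_
        ⟨η ^ l • p, hinv l ⟨p, hp⟩⟩ ?_
      · funext x
        exact (hπ _ x).trans (congrFun hfs x).symm
      · rw [← heq']
        congr 1
        exact Subtype.ext (by simp [smul_smul, ← zpow_add])
    obtain ⟨δ', ⟨j, rfl⟩, hj⟩ := hΓ.exists_smul_eq
      (F := (IsometryEquiv.constSMul (η ^ (k - l)) : ℍ ≃ᵢ ℍ).trans F) (G := F)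
      isOpen_interior hint fun y hy => by
        have hy' := interior_subset hy
        have h1 : proj Γ D' ⟨F y, (hF ⟨y, hy'⟩).1⟩ = proj Γ D' ⟨F (η ^ (k - l) • y),
            (hF ⟨_, hinv (k - l) ⟨y, hy'⟩⟩).1⟩ := by
          rw [← (hF ⟨y, hy'⟩).2, ← (hF ⟨_, hinv (k - l) ⟨y, hy'⟩⟩).2]
          exact congrArg f' (congrFun hsη ⟨y, hy'⟩).symm
        obtain ⟨δ, hδ, h5⟩ := proj_eq_iff.1 h1
        exact ⟨δ, hδ, h5.symm⟩
    exact ⟨k - l, j, sub_ne_zero.2 hkl, hj⟩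

theorem isCoveringMap_homeomorph {E B : Type*} [TopologicalSpace E] [TopologicalSpace B] (e : E ≃ₜ B) :
    IsCoveringMap e := fun _ =>
  IsEvenlyCovered.to_isEvenlyCovered_preimage (I := PUnit.{1})
    ⟨inferInstance, univ, mem_univ _, isOpen_univ, by simp,
      (((Homeomorph.Set.univ E).trans e).trans (Homeomorph.Set.univ B).symm).trans
        (Homeomorph.prodPUnit _).symm, fun _ => rfl⟩

/-- The first surface is itself the common covering; discontinuity makes its pseudometric a metric.
-/
theorem AreIsometric.areCommensurable {Γ : Subgroup SL(2, ℝ)} {D D' : Set ℍ} (hD : IsRegion Γ D)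
    (h : AreIsometric (QuotientSurface Γ D) (QuotientSurface Γ D')) :
    AreCommensurable (QuotientSurface Γ D) (QuotientSurface Γ D') := by
  obtain ⟨e⟩ := h
  let m : MetricSpace (QuotientSurface Γ D) :=
    { quotientPseudoMetricSpace Γ D with
      eq_of_dist_eq_zero := fun h => eq_of_dist_proj_eq_zero hD.discontinuous h }
  refine ⟨QuotientSurface Γ D, m, id, e, connectedSpace_quotient hD.convex hD.nonempty, ?_, ?_⟩
  · exact ⟨isCoveringMap_homeomorph (Homeomorph.refl _), Function.surjective_id,
      fun p => by simp, fun z => ⟨univ, Filter.univ_mem, fun _ _ _ _ => rfl⟩⟩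
  · exact ⟨isCoveringMap_homeomorph e.toHomeomorph, e.surjective,
      fun p => (finite_singleton (e.symm p)).subset fun z hz => by
        rw [mem_singleton_iff, ← (show e z = p from hz), e.symm_apply_apply],
      fun z => ⟨univ, Filter.univ_mem, fun x _ y _ => e.dist_eq x y⟩⟩

/-! ### Congruence of sets of vertices of the cycle -/

theorem res_add_res {k : ℕ} [NeZero k] (i j : ℤ) : res k (i + j) = res k i + res k j := by
  rw [Fin.ext_iff, ← Nat.cast_inj (R := ℤ), coe_res, Fin.val_add, Int.natCast_emod, Nat.cast_add,
    coe_res, coe_res, ← Int.add_emod]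

/-- `i ↦ e * i + c` induces a rotation or reflection of the cycle. An inclusion is enough, since `X`
and its complement have the same size. -/
theorem areCongruent_of_forall_mem {n : ℕ} (hn : 0 < n) {X : Finset (Fin (2 * n))}
    (hX : X.card = n) {e c : ℤ} (he : e = 1 ∨ e = -1)
    (h : ∀ i ∈ cycleLift X, e * i + c ∈ cycleLift Xᶜ) : AreCongruent X Xᶜ := by
  have : NeZero (2 * n) := ⟨by omega⟩
  suffices ∃ φ : SimpleGraph.cycleGraph (2 * n) ≃g SimpleGraph.cycleGraph (2 * n),
      ∀ v : Fin (2 * n), φ v = res (2 * n) (e * (v : ℕ) + c) by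
    obtain ⟨φ, hφ⟩ := this
    refine ⟨φ, Finset.eq_of_subset_of_card_le (fun w hw => ?_) ?_⟩
    · obtain ⟨v, hv, rfl⟩ := Finset.mem_image.1 hw
      rw [hφ, ← mem_cycleLift]
      exact h _ (mem_cycleLift.2 (by rwa [res_coe]))
    · rw [Finset.card_image_of_injective _ φ.injective, Finset.card_compl, hX, Fintype.card_fin]
      omega
  obtain ⟨n, rfl⟩ : ∃ n', n = n' + 1 := ⟨n - 1, by omega⟩
  rcases he with rfl | rfl
  · refine ⟨⟨Equiv.addRight (res (2 * n + 2) c), fun {u v} => ?_⟩, fun v => ?_⟩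
    · show (SimpleGraph.cycleGraph (2 * n + 2)).Adj _ _ ↔ (SimpleGraph.cycleGraph (2 * n + 2)).Adj _ _
      rw [SimpleGraph.cycleGraph_adj, SimpleGraph.cycleGraph_adj, Equiv.coe_addRight,
        add_sub_add_right_eq_sub, add_sub_add_right_eq_sub]
    · rw [one_mul, res_add_res, res_coe]
      rfl
  · refine ⟨⟨Equiv.subLeft (res (2 * n + 2) c), fun {u v} => ?_⟩, fun v => ?_⟩
    · show (SimpleGraph.cycleGraph (2 * n + 2)).Adj _ _ ↔ (SimpleGraph.cycleGraph (2 * n + 2)).Adj _ _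
      rw [SimpleGraph.cycleGraph_adj, SimpleGraph.cycleGraph_adj, Equiv.subLeft_apply,
        Equiv.subLeft_apply, sub_sub_sub_cancel_left, sub_sub_sub_cancel_left, or_comm]
    · have h1 := res_add_res (k := 2 * n + 2) (-1 * ((v : ℕ) : ℤ) + c) (v : ℕ)
      rw [neg_one_mul, neg_add_cancel_comm, res_coe] at h1
      rw [neg_one_mul]
      exact (eq_sub_of_add_eq h1.symm).symm

/-- The vertex 1 has both neighbours 0 and 2 in the first set; no vertex of `{3, 4, 6, 7}` has two
neighbours in that set. -/
theorem not_areCongruent_mallowsClark : ¬ AreCongruent mallowsClark mallowsClarkᶜ := by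
  rintro ⟨φ, hφ⟩
  have hmem : ∀ v ∈ mallowsClark, φ v ∈ mallowsClarkᶜ := fun v hv => by
    rw [← hφ]; exact Finset.mem_image_of_mem _ hv
  have hadj : ∀ u v : Fin 8, u - v = 1 ∨ v - u = 1 →
      φ u - φ v = (1 : Fin 8) ∨ φ v - φ u = (1 : Fin 8) := fun u v h =>
    (SimpleGraph.cycleGraph_adj (n := 6)).1
      (φ.map_rel_iff.2 ((SimpleGraph.cycleGraph_adj (n := 6)).2 h))
  have h1 := hadj 1 0 (by decide)
  have h2 := hadj 1 2 (by decide)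
  have h3 : φ 0 ≠ φ 2 := fun h => absurd (φ.injective h) (by decide)
  have key : ∀ u v w : Fin 8, u ∈ mallowsClarkᶜ → v ∈ mallowsClarkᶜ → w ∈ mallowsClarkᶜ →
      (u - v = 1 ∨ v - u = 1) → (u - w = 1 ∨ w - u = 1) → v = w := by
    unfold mallowsClark
    decide
  exact h3 (key _ _ _ (hmem 1 (by decide)) (hmem 0 (by decide)) (hmem 2 (by decide)) h1 h2)

/-! ### Isometries that normalise a group of translations or dilations -/

theorem reflect_trans_smul (t : ℝ) (z : ℍ) : reflect (trans t • z) = trans (-t) • reflect z :=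
  ext_re_im (by simp; ring) (by simp)

theorem reflect_dil_smul (t : ℝ) (z : ℍ) : reflect (dil t • z) = dil t • reflect z :=
  ext_re_im (by simp) (by simp)

/-- On the horocycle of height 1 the height of the image is the reciprocal of a quadratic polynomial
in `x` with leading coefficient `(M 1 0)²`. It is periodic, so the polynomial is constant. -/
theorem lower_left_eq_zero_of_normalizes_trans {M : SL(2, ℝ)} {t t' : ℝ} (ht : t ≠ 0)
    (h : ∀ z : ℍ, M • trans t • z = trans t' • M • z) : M 1 0 = 0 := by
  have key : ∀ x : ℝ, (M 1 0 * (x + t) + M 1 1) ^ 2 = (M 1 0 * x + M 1 1) ^ 2 := by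
    intro x
    have h1 := congrArg UpperHalfPlane.im (h (x +ᵥ UpperHalfPlane.I))
    rw [trans_smul_im, smul_im M, smul_im M, trans_smul_im, trans_smul_re] at h1
    simp only [vadd_re, vadd_im, UpperHalfPlane.I_re, UpperHalfPlane.I_im, add_zero, mul_one,
      one_div] at h1
    have := inv_injective h1
    linarith
  have h0 := key 0
  have h1 := key 1
  have h2 : M 1 0 ^ 2 * t = 0 := by linarith
  simpa [ht] using h2

/-- The isometry fixes `∞` and is a Euclidean similarity. Its factor `α` remains free here; the
boundary geodesics determine it later. -/
theorem exists_scale_of_normalizes_trans (G : ℍ ≃ᵢ ℍ) {t t' : ℝ} (ht : t ≠ 0)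
    (h : ∀ z : ℍ, G (trans t • z) = trans t' • G z) : ∃ α > 0, ∃ e : ℤ, (e = 1 ∨ e = -1) ∧
      (∀ z, (G z).im = α * z.im) ∧ ∀ s z, G (trans s • z) = trans (e * α * s) • G z := by
  obtain ⟨M, hM⟩ := isometryEquiv_eq_smul G
  have hd := det_entries M
  have hsmul : M 1 0 = 0 → 0 < M 0 0 ^ 2 ∧ (∀ z : ℍ, (M • z).im = M 0 0 ^ 2 * z.im) ∧
      ∀ (s : ℝ) (z : ℍ), M • trans s • z = trans (M 0 0 ^ 2 * s) • M • z := by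
    intro hc
    rw [hc, mul_zero, sub_zero] at hd
    have ha : M 0 0 ≠ 0 := left_ne_zero_of_mul_eq_one hd
    have hd1 : M 1 1 = (M 0 0)⁻¹ := eq_inv_of_mul_eq_one_right hd
    have him : ∀ z : ℍ, (M • z).im = M 0 0 ^ 2 * z.im := by
      intro z
      rw [smul_im, hc, hd1]
      field_simp
      ring
    refine ⟨by positivity, him, fun s z => ext_re_im ?_ (by simp [him])⟩
    rw [trans_smul_re, smul_re M, smul_re M, hc, hd1]
    simp
    field_simp
    ring
  rcases hM with hM | hM
  · simp only [hM] at h ⊢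
    obtain ⟨h1, h2, h3⟩ := hsmul (lower_left_eq_zero_of_normalizes_trans ht h)
    exact ⟨_, h1, 1, Or.inl rfl, h2, fun s z => by rw [h3]; simp⟩
  · simp only [hM, reflect_trans_smul] at h ⊢
    obtain ⟨h1, h2, h3⟩ := hsmul (lower_left_eq_zero_of_normalizes_trans (neg_ne_zero.2 ht)
      fun z => by simpa using h (reflect.symm z))
    exact ⟨_, h1, -1, Or.inr rfl, fun z => by rw [h2, reflect_im], fun s z => by rw [h3]; simp⟩

/-- The quotient `re / im` is invariant under dilations. On the image of the imaginary axis it is `A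
e^s + B e^(-s)`, which takes the same value at `0`, `t` and `2t` only if `A = B = 0`. -/
theorem diag_or_antidiag_of_normalizes_dil {M : SL(2, ℝ)} {t t' : ℝ} (ht : t ≠ 0)
    (h : ∀ z : ℍ, M • dil t • z = dil t' • M • z) : M 0 0 * M 1 0 = 0 ∧ M 0 1 * M 1 1 = 0 := by
  have hratio : ∀ s : ℝ, (M • expI s).re / (M • expI s).im
      = M 0 0 * M 1 0 * Real.exp s + M 0 1 * M 1 1 * Real.exp (-s) := by
    intro s
    have h1 := denom_sq_pos M (expI s)
    have h2 := Real.exp_pos s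
    rw [smul_re, smul_im, div_div_div_cancel_right₀ h1.ne', Real.exp_neg]
    simp
    field_simp
  have key : ∀ s : ℝ, M 0 0 * M 1 0 * Real.exp (t + s) + M 0 1 * M 1 1 * Real.exp (-(t + s))
      = M 0 0 * M 1 0 * Real.exp s + M 0 1 * M 1 1 * Real.exp (-s) := by
    intro s
    rw [← hratio, ← hratio, ← dil_smul_expI, h, dil_smul_re, dil_smul_im,
      mul_div_mul_left _ _ (Real.exp_pos _).ne']
  have h0 := key 0
  have h1 := key t
  have hq : Real.exp t ≠ 1 := fun h => ht (Real.exp_eq_one_iff _ |>.1 h)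
  have hq0 := Real.exp_pos t
  simp only [add_zero, neg_zero, Real.exp_zero, neg_add, Real.exp_add, Real.exp_neg] at h0 h1
  set q := Real.exp t
  set A := M 0 0 * M 1 0
  set B := M 0 1 * M 1 1
  have e0 : (A * q - B) * (q - 1) = 0 := by
    field_simp at h0
    linear_combination h0
  have e1 : (A * q ^ 3 - B) * (q - 1) = 0 := by
    field_simp at h1
    linear_combination h1
  have hq1 : q - 1 ≠ 0 := sub_ne_zero.2 hq
  have f0 := (mul_eq_zero.1 e0).resolve_right hq1
  have f1 := (mul_eq_zero.1 e1).resolve_right hq1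
  have hA : A * (q * ((q - 1) * (q + 1))) = 0 := by linear_combination f1 - f0
  have hA0 : A = 0 := by
    refine (mul_eq_zero.1 hA).resolve_right ?_
    have : q + 1 ≠ 0 := by positivity
    exact mul_ne_zero hq0.ne' (mul_ne_zero hq1 this)
  exact ⟨hA0, by rw [hA0] at f0; linarith⟩

/-- Diagonal matrices and the reflection commute with dilations, antidiagonal matrices invert them.
In contrast to translations, no scale factor arises. -/
theorem exists_sign_of_normalizes_dil (G : ℍ ≃ᵢ ℍ) {t t' : ℝ} (ht : t ≠ 0)
    (h : ∀ z : ℍ, G (dil t • z) = dil t' • G z) : ∃ e : ℤ, (e = 1 ∨ e = -1) ∧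
      (∀ z, (G z).re = 0 → z.re = 0) ∧ ∀ s z, G (dil s • z) = dil (e * s) • G z := by
  obtain ⟨M, hM⟩ := isometryEquiv_eq_smul G
  have hd := det_entries M
  have hsmul : M 0 0 * M 1 0 = 0 ∧ M 0 1 * M 1 1 = 0 → ∃ e : ℤ, (e = 1 ∨ e = -1) ∧
      (∀ z : ℍ, (M • z).re = 0 → z.re = 0) ∧
      ∀ (s : ℝ) (z : ℍ), M • dil s • z = dil (e * s) • M • z := by
    rintro ⟨hac, hbd⟩
    have hre : ∀ z : ℍ, (M • z).re = 0 → z.re = 0 := by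
      intro z hz
      have h1 := denom_sq_pos M z
      rw [smul_re, hac, hbd, div_eq_zero_iff] at hz
      have h2 := hz.resolve_right h1.ne'
      rw [zero_mul, zero_add, add_zero] at h2
      refine (mul_eq_zero.1 h2).resolve_left fun h3 => ?_
      have h4 : M 0 0 * M 1 1 * (M 0 1 * M 1 0) = 0 := by linear_combination M 0 1 * M 1 1 * hac
      have h5 : M 0 0 * M 1 1 = 1 / 2 := by linarith
      have h6 : M 0 1 * M 1 0 = -1 / 2 := by linarith
      rw [h5, h6] at h4
      norm_num at h4
    rcases mul_eq_zero.1 hac with ha | hc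
    · rw [ha] at hd
      have hb : M 0 1 ≠ 0 := fun hb => by simp [hb] at hd
      have hc : M 1 0 ≠ 0 := fun hc => by simp [hc] at hd
      have hd1 : M 1 1 = 0 := (mul_eq_zero.1 hbd).resolve_left hb
      refine ⟨-1, Or.inr rfl, hre, fun s z => ext_re_im ?_ ?_⟩
      · have := z.im_pos
        have := Real.exp_pos s
        rw [dil_smul_re, smul_re M, smul_re M, ha, hd1]
        simp [Real.exp_neg]
        field_simp
      · have := z.im_pos
        have := Real.exp_pos s
        rw [dil_smul_im, smul_im M, smul_im M, hd1]
        simp [Real.exp_neg]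
        field_simp
    · rw [hc] at hd
      have hd1 : M 1 1 ≠ 0 := fun hd1 => by simp [hd1] at hd
      have hb : M 0 1 = 0 := (mul_eq_zero.1 hbd).resolve_right hd1
      refine ⟨1, Or.inl rfl, hre, fun s z => ext_re_im ?_ ?_⟩
      · rw [dil_smul_re, smul_re M, smul_re M, hc, hb]
        simp
        field_simp
      · rw [dil_smul_im, smul_im M, smul_im M, hc]
        simp
        field_simp
  rcases hM with hM | hM
  · simp only [hM] at h ⊢
    exact hsmul (diag_or_antidiag_of_normalizes_dil ht h)
  · simp only [hM, reflect_dil_smul] at h ⊢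
    obtain ⟨e, he, h1, h2⟩ := hsmul (diag_or_antidiag_of_normalizes_dil ht
      fun z => by simpa using h (reflect.symm z))
    exact ⟨e, he, fun z hz => by simpa using h1 _ hz, fun s z => h2 s _⟩

/-- The isometry `F` in the coordinates given by `N`. -/
def conj (N : SL(2, ℝ)) (F : ℍ ≃ᵢ ℍ) : ℍ ≃ᵢ ℍ :=
  ((IsometryEquiv.constSMul N).trans F).trans (IsometryEquiv.constSMul N⁻¹)

@[simp] theorem conj_apply (N : SL(2, ℝ)) (F : ℍ ≃ᵢ ℍ) (z : ℍ) : conj N F z = N⁻¹ • F (N • z) := rfl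

theorem zpow_smul_eq_conj {γ N : SL(2, ℝ)} {φ : ℝ → SL(2, ℝ)} {t : ℝ}
    (h : ∀ (k : ℤ) (z : ℍ), γ ^ k • N • z = N • φ (k * t) • z) (F : ℍ ≃ᵢ ℍ) {k l : ℤ} :
    (∀ z : ℍ, F (γ ^ k • z) = γ ^ l • F z) ↔
      ∀ z, conj N F (φ (k * t) • z) = φ (l * t) • conj N F z := by
  constructor
  · intro hF z
    rw [conj_apply, conj_apply, ← h, hF, inv_smul_eq_iff, ← h, smul_inv_smul]
  · intro hF z
    have h1 := hF (N⁻¹ • z)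
    rw [conj_apply, conj_apply, ← h, inv_smul_eq_iff, ← h, smul_inv_smul, smul_inv_smul] at h1
    exact h1

/-! ### Isometries of the regions -/

theorem image_mem_boundaryGeodesics (F : ℍ ≃ᵢ ℍ) {D D' : Set ℍ} (hF : ∀ z, z ∈ D ↔ F z ∈ D')
    {s : Set ℍ} (hs : s ∈ boundaryGeodesics D) : F '' s ∈ boundaryGeodesics D' := by
  obtain ⟨⟨c, hc, rfl⟩, hfr⟩ := hs
  refine ⟨⟨F ∘ c, F.isometry.comp hc, (range_comp F c).symm⟩, ?_⟩
  have hD : F '' D = D' := by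
    ext z
    constructor
    · rintro ⟨w, hw, rfl⟩
      exact (hF w).1 hw
    · exact fun hz => ⟨F.symm z, (hF _).2 (by simpa using hz), by simp⟩
  rw [← hD]
  exact (image_mono hfr).trans (F.toHomeomorph.image_frontier D).subset

theorem le_one_of_mul_mem {P : Set ℝ} {r α : ℝ} (hP : ∀ p ∈ P, 0 < p ∧ p ≤ r) (hne : P.Nonempty)
    (h : ∀ p ∈ P, α * p ∈ P) : α ≤ 1 := by
  by_contra! hα
  obtain ⟨p, hp⟩ := hne
  obtain ⟨n, hn⟩ := pow_unbounded_of_one_lt (r / p) hα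
  have key : ∀ n : ℕ, α ^ n * p ∈ P := by
    intro n
    induction n with
    | zero => simpa using hp
    | succ n ih => rw [pow_succ', mul_assoc]; exact h _ ih
  have h1 := (hP _ (key n)).2
  rw [div_lt_iff₀ (hP p hp).1] at hn
  linarith

section
variable {γ : SL(2, ℝ)} {U : Set ℍ} {𝒢₀ : Set (Set ℍ)} {n : ℕ} {X : Finset (Fin (2 * n))}
  {F : ℍ ≃ᵢ ℍ}

/-- The constant `c` in the action `i ↦ e * i + c` on indices is read off at one translate. It holds
for the others because a point cannot lie in two translates of the complement of `U`. -/
theorem IsCore.areCongruent (h : IsCore γ U 𝒢₀) (hn : 0 < n) (hX : X.card = n)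
    {e : ℤ} (he : e = 1 ∨ e = -1) (hF : ∀ (i : ℤ) z, F (γ ^ i • z) = γ ^ (e * i) • F z)
    (himg : ∀ s ∈ translates γ 𝒢₀ (cycleLift X), F '' s ∈ translates γ 𝒢₀ (cycleLift Xᶜ)) :
    AreCongruent X Xᶜ := by
  have : NeZero (2 * n) := ⟨by omega⟩
  obtain ⟨v, hv⟩ := Finset.card_pos.1 (hX.trans_gt hn)
  obtain ⟨a, ha⟩ := h.nonempty
  have himg' : ∀ i ∈ cycleLift X, ∃ j ∈ cycleLift Xᶜ, ∃ b ∈ 𝒢₀, ∀ x ∈ a,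
      ∃ y ∈ b, F (γ ^ i • x) = γ ^ j • y := by
    intro i hi
    obtain ⟨j, hj, b, hb, hab⟩ := himg _ ⟨i, hi, a, ha, rfl⟩
    refine ⟨j, hj, b, hb, fun x hx => ?_⟩
    have h1 : F (γ ^ i • x) ∈ F '' (γ ^ i • a) := mem_image_of_mem _ (smul_mem_smul_set hx)
    rw [hab] at h1
    obtain ⟨y, hy, h2⟩ := h1
    exact ⟨y, hy, h2.symm⟩
  obtain ⟨j₀, -, b₀, hb₀, h0⟩ := himg' (v : ℕ) (mem_cycleLift.2 (by rwa [res_coe]))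
  obtain ⟨x, hx⟩ := (h.geodesics a ha).nonempty
  obtain ⟨y₀, hy₀, hxy₀⟩ := h0 x hx
  refine areCongruent_of_forall_mem hn hX (c := j₀ - e * (v : ℕ)) he fun i hi => ?_
  obtain ⟨j, hj, b, hb, h1⟩ := himg' i hi
  obtain ⟨y, hy, hxy⟩ := h1 x hx
  have h2 : γ ^ (e * i + (j₀ - e * (v : ℕ))) • y₀ = γ ^ j • y := by
    rw [← hxy, hF, show e * i + (j₀ - e * (v : ℕ)) = e * i - e * (v : ℕ) + j₀ by ring, zpow_add,
      mul_smul, ← hxy₀, hF, zpow_sub, mul_smul, inv_smul_smul]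
  by_contra hne
  have hij : e * i + (j₀ - e * (v : ℕ)) ≠ j := fun hij => hne (by rwa [hij])
  refine disjoint_left.1 (h.disjoint _ _ hij)
    (?_ : γ ^ (e * i + (j₀ - e * (v : ℕ))) • y₀ ∈ _) ?_
  · rw [← smul_set_compl]
    exact smul_mem_smul_set (h.subset_compl _ hb₀ hy₀)
  · rw [h2, ← smul_set_compl]
    exact smul_mem_smul_set (h.subset_compl _ hb hy)

theorem exists_smul_eq_of_image_mem_translates {A A' : Set ℤ} (hA : A.Nonempty) (G : ℍ → ℍ)
    (himg : ∀ s ∈ translates γ 𝒢₀ A, G '' s ∈ translates γ 𝒢₀ A') {z : ℍ} (hz : z ∈ ⋃₀ 𝒢₀) :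
    ∃ i j : ℤ, ∃ w ∈ ⋃₀ 𝒢₀, G (γ ^ i • z) = γ ^ j • w := by
  obtain ⟨i, hi⟩ := hA
  obtain ⟨a, ha, hza⟩ := hz
  obtain ⟨j, -, b, hb, hab⟩ := himg _ ⟨i, hi, a, ha, rfl⟩
  have h1 : G (γ ^ i • z) ∈ G '' (γ ^ i • a) := mem_image_of_mem _ (smul_mem_smul_set hza)
  rw [hab] at h1
  obtain ⟨w, hw, h2⟩ := h1
  exact ⟨i, j, w, ⟨b, hb, hw⟩, h2.symm⟩

theorem IsTranslation.areCongruent {N : SL(2, ℝ)} {t : ℝ} (hγ : IsTranslation γ N t)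
    (h : IsCore γ U 𝒢₀) (hn : 0 < n) (hX : X.card = n) {k l : ℤ} (hk : k ≠ 0)
    (hF : ∀ z, F (γ ^ k • z) = γ ^ l • F z)
    (himg : ∀ s ∈ translates γ 𝒢₀ (cycleLift X), F '' s ∈ translates γ 𝒢₀ (cycleLift Xᶜ))
    (himg' : ∀ s ∈ translates γ 𝒢₀ (cycleLift Xᶜ), F.symm '' s ∈ translates γ 𝒢₀ (cycleLift X)) :
    AreCongruent X Xᶜ := by
  have : NeZero (2 * n) := ⟨by omega⟩
  have hne : ∀ Y : Finset (Fin (2 * n)), Y.card = n → (cycleLift Y).Nonempty := by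
    intro Y hY
    obtain ⟨v, hv⟩ := Finset.card_pos.1 (hY.trans_gt hn)
    exact ⟨(v : ℕ), mem_cycleLift.2 (by rwa [res_coe])⟩
  obtain ⟨α, hα, e, he, him, hG⟩ := exists_scale_of_normalizes_trans (conj N F)
    (mul_ne_zero (Int.cast_ne_zero.2 hk) hγ.1) ((zpow_smul_eq_conj hγ.zpow_smul F).1 hF)
  have hinv : ∀ (i : ℤ) (z : ℍ), (N⁻¹ • γ ^ i • z).im = (N⁻¹ • z).im := by
    intro i z
    have := hγ.zpow_smul i (N⁻¹ • z)
    rw [smul_inv_smul] at this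
    rw [this, inv_smul_smul, trans_smul_im]
  have hFim : ∀ z, (N⁻¹ • F z).im = α * (N⁻¹ • z).im := by
    intro z
    rw [← him, conj_apply, smul_inv_smul]
  set P := (fun z : ℍ => (N⁻¹ • z).im) '' ⋃₀ 𝒢₀ with hPdef
  obtain ⟨r, -, hr⟩ := hγ.exists_horoball h
  have hP : ∀ p ∈ P, 0 < p ∧ p ≤ r := by
    rintro _ ⟨z, ⟨a, ha, hza⟩, rfl⟩
    refine ⟨UpperHalfPlane.im_pos _, not_lt.1 fun hlt => h.subset_compl a ha hza ?_⟩
    simpa using hr _ hlt 0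
  have hPne : P.Nonempty := by
    obtain ⟨a, ha⟩ := h.nonempty
    obtain ⟨z, hz⟩ := (h.geodesics a ha).nonempty
    exact ⟨_, z, ⟨a, ha, hz⟩, rfl⟩
  -- Powers of `γ` keep heights, `F` multiplies them by `α` and its inverse by `α⁻¹`. Both factors
  -- map the bounded set `P` of heights of `𝒢₀` into itself, so neither exceeds 1.
  have hα1 : α = 1 := by
    refine le_antisymm (le_one_of_mul_mem hP hPne ?_) ?_
    · rintro _ ⟨z, hz, rfl⟩
      obtain ⟨i, j, w, hw, hzw⟩ := exists_smul_eq_of_image_mem_translates (hne X hX) F himg hz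
      refine ⟨w, hw, ?_⟩
      show (N⁻¹ • w).im = α * (N⁻¹ • z).im
      rw [← hinv i z, ← hFim, hzw, hinv]
    · refine (inv_le_one₀ hα).1 (le_one_of_mul_mem hP hPne ?_)
      rintro _ ⟨z, hz, rfl⟩
      have hXc : Xᶜ.card = n := by
        rw [Finset.card_compl, hX, Fintype.card_fin]; omega
      obtain ⟨i, j, w, hw, hzw⟩ := exists_smul_eq_of_image_mem_translates (hne _ hXc) F.symm himg' hz
      refine ⟨w, hw, ?_⟩
      show (N⁻¹ • w).im = α⁻¹ * (N⁻¹ • z).im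
      rw [← hinv i z, eq_inv_mul_iff_mul_eq₀ hα.ne', ← hinv j, ← hFim, ← hzw, F.apply_symm_apply]
  refine h.areCongruent hn hX he (fun i => (zpow_smul_eq_conj hγ.zpow_smul F).2 fun z => ?_) himg
  rw [hG, hα1]
  push_cast
  ring_nf

theorem IsDilation.areCongruent {N : SL(2, ℝ)} {t : ℝ} (hγ : IsDilation γ N t)
    (h : IsCore γ U 𝒢₀) (hU : frontier U ⊆ halfPlane N⁻¹)
    (hn : 0 < n) (hX : X.card = n) {k l : ℤ} (hk : k ≠ 0)
    (hF : ∀ z, F (γ ^ k • z) = γ ^ l • F z)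
    (himg : ∀ s ∈ translates γ 𝒢₀ (cycleLift X),
      F '' s ∈ bdry γ 𝒢₀ {{z : ℍ | (N⁻¹ • z).re = 0}} (cycleLift Xᶜ)) :
    AreCongruent X Xᶜ := by
  obtain ⟨e, he, hre, hG⟩ := exists_sign_of_normalizes_dil (conj N F)
    (mul_ne_zero (Int.cast_ne_zero.2 hk) hγ.1) ((zpow_smul_eq_conj hγ.zpow_smul F).1 hF)
  refine h.areCongruent hn hX he (fun i => (zpow_smul_eq_conj hγ.zpow_smul F).2 fun z => ?_) ?_
  · rw [hG]
    push_cast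
    ring_nf
  · intro s hs
    -- Only points of the axis are mapped to the axis by `F`, and no translate of `𝒢₀` meets the
    -- axis.
    refine (himg s hs).resolve_right fun hax => ?_
    obtain ⟨i, hi, a, ha, rfl⟩ := hs
    obtain ⟨z, hz⟩ := (h.geodesics a ha).nonempty
    have h1 : F (γ ^ i • z) ∈ F '' (γ ^ i • a) := mem_image_of_mem _ (smul_mem_smul_set hz)
    rw [mem_singleton_iff.1 hax] at h1
    have h2 := hre (N⁻¹ • γ ^ i • z) (by rw [conj_apply, smul_inv_smul]; exact h1)
    have h3 := (hγ.axis_subset h hU).1 i h2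
    exact h.subset_compl a ha hz ((smul_mem_smul_set_iff).1 h3)

end

/-! ### The surfaces of the construction -/

theorem nontrivial_cycleLift {n : ℕ} (hn : 0 < n) {X : Finset (Fin (2 * n))} (hX : X.card = n) :
    (cycleLift X).Nontrivial := by
  have : NeZero (2 * n) := ⟨by omega⟩
  obtain ⟨v, hv⟩ := Finset.card_pos.1 (hX.trans_gt hn)
  have h1 : ((v : ℕ) : ℤ) ∈ cycleLift X := mem_cycleLift.2 (by rwa [res_coe])
  exact ⟨_, h1, (v : ℕ) + (2 * n : ℕ), (cycleLift_add X (dvd_refl _)).2 h1, by omega⟩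

theorem interior_closure_halfPlane (M : SL(2, ℝ)) :
    interior {z : ℍ | 0 ≤ (M • z).re} = halfPlane M := by
  have h1 : {z : ℍ | 0 ≤ (M • z).re} = (halfPlane (rot (Real.pi / 2) * M))ᶜ := by
    rw [halfPlane_rot, compl_ofPred]
    simp only [not_lt]
  rw [h1, interior_compl, closure_halfPlane, compl_ofPred]
  ext z
  obtain ⟨k, hk, h⟩ := rot_half_pi_smul_re (M • z)
  simp only [halfPlane, mem_ofPred_eq, not_le, mul_smul, h, neg_lt_zero, mul_pos_iff_of_pos_left hk]

theorem interior_inter_closed {D : Set ℍ} (hD : IsOpen D) (M : SL(2, ℝ)) :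
    interior (D ∩ {z | 0 ≤ (M • z).re}) = D ∩ halfPlane M := by
  rw [interior_inter, hD.interior_eq, interior_closure_halfPlane]

theorem inter_closed_subset_closure {D : Set ℍ} (hD : IsOpen D) (M : SL(2, ℝ)) :
    D ∩ {z | 0 ≤ (M • z).re} ⊆ closure (D ∩ halfPlane M) := by
  rw [← closure_halfPlane]
  exact hD.inter_closure

/-- Replaces the truncated region, which contains its boundary axis, by an open intersection of half
planes with the same frontier. -/
theorem frontier_inter_closed {D : Set ℍ} (hD : IsOpen D) (M : SL(2, ℝ)) :
    frontier (D ∩ {z | 0 ≤ (M • z).re}) = frontier (D ∩ halfPlane M) := by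
  rw [frontier, frontier, interior_inter_closed hD, (hD.inter (isOpen_halfPlane M)).interior_eq]
  congr 1
  refine subset_antisymm (closure_minimal (inter_closed_subset_closure hD M) isClosed_closure)
    (closure_mono (inter_subset_inter_right _ fun z hz => ?_))
  exact le_of_lt (show 0 < (M • z).re from hz)

theorem zpow_natCast_zpow (γ : SL(2, ℝ)) (m : ℕ) (k : ℤ) : (γ ^ m) ^ k = γ ^ ((m : ℤ) * k) := by
  rw [zpow_mul, zpow_natCast]

section
variable {γ N : SL(2, ℝ)} {t : ℝ} {U : Set ℍ} {𝒢₀ : Set (Set ℍ)} {n m : ℕ}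
  {X : Finset (Fin (2 * n))} {D D' : Set ℍ}

theorem IsCore.exists_isFamily (hc : IsCore γ U 𝒢₀) (hn : 0 < n) (hX : X.card = n)
    (hm : 2 * n ∣ m) (hD : IsFace (translates γ 𝒢₀ (cycleLift X)) D) :
    ∃ 𝒦, IsFamily 𝒦 ∧ D = ⋂₀ 𝒦 ∧ frontier '' 𝒦 = translates γ 𝒢₀ (cycleLift X) ∧
      (∀ K ∈ 𝒦, ∃ i : ℤ, γ ^ i • U ⊆ K) ∧ IsInvariant (Subgroup.zpowers (γ ^ m)) D := by
  obtain ⟨S, hS⟩ := hc.exists_isSide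
  have hA := nontrivial_cycleLift hn hX
  have hDS := hc.eq_sInter hS hA hD
  refine ⟨_, hc.isFamily hS hA hD, hDS, hS.frontier_image_sides, ?_, ?_⟩
  · rintro _ ⟨i, -, a, ha, rfl⟩
    exact ⟨i, smul_set_mono (hS a ha).2.2⟩
  · rintro _ ⟨k, rfl⟩ z hz
    rw [hDS] at hz ⊢
    show (γ ^ m) ^ k • z ∈ _
    rw [zpow_natCast_zpow]
    refine zpow_smul_mem_sInter_sides (fun i hi => ?_) hz
    have hdvd : ((2 * n : ℕ) : ℤ) ∣ (m : ℤ) * k := (Int.natCast_dvd_natCast.2 hm).mul_right k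
    rwa [← cycleLift_add X hdvd, sub_add_cancel]

theorem IsTranslation.isRegion (hγ : IsTranslation γ N t) (hc : IsCore γ U 𝒢₀) (hn : 0 < n)
    (hX : X.card = n) (hm0 : 0 < m) (hm : 2 * n ∣ m)
    (hD : IsFace (translates γ 𝒢₀ (cycleLift X)) D) :
    IsRegion (Subgroup.zpowers (γ ^ m)) D ∧ IsPuncturedSurface (CyclicQuotient γ m D) ∧
      boundaryGeodesics D = translates γ 𝒢₀ (cycleLift X) := by
  obtain ⟨𝒦, hfam, rfl, hfr, hU, hinv⟩ := hc.exists_isFamily hn hX hm hD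
  obtain ⟨r, hr, hball⟩ := hγ.exists_horoball hc
  have hball' : ∀ z : ℍ, r < z.im → N • z ∈ ⋂₀ 𝒦 := by
    intro z hz K hK
    obtain ⟨i, hi⟩ := hU K hK
    exact hi (hball z hz i)
  have hne : (⋂₀ 𝒦).Nonempty := ⟨_, hball' ⟨⟨0, r + 1⟩, by show 0 < r + 1; linarith⟩ (by
    show r < r + 1; linarith)⟩
  have hdisc := hγ.actsFreely.isDiscontinuous m
  refine ⟨⟨hdisc, hinv, hfam.isHConvex, hne, ?_⟩,
    ⟨isHyperbolicSurface_of_isOpen hdisc hinv hfam.isHConvex hne hfam.isOpen_sInter,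
      (hγ.pow hm0).hasCusp hinv hr hball'⟩, by rw [hfam.boundaryGeodesics_eq, hfr]⟩
  rw [hfam.isOpen_sInter.interior_eq]
  exact subset_closure

theorem IsDilation.isRegion (hγ : IsDilation γ N t) (hc : IsCore γ U 𝒢₀)
    (hUN : frontier U ⊆ halfPlane N⁻¹) (hn : 0 < n)
    (hX : X.card = n) (hm0 : 0 < m) (hm : 2 * n ∣ m)
    (hD : IsFace (translates γ 𝒢₀ (cycleLift X)) D) :
    IsRegion (Subgroup.zpowers (γ ^ m)) (D ∩ {z | 0 ≤ (N⁻¹ • z).re}) ∧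
      HasOneGeodesicBoundary (CyclicQuotient γ m (D ∩ {z | 0 ≤ (N⁻¹ • z).re})) ∧
      boundaryGeodesics (D ∩ {z | 0 ≤ (N⁻¹ • z).re})
        = bdry γ 𝒢₀ {{z : ℍ | (N⁻¹ • z).re = 0}} (cycleLift X) := by
  obtain ⟨𝒦, hfam, rfl, hfr, hU, hinv⟩ := hc.exists_isFamily hn hX hm hD
  obtain ⟨hax, hUc⟩ := hγ.axis_subset hc hUN
  have haxis : {z : ℍ | (N⁻¹ • z).re = 0} ⊆ ⋂₀ 𝒦 := by
    intro z hz K hK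
    obtain ⟨i, hi⟩ := hU K hK
    exact hi (hax i hz)
  have hdisc := hγ.actsFreely.isDiscontinuous m
  have hinv' : IsInvariant (Subgroup.zpowers (γ ^ m)) (⋂₀ 𝒦 ∩ {z | 0 ≤ (N⁻¹ • z).re}) := by
    rintro _ ⟨k, rfl⟩ z hz
    refine ⟨hinv _ ⟨k, rfl⟩ z hz.1, ?_⟩
    show 0 ≤ (N⁻¹ • (γ ^ m) ^ k • z).re
    rw [zpow_natCast_zpow, hγ.smul_axis_iff]
    exact mul_nonneg (Real.exp_pos _).le hz.2
  refine ⟨⟨hdisc, hinv', hfam.isHConvex.inter (isHConvex_closed _), ?_, ?_⟩,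
    (hγ.pow hm0).hasOneGeodesicBoundary hdisc hinv' hfam.isHConvex hfam.isOpen_sInter haxis, ?_⟩
  · have h0 : (N⁻¹ • N • UpperHalfPlane.I).re = 0 := by simp
    exact ⟨N • UpperHalfPlane.I, haxis h0, h0.ge⟩
  · rw [interior_inter_closed hfam.isOpen_sInter]
    exact inter_closed_subset_closure hfam.isOpen_sInter _
  -- The half plane of the axis can join the family: `Kᶜ` lies in a translate of `Uᶜ`, hence
  -- strictly to one side of the axis.
  · have hd : ∀ K ∈ 𝒦, Disjoint (halfPlane N⁻¹)ᶜ Kᶜ := by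
      intro K hK
      obtain ⟨i, hi⟩ := hU K hK
      rw [disjoint_compl_left_iff_subset]
      intro z hz
      have h1 : z ∈ γ ^ i • Uᶜ := by
        rw [smul_set_compl]
        exact fun h => hz (hi h)
      obtain ⟨w, hw, rfl⟩ := h1
      show 0 < (N⁻¹ • γ ^ i • w).re
      rw [hγ.smul_axis_iff]
      exact mul_pos (Real.exp_pos _) (hUc hw)
    have hfam' : IsFamily (insert (halfPlane N⁻¹) 𝒦) := by
      constructor
      · rintro K (rfl | hK)
        · exact ⟨_, rfl⟩
        · exact hfam.isHalfPlane K hK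
      · rintro K (rfl | hK) L (rfl | hL) hne
        · exact (hne rfl).elim
        · exact hd L hL
        · exact (hd K hK).symm
        · exact hfam.disjoint_compl K hK L hL hne
    have h1 := hfam'.boundaryGeodesics_eq
    rw [sInter_insert, inter_comm, image_insert_eq, frontier_halfPlane, hfr, insert_eq,
      union_comm] at h1
    rw [bdry, ← h1, boundaryGeodesics, frontier_inter_closed hfam.isOpen_sInter]
    rfl

theorem IsTranslation.areCongruent_of_areCommensurable (hγ : IsTranslation γ N t)
    (hc : IsCore γ U 𝒢₀) (hn : 0 < n) (hX : X.card = n) (hm0 : 0 < m)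
    (hR : IsRegion (Subgroup.zpowers (γ ^ m)) D) (hR' : IsRegion (Subgroup.zpowers (γ ^ m)) D')
    (hB : boundaryGeodesics D = translates γ 𝒢₀ (cycleLift X))
    (hB' : boundaryGeodesics D' = translates γ 𝒢₀ (cycleLift Xᶜ))
    (h : AreCommensurable (CyclicQuotient γ m D) (CyclicQuotient γ m D')) : AreCongruent X Xᶜ := by
  obtain ⟨F, hF, k, l, hk, hkl⟩ := h.exists_isometryEquiv hR hR'
  simp only [zpow_natCast_zpow] at hkl
  refine hγ.areCongruent hc hn hX (mul_ne_zero (Int.natCast_ne_zero.2 hm0.ne') hk) hkl ?_ ?_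
  · rw [← hB, ← hB']
    exact fun s => image_mem_boundaryGeodesics F hF
  · rw [← hB, ← hB']
    exact fun s => image_mem_boundaryGeodesics F.symm fun z => by rw [hF, F.apply_symm_apply]

theorem IsDilation.areCongruent_of_areCommensurable (hγ : IsDilation γ N t)
    (hc : IsCore γ U 𝒢₀) (hUN : frontier U ⊆ halfPlane N⁻¹) (hn : 0 < n) (hX : X.card = n)
    (hm0 : 0 < m) (hR : IsRegion (Subgroup.zpowers (γ ^ m)) D)
    (hR' : IsRegion (Subgroup.zpowers (γ ^ m)) D')
    (hB : boundaryGeodesics D = bdry γ 𝒢₀ {{z : ℍ | (N⁻¹ • z).re = 0}} (cycleLift X))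
    (hB' : boundaryGeodesics D' = bdry γ 𝒢₀ {{z : ℍ | (N⁻¹ • z).re = 0}} (cycleLift Xᶜ))
    (h : AreCommensurable (CyclicQuotient γ m D) (CyclicQuotient γ m D')) : AreCongruent X Xᶜ := by
  obtain ⟨F, hF, k, l, hk, hkl⟩ := h.exists_isometryEquiv hR hR'
  simp only [zpow_natCast_zpow] at hkl
  refine hγ.areCongruent hc hUN hn hX (mul_ne_zero (Int.natCast_ne_zero.2 hm0.ne') hk) hkl
    fun s hs => ?_
  rw [← hB']
  exact image_mem_boundaryGeodesics F hF (by rw [hB]; exact Or.inl hs)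

theorem card_compl_eq {X : Finset (Fin (2 * n))} (hX : X.card = n) : Xᶜ.card = n := by
  rw [Finset.card_compl, hX, Fintype.card_fin]
  omega

/-- Only the implication from commensurability to congruence needs work; the one from isometry
follows, as isometric surfaces are commensurable. -/
theorem IsPair.parabolic {g : Set ℍ} (hγ : Parabolic γ) (h : IsPair γ g 𝒢₀ X m D D') :
    IsPuncturedSurface (CyclicQuotient γ m D) ∧ IsPuncturedSurface (CyclicQuotient γ m D') ∧
      SameOrthoSpectrum γ m D D' ∧
      (AreIsometric (CyclicQuotient γ m D) (CyclicQuotient γ m D') → AreCongruent X Xᶜ) ∧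
      (AreCommensurable (CyclicQuotient γ m D) (CyclicQuotient γ m D') → AreCongruent X Xᶜ) := by
  obtain ⟨N, t, hT⟩ := hγ.exists_isTranslation
  obtain ⟨U, -, -, hc⟩ := h.setup.exists_isCore fun i hi => hT.zpow_smul_ne h.setup.geodesic hi
  obtain ⟨hR, hP, hB⟩ := hT.isRegion hc h.n_pos h.card h.m_pos h.dvd h.face
  obtain ⟨hR', hP', hB'⟩ :=
    hT.isRegion hc h.n_pos (card_compl_eq h.card) h.m_pos h.dvd h.face_compl
  have hcong := hT.areCongruent_of_areCommensurable hc h.n_pos h.card h.m_pos hR hR' hB hB'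
  refine ⟨hP, hP', ?_, fun hiso => hcong (hiso.areCommensurable hR), hcong⟩
  exact hc.sameOrthoSpectrum (𝓔 := ∅) (by simp) (by simp) h.n_pos h.card h.dvd
    (by rw [hB, bdry, union_empty]) (by rw [hB', bdry, union_empty])

theorem IsPair.hyperbolic {g H : Set ℍ} (hγ : HyperbolicWithSide γ g H)
    (h : IsPair γ g 𝒢₀ X m D D') :
    HasOneGeodesicBoundary (CyclicQuotient γ m (D ∩ H)) ∧
      HasOneGeodesicBoundary (CyclicQuotient γ m (D' ∩ H)) ∧
      SameOrthoSpectrum γ m (D ∩ H) (D' ∩ H) ∧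
      (AreIsometric (CyclicQuotient γ m (D ∩ H)) (CyclicQuotient γ m (D' ∩ H)) →
        AreCongruent X Xᶜ) ∧
      (AreCommensurable (CyclicQuotient γ m (D ∩ H)) (CyclicQuotient γ m (D' ∩ H)) →
        AreCongruent X Xᶜ) := by
  obtain ⟨N, t, hT, rfl, hg⟩ := hγ.exists_isDilation
  obtain ⟨U, -, hfr, hc⟩ :=
    h.setup.exists_isCore fun i hi => hT.zpow_smul_ne h.setup.geodesic hg hi
  rw [← hfr] at hg
  obtain ⟨hR, hP, hB⟩ := hT.isRegion hc hg h.n_pos h.card h.m_pos h.dvd h.face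
  obtain ⟨hR', hP', hB'⟩ :=
    hT.isRegion hc hg h.n_pos (card_compl_eq h.card) h.m_pos h.dvd h.face_compl
  have hcong := hT.areCongruent_of_areCommensurable hc hg h.n_pos h.card h.m_pos hR hR' hB hB'
  refine ⟨hP, hP', ?_, fun hiso => hcong (hiso.areCommensurable hR), hcong⟩
  refine hc.sameOrthoSpectrum ?_ ?_ h.n_pos h.card h.dvd hB hB'
  · rintro _ rfl
    exact (hT.axis_subset hc hg).1
  · rintro _ rfl i
    rw [mem_singleton_iff]
    ext z
    rw [mem_smul_set_iff_inv_smul_mem, ← zpow_neg]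
    rw [mem_ofPred_eq, mem_ofPred_eq, hT.smul_axis_iff]
    simp

theorem IsSetup.exists_isFace {g : Set ℍ} (h : IsSetup γ g {g})
    (hγ : Parabolic γ ∨ ∃ H, HyperbolicWithSide γ g H) (A : Set ℤ) :
    ∃ D, IsFace (translates γ {g} A) D := by
  rcases hγ with hγ | ⟨H, hγ⟩
  · obtain ⟨N, t, hT⟩ := hγ.exists_isTranslation
    obtain ⟨U, -, hfr, hc⟩ := h.exists_isCore fun i hi => hT.zpow_smul_ne h.geodesic hi
    obtain ⟨r, hr, hball⟩ := hT.exists_horoball hc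
    exact hc.exists_isFace hfr (hball ⟨⟨0, r + 1⟩, by show 0 < r + 1; linarith⟩ (by
      show r < r + 1; linarith)) A
  · obtain ⟨N, t, hT, -, hg⟩ := hγ.exists_isDilation
    obtain ⟨U, -, hfr, hc⟩ := h.exists_isCore fun i hi => hT.zpow_smul_ne h.geodesic hg hi
    rw [← hfr] at hg
    refine hc.exists_isFace hfr (x := N • UpperHalfPlane.I) (fun i => ?_) A
    exact (hT.axis_subset hc hg).1 i (by simp)

end

/-! ### Examples -/

theorem isSetup_singleton {γ M : SL(2, ℝ)}
    (h : ∀ i : ℤ, i ≠ 0 → ∀ z : ℍ, form M z = 0 → 0 < form M (γ ^ i • z)) :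
    IsSetup γ {z | (M • z).re = 0} {{z | (M • z).re = 0}} := by
  set g := {z : ℍ | (M • z).re = 0} with hg
  have hsub : ∀ i : ℤ, i ≠ 0 → γ ^ i • g ⊆ halfPlane M := by
    rintro i hi _ ⟨z, hz, rfl⟩
    exact (smul_re_pos_iff M _).2 (h i hi z ((smul_re_eq_zero_iff M z).1 hz))
  have hd : g ⊆ (halfPlane M)ᶜ := fun z hz hz' => hz'.ne' hz
  have hne : ∀ i : ℤ, γ ^ i • g ≠ g → i ≠ 0 := by
    rintro i hi rfl
    exact hi (by rw [zpow_zero, one_smul])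
  have hgeo : IsGeodesic g := isGeodesic_iff.2 ⟨M, rfl⟩
  refine ⟨hgeo, fun i => ?_, singleton_nonempty _, fun a ha => by rwa [mem_singleton_iff.1 ha],
    pairwiseDisjoint_singleton _ _, halfPlane M, ?_, fun i hi => hsub i (hne i hi),
    fun a ha => by rwa [mem_singleton_iff.1 ha]⟩
  · by_cases hi : i = 0
    · exact Or.inr (by rw [hi, zpow_zero, one_smul])
    · exact Or.inl (disjoint_left.2 fun z hz hz' => hd hz (hsub i hi hz'))
  · rw [hg, ← frontier_halfPlane]
    exact IsHalfPlane.isComponentOf ⟨M, rfl⟩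

theorem exists_parabolic_isSetup :
    ∃ (γ : SL(2, ℝ)) (g : Set ℍ), Parabolic γ ∧ IsSetup γ g {g} := by
  have hT : IsTranslation (trans 2) 1 2 := ⟨two_ne_zero, fun z => by simp⟩
  -- The semicircle `|z| = 1 / 2` and the translation by 2.
  refine ⟨trans 2, _, ⟨?_, ?_⟩,
    isSetup_singleton (M := mkSL 1 (-1 / 2) 1 (1 / 2) (by norm_num)) fun i hi z hz => ?_⟩
  · rintro ⟨a, ha⟩
    have h1 := congrFun (congrFun ha 0) 1
    simp [trans, mkSL] at h1
  · rw [Matrix.discr_fin_two, Matrix.trace_fin_two, (trans 2).det_coe]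
    simp [trans]
    norm_num
  · have h1 := hT.zpow_smul i z
    rw [one_smul, one_smul] at h1
    rw [h1]
    simp only [form, mkSL_zero_zero, mkSL_zero_one, mkSL_one_zero, mkSL_one_one, trans_smul_re,
      trans_smul_im] at hz ⊢
    have hy := z.im_pos
    have hx : |z.re| < 1 := abs_lt_of_sq_lt_sq (by nlinarith) one_pos.le
    have hx' := abs_lt.1 hx
    rcases lt_or_gt_of_ne hi with h | h
    · have h2 : (i : ℝ) ≤ -1 := by exact_mod_cast Int.le_sub_one_of_lt h
      nlinarith
    · have h2 : (1 : ℝ) ≤ i := by exact_mod_cast h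
      nlinarith

theorem exists_hyperbolic_isSetup :
    ∃ (γ : SL(2, ℝ)) (g H : Set ℍ), HyperbolicWithSide γ g H ∧ IsSetup γ g {g} := by
  have h4 : 0 < Real.log 4 := Real.log_pos (by norm_num)
  have hexp : Real.exp (Real.log 4) = 4 := Real.exp_log (by norm_num)
  obtain ⟨γ, hγ, hT⟩ : ∃ γ : SL(2, ℝ), (γ : Matrix (Fin 2) (Fin 2) ℝ).IsHyperbolic ∧
      IsDilation γ 1 (Real.log 4) := by
    refine ⟨mkSL 2 0 0 (1 / 2) (by norm_num), ?_, h4.ne', fun z => ?_⟩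
    · rw [Matrix.IsHyperbolic, Matrix.discr_fin_two, Matrix.trace_fin_two,
        Matrix.SpecialLinearGroup.det_coe]
      simp
      norm_num
    · rw [one_smul, one_smul]
      apply ext_re_im
      · rw [dil_smul_re, smul_re, hexp]
        simp
        ring
      · rw [dil_smul_im, smul_im, hexp]
        simp
        ring
  -- The semicircle with ends 1 and 2, which the dilation by 4 moves to one with ends 4 and 8.
  obtain ⟨M, hM⟩ : ∃ M : SL(2, ℝ), ∀ z, form M z = z.re ^ 2 + z.im ^ 2 - 3 * z.re + 2 :=
    ⟨mkSL 1 (-2) 1 (-1) (by norm_num), fun z => by simp [form]; ring⟩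
  have hre : ∀ z : ℍ, form M z = 0 → 1 < z.re ∧ z.re < 2 := by
    intro z hz
    rw [hM] at hz
    have hy : 0 < z.im ^ 2 := pow_pos z.im_pos 2
    constructor <;> nlinarith
  refine ⟨γ, {z : ℍ | (M • z).re = 0}, _,
    ⟨hγ, {z : ℍ | ((1 : SL(2, ℝ)) • z).re = 0}, isGeodesic_iff.2 ⟨1, rfl⟩, ?_, ?_, halfPlane 1, ?_, ?_,
      rfl⟩, isSetup_singleton fun i hi z hz => ?_⟩
  · ext z
    have h1 := hT.smul_axis_iff (-1) z
    rw [mem_smul_set_iff_inv_smul_mem]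
    simp only [mem_ofPred_eq, one_smul]
    rw [inv_one, one_smul, one_smul, zpow_neg_one] at h1
    rw [h1]
    simp
  · refine disjoint_left.2 fun z hz hz' => ?_
    have h1 := (hre z ((smul_re_eq_zero_iff _ z).1 hz')).1
    rw [mem_ofPred_eq, one_smul] at hz
    linarith
  · rw [← frontier_halfPlane]
    exact IsHalfPlane.isComponentOf ⟨1, rfl⟩
  · intro z hz
    have h1 := (hre z ((smul_re_eq_zero_iff _ z).1 hz)).1
    show 0 < ((1 : SL(2, ℝ)) • z).re
    rw [one_smul]
    linarith
  · obtain ⟨hx1, hx2⟩ := hre z hz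
    have h1 := hT.zpow_smul i z
    rw [one_smul, one_smul] at h1
    rw [hM] at hz
    rw [h1, hM, dil_smul_re, dil_smul_im]
    set q := Real.exp (i * Real.log 4) with hq
    have hq0 : 0 < q := Real.exp_pos _
    -- On the semicircle `|z|² = 3x - 2`, and then the form at `q z` factors into this product. By
    -- `1 < x < 2` both factors have the same sign when `q ≥ 4` and when `q ≤ 1 / 4`.
    have key : 0 < (q - 1) * (3 * z.re * q - 2 * (q + 1)) := by
      rcases lt_or_gt_of_ne hi with h | h
      · have h2 : (i : ℝ) ≤ -1 := by exact_mod_cast Int.le_sub_one_of_lt h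
        have h3 : q ≤ 1 / 4 := by
          have : q ≤ Real.exp (-Real.log 4) := Real.exp_le_exp.2 (by nlinarith)
          rwa [Real.exp_neg, hexp, ← one_div] at this
        refine mul_pos_of_neg_of_neg (by linarith) ?_
        nlinarith
      · have h2 : (1 : ℝ) ≤ i := by exact_mod_cast h
        have h3 : 4 ≤ q := by
          rw [← hexp]
          exact Real.exp_le_exp.2 (by nlinarith)
        refine mul_pos (by linarith) ?_
        nlinarith
    linear_combination key - q ^ 2 * hz

end OrthoSurf

end

theorem mainTheorem4 :
    -- parabolic `γ`: punctured surfaces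
    (∀ (γ : SL(2, ℝ)) (g : Set ℍ) (𝒢₀ : Set (Set ℍ)) (n : ℕ) (X : Finset (Fin (2 * n))) (m : ℕ)
        (D D' : Set ℍ), Parabolic γ → IsPair γ g 𝒢₀ X m D D' →
      IsPuncturedSurface (CyclicQuotient γ m D) ∧
      IsPuncturedSurface (CyclicQuotient γ m D') ∧
      SameOrthoSpectrum γ m D D' ∧
      (¬ AreCongruent X Xᶜ →
        ¬ AreIsometric (CyclicQuotient γ m D) (CyclicQuotient γ m D'))) ∧
    -- hyperbolic `γ` with axis disjoint from `g`: surfaces with one totally geodesic boundary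
    (∀ (γ : SL(2, ℝ)) (g : Set ℍ) (𝒢₀ : Set (Set ℍ)) (n : ℕ) (X : Finset (Fin (2 * n))) (m : ℕ)
        (D D' H : Set ℍ), HyperbolicWithSide γ g H → IsPair γ g 𝒢₀ X m D D' →
      HasOneGeodesicBoundary (CyclicQuotient γ m (D ∩ H)) ∧
      HasOneGeodesicBoundary (CyclicQuotient γ m (D' ∩ H)) ∧
      SameOrthoSpectrum γ m (D ∩ H) (D' ∩ H) ∧
      (¬ AreCongruent X Xᶜ →
        ¬ AreIsometric (CyclicQuotient γ m (D ∩ H)) (CyclicQuotient γ m (D' ∩ H)))) ∧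
    -- the Mallows-Clark pair gives incommensurable surfaces in both cases
    (∀ (γ : SL(2, ℝ)) (g : Set ℍ) (𝒢₀ : Set (Set ℍ)) (m : ℕ) (D D' : Set ℍ),
      Parabolic γ → IsPair γ g 𝒢₀ mallowsClark m D D' →
      ¬ AreCommensurable (CyclicQuotient γ m D) (CyclicQuotient γ m D')) ∧
    (∀ (γ : SL(2, ℝ)) (g : Set ℍ) (𝒢₀ : Set (Set ℍ)) (m : ℕ) (D D' H : Set ℍ),
      HyperbolicWithSide γ g H → IsPair γ g 𝒢₀ mallowsClark m D D' →
      ¬ AreCommensurable (CyclicQuotient γ m (D ∩ H)) (CyclicQuotient γ m (D' ∩ H))) ∧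
    -- such surfaces exist, already for `𝒢₀ = {g}`
    (∃ (γ : SL(2, ℝ)) (g : Set ℍ), Parabolic γ ∧ IsSetup γ g {g}) ∧
    (∃ (γ : SL(2, ℝ)) (g H : Set ℍ), HyperbolicWithSide γ g H ∧ IsSetup γ g {g}) ∧
    (∀ (γ : SL(2, ℝ)) (g : Set ℍ), Parabolic γ ∨ (∃ H, HyperbolicWithSide γ g H) →
      IsSetup γ g {g} → ∀ A : Set ℤ, ∃ D : Set ℍ, IsFace (translates γ {g} A) D) := by
  refine ⟨fun γ g 𝒢₀ n X m D D' hγ h => ?_, fun γ g 𝒢₀ n X m D D' H hγ h => ?_,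
    fun γ g 𝒢₀ m D D' hγ h hcomm => ?_, fun γ g 𝒢₀ m D D' H hγ h hcomm => ?_,
    exists_parabolic_isSetup, exists_hyperbolic_isSetup, fun γ g hγ h A => h.exists_isFace hγ A⟩
  · obtain ⟨h1, h2, h3, h4, -⟩ := h.parabolic hγ
    exact ⟨h1, h2, h3, fun hX hiso => hX (h4 hiso)⟩
  · obtain ⟨h1, h2, h3, h4, -⟩ := h.hyperbolic hγ
    exact ⟨h1, h2, h3, fun hX hiso => hX (h4 hiso)⟩
  · exact not_areCongruent_mallowsClark ((h.parabolic hγ).2.2.2.2 hcomm)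
  · exact not_areCongruent_mallowsClark ((h.hyperbolic hγ).2.2.2.2 hcomm)
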